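/- **Setting.** Let $G$ be a real (finite-dimensional, smooth) Lie group with Lie algebra $\mathfrak g$, and let $D\subset\mathfrak g$ be a linear subspace that generates $\mathfrak g$ in the following sense: with $V^0=0$, $V^1=D$, $V^{i+1}=V^i+[D,V^i]$, one has $V^m=\mathfrak g$ for some $m$. The left translates of $D$ form a bracket-generating left-invariant distribution. Let $$\mathfrak n(\mathfrak g,D)=\bigoplus_{i\ge 1}V^i/V^{i-1},\qquad [x+V^{i-1},\,y+V^{j-1}]=[x,y]+V^{i+j-1}\quad(x\in V^i,\ y\in V^j),$$ and let $N(G,D)$ be the simply connected Lie group with Lie algebra $\mathfrak n(\mathfrak g,D)$. An *adapted basis* of $\mathfrak g$ is a basis $(X_j)$ with weights $l_j\in\mathbb N$ such that $V^i=\mathrm{span}\{X_j: l_j\le i\}$ for all $i$. It gives the dilatations $\delta_\varepsilon X_j=\varepsilon^{l_j}X_j$ ($\varepsilon>0$) and the linear isomorphism $b:\mathfrak g\to\mathfrak n(\mathfrak g,D)$, $b(X_j)=X_j+V^{l_j-1}$. We identify a neighbourhood of the identity of $N(G,D)$ with a neighbourhood of $0$ in $\mathfrak g$ by $\exp_N\circ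 b$, and write $X\stackrel{\mathfrak n}{\cdot}Y=b^{-1}\log_N(\exp_N(bX)\exp_N(bY))$ for the transported operation. For a local group $M$ (neutral element $e$) with a local action $\delta$ of $(0,\infty)$ at $e$, consider the hypotheses (H0) $\delta_\varepsilon(e)=e$ and $\delta_\varepsilon x\to e$ as $\varepsilon\to0$, uniformly for $x$ near $e$; (H1) $\beta(x,y)=\lim_{\varepsilon\to0}\delta_\varepsilon^{-1}\big((\delta_\varepsilon x)(\delta_\varepsilon y)\big)$ exists, uniformly for $x,y$ near $e$; (H2) $\lim_{\varepsilon\to0}\delta_\varepsilon^{-1}\big((\delta_\varepsilon x)^{-1}\big)$ exists, uniformly for $x$ near $e$. When they hold, the *virtual tangent space* $VT_eM$ is the local group, under composition, of the transformations $L^N_x:y\mapsto\beta(x,y)$, $x$ near $e$. Since $L^N_x\circ L^N_y=L^N_{\beta(x,y)}$ and $L^N_x e=x$, its operation is $\beta$ when it is parametrised by $x$. Let $\log G$ be the local group on a neighbourhood of $0$ in $\mathfrak g$ with operation $XY=\log_G(\exp_G X\exp_G Y)$ and dilatations $\delta_\varepsilon$, and equip $G$ near its identity $e$ with the dilatations $\exp_G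 X\mapsto\exp_G(\delta_\varepsilon X)$. **Theorem.** Adapted bases and the group $N(G,D)$ exist. For every adapted basis: 1. $\log G$ and $G$, with these dilatations, satisfy (H0), (H1), (H2), and $VT_0\log G$ and $VT_eG$ are local groups; $\exp_G$ is an isomorphism of local groups from $\log G$ to $G$, and $\exp_N\circ b$ is one from $(\mathfrak g,\stackrel{\mathfrak n}{\cdot})$, near $0$, to $N(G,D)$. 2. $N(G,D)=VT_0\log G$ as local groups: for all $X,Y$ in a neighbourhood of $0$ in $\mathfrak g$, $L^N_X(Y)=\beta(X,Y)=X\stackrel{\mathfrak n}{\cdot}Y$. 3. $VT_eG$ is isomorphic to $N(G,D)$ as a local group, by $g\mapsto\exp_N(b(\log_G g))$. -/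

import Mathlib

open Filter Topology Set
open scoped Manifold ContDiff DirectSum

universe u

noncomputable section

namespace SubRiemLie

/-! ## The filtration generated by a subspace, and the nilpotentisation -/

section Algebra

variable {L : Type*} [LieRing L] [LieAlgebra ℝ L]

/-- The filtration `V⁰ = 0`, `V¹ = D`, `Vⁱ⁺¹ = Vⁱ + [D, Vⁱ]` generated by a subspace `D`. -/
def filtration (D : Submodule ℝ L) : ℕ → Submodule ℝ L
  | 0 => ⊥
  | 1 => D
  | i + 2 => filtration D (i + 1) ⊔
      Submodule.span ℝ {z | ∃ x ∈ D, ∃ y ∈ filtration D (i + 1), z = ⁅x, y⁆}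

/-- `D` generates the Lie algebra: the filtration reaches the whole algebra. -/
def IsBracketGenerating (D : Submodule ℝ L) : Prop := ∃ m, filtration D m = ⊤

variable (D : Submodule ℝ L)

lemma filtration_succ (i : ℕ) : filtration D i ≤ filtration D (i + 1) := by
  rcases i with _ | i
  · exact bot_le
  · exact le_sup_left

lemma filtration_mono : Monotone (filtration D) := monotone_nat_of_le_succ (filtration_succ D)

lemma lie_mem_filtration_left {x y : L} (hx : x ∈ D) {j : ℕ} (hy : y ∈ filtration D j) :
    ⁅x, y⁆ ∈ filtration D (j + 1) := by
  rcases j with _ | j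
  · have : y = 0 := by simpa [filtration] using hy
    simp [this]
  · exact Submodule.mem_sup_right (Submodule.subset_span ⟨x, hx, y, hy, rfl⟩)

lemma lie_mem_filtration (i : ℕ) : ∀ (j : ℕ) {x y : L}, x ∈ filtration D i → y ∈ filtration D j →
    ⁅x, y⁆ ∈ filtration D (i + j) := by
  induction i with
  | zero =>
    intro j x y hx _
    have : x = 0 := by simpa [filtration] using hx
    simp [this]
  | succ i ih =>
    intro j x y hx hy
    rcases i with _ | i
    · have := lie_mem_filtration_left D (x := x) (by simpa [filtration] using hx) hy
      rwa [add_comm] at this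
    · have hle : filtration D (i + 1 + j) ≤ filtration D (i + 1 + 1 + j) :=
        filtration_mono D (by omega)
      have hsub : filtration D (i + 1 + 1) ≤
          (filtration D (i + 1 + 1 + j)).comap ((LieModule.toEnd ℝ L L : L →ₗ[ℝ] Module.End ℝ L).flip y) := by
        refine sup_le (fun z hz => hle (ih j hz hy)) (Submodule.span_le.2 ?_)
        rintro _ ⟨d, hd, z, hz, rfl⟩
        change ⁅⁅d, z⁆, y⁆ ∈ filtration D (i + 1 + 1 + j)
        rw [lie_lie]
        refine Submodule.sub_mem _ ?_ ?_
        · have := lie_mem_filtration_left D hd (ih j hz hy)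
          exact filtration_mono D (by omega) this
        · have := ih (j + 1) hz (lie_mem_filtration_left D hd hy)
          exact filtration_mono D (by omega) this
      exact hsub hx

/-- The graded piece `Vⁱ / Vⁱ⁻¹` (for `i = 0` this is the zero space `0 / 0`). -/
abbrev GradedPiece (i : ℕ) : Type _ :=
  filtration D i ⧸ (filtration D (i - 1)).submoduleOf (filtration D i)

/-- The bracket `Vⁱ × Vʲ → Vⁱ⁺ʲ` of the Lie algebra. -/
def filtrationBracket (i j : ℕ) :
    filtration D i →ₗ[ℝ] filtration D j →ₗ[ℝ] filtration D (i + j) :=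
  LinearMap.mk₂ ℝ (fun x y => ⟨⁅(x : L), (y : L)⁆, lie_mem_filtration D i j x.2 y.2⟩)
    (fun x x' y => by ext; simp) (fun c x y => by ext; simp)
    (fun x y y' => by ext; simp) (fun c x y => by ext; simp)

/-- The bracket `Vⁱ/Vⁱ⁻¹ × Vʲ/Vʲ⁻¹ → Vⁱ⁺ʲ/Vⁱ⁺ʲ⁻¹` induced on classes. -/
def gradedBracket (i j : ℕ) :
    GradedPiece D i →ₗ[ℝ] GradedPiece D j →ₗ[ℝ] GradedPiece D (i + j) :=
  Submodule.liftQ _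
    (LinearMap.flip (Submodule.liftQ _
      (((filtrationBracket D i j).compr₂ (Submodule.mkQ _)).flip) (by
        intro y hy
        ext x
        change Submodule.Quotient.mk _ = 0
        rw [Submodule.Quotient.mk_eq_zero]
        rcases j with _ | j
        · have : (y : L) = 0 := by simpa [filtration] using y.2
          have h : filtrationBracket D i 0 x y = 0 := by
            ext; simp [filtrationBracket, this]
          rw [h]; exact Submodule.zero_mem _
        · exact lie_mem_filtration D i j x.2 hy)))
    (by
      intro x hx
      ext y
      change Submodule.Quotient.mk _ = 0
      rw [Submodule.Quotient.mk_eq_zero]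
      rcases i with _ | i
      · have : (x : L) = 0 := by simpa [filtration] using x.2
        have h : filtrationBracket D 0 j x y = 0 := by
          ext; simp [filtrationBracket, this]
        rw [h]; exact Submodule.zero_mem _
      · refine filtration_mono D (by omega : i + j ≤ _) ?_
        exact lie_mem_filtration D i j hx y.2)

/-- The nilpotentisation `𝔫(𝔤, D) = ⨁ᵢ Vⁱ / Vⁱ⁻¹`. -/
def Nilpotentisation : Type _ := ⨁ i, GradedPiece D i

instance : AddCommGroup (Nilpotentisation D) :=
  inferInstanceAs (AddCommGroup (⨁ i, GradedPiece D i))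

instance : Module ℝ (Nilpotentisation D) :=
  inferInstanceAs (Module ℝ (⨁ i, GradedPiece D i))

namespace Nilpotentisation

/-- The inclusion of a graded piece. -/
def incl (i : ℕ) : GradedPiece D i →ₗ[ℝ] Nilpotentisation D :=
  DirectSum.lof ℝ ℕ (fun i => GradedPiece D i) i

/-- The linear map out of the direct sum given by linear maps out of the graded pieces. -/
def desc {M : Type*} [AddCommGroup M] [Module ℝ M] (f : ∀ i, GradedPiece D i →ₗ[ℝ] M) :
    Nilpotentisation D →ₗ[ℝ] M :=
  DirectSum.toModule ℝ ℕ M f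

lemma desc_incl {M : Type*} [AddCommGroup M] [Module ℝ M] (f : ∀ i, GradedPiece D i →ₗ[ℝ] M)
    (i : ℕ) (x : GradedPiece D i) : desc D f (incl D i x) = f i x :=
  DirectSum.toModule_lof ℝ i x

/-- The class `x + Vⁱ⁻¹` of an element `x` of `Vⁱ`. -/
def cls (i : ℕ) (x : filtration D i) : Nilpotentisation D := incl D i (Submodule.Quotient.mk x)

/-- The bracket of `𝔫(𝔤, D)`, as a bilinear map. -/
def bracketₗ : Nilpotentisation D →ₗ[ℝ] Nilpotentisation D →ₗ[ℝ] Nilpotentisation D :=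
  desc D fun i => LinearMap.flip <| desc D fun j =>
    LinearMap.flip ((gradedBracket D i j).compr₂ (incl D (i + j)))

variable {D}

lemma cls_congr {i j : ℕ} (h : i = j) {x : filtration D i} {y : filtration D j}
    (hxy : (x : L) = y) : cls D i x = cls D j y := by
  subst h
  congr 1
  exact Subtype.ext hxy

lemma cls_add (i : ℕ) (x y : filtration D i) : cls D i (x + y) = cls D i x + cls D i y := by
  simp [cls, Submodule.Quotient.mk_add]

lemma cls_neg (i : ℕ) (x : filtration D i) : cls D i (-x) = -cls D i x := by
  simp [cls, Submodule.Quotient.mk_neg]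

lemma bracketₗ_cls (i j : ℕ) (x : filtration D i) (y : filtration D j) :
    bracketₗ D (cls D i x) (cls D j y) =
      cls D (i + j) ⟨⁅(x : L), (y : L)⁆, lie_mem_filtration D i j x.2 y.2⟩ := by
  unfold bracketₗ cls
  rw [desc_incl, LinearMap.flip_apply, desc_incl]
  rfl

@[elab_as_elim]
lemma induction {p : Nilpotentisation D → Prop} (x : Nilpotentisation D) (h0 : p 0)
    (hc : ∀ i y, p (cls D i y)) (ha : ∀ x y, p x → p y → p (x + y)) : p x := by
  refine DirectSum.induction_on (motive := p) x h0 (fun i y => ?_) ha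
  obtain ⟨y, rfl⟩ := Submodule.Quotient.mk_surjective _ y
  exact hc i y

lemma bracketₗ_skew (x y : Nilpotentisation D) : bracketₗ D x y = -bracketₗ D y x := by
  induction x using induction with
  | h0 => simp
  | ha a b ha hb => rw [map_add, LinearMap.add_apply, ha, hb, map_add, neg_add]
  | hc i x =>
    induction y using induction with
    | h0 => simp
    | ha a b ha hb => rw [map_add, ha, hb, map_add, LinearMap.add_apply, neg_add]
    | hc j y =>
      rw [bracketₗ_cls, bracketₗ_cls, ← cls_neg]
      exact cls_congr (add_comm i j) (by simp)

lemma bracketₗ_jacobi (x y z : Nilpotentisation D) : bracketₗ D x (bracketₗ D y z) =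
    bracketₗ D (bracketₗ D x y) z + bracketₗ D y (bracketₗ D x z) := by
  induction x using induction with
  | h0 => simp
  | ha a b ha hb => simp only [map_add, LinearMap.add_apply, ha, hb]; abel
  | hc i x =>
    induction y using induction with
    | h0 => simp
    | ha a b ha hb => simp only [map_add, LinearMap.add_apply, ha, hb]; abel
    | hc j y =>
      induction z using induction with
      | h0 => simp
      | ha a b ha hb => simp only [map_add, ha, hb]; abel
      | hc k z =>
        simp only [bracketₗ_cls]
        rw [cls_congr (show j + (i + k) = i + j + k by omega)
            (y := ⟨⁅(y : L), ⁅(x : L), (z : L)⁆⁆, filtration_mono D (by omega)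
              (lie_mem_filtration D j (i + k) y.2 (lie_mem_filtration D i k x.2 z.2))⟩) rfl, ← cls_add]
        exact cls_congr (by omega) (by simp)

variable (D)

/-- The bracket of `𝔫(𝔤, D)`, given on classes by `[x + Vⁱ⁻¹, y + Vʲ⁻¹] = [x, y] + Vⁱ⁺ʲ⁻¹`. -/
instance : LieRing (Nilpotentisation D) where
  bracket x y := bracketₗ D x y
  add_lie x y z := by change bracketₗ D (x + y) z = _; rw [map_add]; rfl
  lie_add x y z := by exact map_add (bracketₗ D x) y z
  lie_self x := by
    have h := bracketₗ_skew x x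
    change bracketₗ D x x = 0
    have h2 : (2 : ℝ) • bracketₗ D x x = 0 := by
      rw [two_smul]; nth_rewrite 1 [h]; simp
    simpa using h2
  leibniz_lie x y z := bracketₗ_jacobi x y z

instance : LieAlgebra ℝ (Nilpotentisation D) where
  lie_smul c x y := by exact map_smul (bracketₗ D x) c y

end Nilpotentisation

/-- A basis of the Lie algebra adapted to the filtration: each basis vector has a weight `l`, and
`Vⁱ` is spanned by the basis vectors of weight at most `i`. -/
structure AdaptedBasis where
  basis : Module.Basis (Fin (Module.finrank ℝ L)) ℝ L
  weight : Fin (Module.finrank ℝ L) → ℕ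
  span_eq : ∀ i, filtration D i = Submodule.span ℝ (basis '' {j | weight j ≤ i})

namespace AdaptedBasis

variable {D} (B : AdaptedBasis D)

/-- The dilatation `δ_ε`, multiplying a basis vector of weight `i` by `εⁱ`. -/
def dil (ε : ℝ) : L →ₗ[ℝ] L := B.basis.constr ℝ fun j => ε ^ B.weight j • B.basis j

lemma mem_filtration (j : Fin (Module.finrank ℝ L)) :
    B.basis j ∈ filtration D (B.weight j) := by
  rw [B.span_eq]
  exact Submodule.subset_span ⟨j, le_refl (B.weight j), rfl⟩

/-- The linear map sending a basis vector `X` of weight `i` to its class `X + Vⁱ⁻¹`. -/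
def toNilₗ : L →ₗ[ℝ] Nilpotentisation D :=
  B.basis.constr ℝ fun j => Nilpotentisation.cls D (B.weight j) ⟨B.basis j, B.mem_filtration j⟩

lemma toNilₗ_basis (j : Fin (Module.finrank ℝ L)) : B.toNilₗ (B.basis j) =
    Nilpotentisation.cls D (B.weight j) ⟨B.basis j, B.mem_filtration j⟩ :=
  B.basis.constr_basis ℝ _ j

/-- The projection onto the span of the basis vectors of weight `i`. -/
def proj (i : ℕ) : L →ₗ[ℝ] L := B.basis.constr ℝ fun j => if B.weight j = i then B.basis j else 0

lemma proj_eq_zero {i k : ℕ} (h : k < i) {x : L} (hx : x ∈ filtration D k) : B.proj i x = 0 := by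
  have hle : filtration D k ≤ LinearMap.ker (B.proj i) := by
    rw [B.span_eq, Submodule.span_le]
    rintro _ ⟨j, hj, rfl⟩
    have hj' : B.weight j ≤ k := hj
    have : B.weight j ≠ i := by omega
    rw [SetLike.mem_coe, LinearMap.mem_ker, proj, B.basis.constr_basis, if_neg this]
  exact hle hx

lemma toNilₗ_injective : Function.Injective B.toNilₗ := by
  let g : Nilpotentisation D →ₗ[ℝ] L := Nilpotentisation.desc D fun i =>
    Submodule.liftQ _ ((B.proj i).domRestrict (filtration D i)) (by
      intro x hx
      change B.proj i x = 0
      rcases i with _ | i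
      · have : (x : L) = 0 := by simpa [filtration] using x.2
        simp [this]
      · exact B.proj_eq_zero (Nat.lt_succ_self i) hx)
  have hg : g ∘ₗ B.toNilₗ = LinearMap.id := by
    refine B.basis.ext fun j => ?_
    rw [LinearMap.comp_apply, toNilₗ_basis]
    unfold Nilpotentisation.cls
    rw [Nilpotentisation.desc_incl]
    change B.proj (B.weight j) (B.basis j) = B.basis j
    rw [proj, B.basis.constr_basis, if_pos rfl]
  exact Function.LeftInverse.injective (g := g) fun x => LinearMap.congr_fun hg x

lemma toNilₗ_surjective : Function.Surjective B.toNilₗ := by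
  rw [← LinearMap.range_eq_top, eq_top_iff]
  intro z _
  induction z using Nilpotentisation.induction with
  | h0 => exact Submodule.zero_mem _
  | ha x y hx hy => exact Submodule.add_mem _ (hx trivial) (hy trivial)
  | hc i x =>
    let c : filtration D i →ₗ[ℝ] Nilpotentisation D :=
      Nilpotentisation.incl D i ∘ₗ Submodule.mkQ _
    have hle : Submodule.span ℝ (B.basis '' {j | B.weight j ≤ i}) ≤
        ((LinearMap.range B.toNilₗ).comap c).map (filtration D i).subtype := by
      rw [Submodule.span_le]
      rintro _ ⟨j, hj, rfl⟩
      have hj' : B.weight j ≤ i := hj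
      refine ⟨⟨B.basis j, filtration_mono D hj' (B.mem_filtration j)⟩, ?_, rfl⟩
      rcases hj'.eq_or_lt with h | h
      · exact ⟨B.basis j, (B.toNilₗ_basis j).trans (Nilpotentisation.cls_congr h rfl)⟩
      · have hz : c ⟨B.basis j, filtration_mono D hj' (B.mem_filtration j)⟩ = 0 := by
          change Nilpotentisation.incl D i (Submodule.Quotient.mk _) = 0
          rw [(Submodule.Quotient.mk_eq_zero _).2, map_zero]
          exact filtration_mono D (by omega : B.weight j ≤ i - 1) (B.mem_filtration j)
        exact Submodule.mem_comap.2 (hz ▸ Submodule.zero_mem _)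
    rw [← B.span_eq i] at hle
    obtain ⟨y, hy, hyx⟩ := hle x.2
    have : y = x := Subtype.ext hyx
    subst this
    exact hy

/-- The identification `b : 𝔤 → 𝔫(𝔤, D)` given by an adapted basis: it sends a basis vector `X`
of weight `i` to its class `X + Vⁱ⁻¹`. -/
def toNil : L ≃ₗ[ℝ] Nilpotentisation D :=
  LinearEquiv.ofBijective B.toNilₗ ⟨B.toNilₗ_injective, B.toNilₗ_surjective⟩

end AdaptedBasis

end Algebra

/-! ## Lie groups: exponential, logarithm, integration of a Lie algebra -/

instance : ENat.LEInfty (minSmoothness ℝ 3) := by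
  rw [minSmoothness_of_isRCLikeNormedField]; infer_instance

section Lie

variable {E : Type*} [NormedAddCommGroup E] [NormedSpace ℝ E]
  {G : Type*} [TopologicalSpace G] [ChartedSpace E G] [Group G]

open Classical in
/-- The exponential `exp X = γ 1`, where `γ` is the integral curve of the left-invariant vector
field defined by `X` with `γ 0 = 1`. -/
def lieExp (X : GroupLieAlgebra 𝓘(ℝ, E) G) : G :=
  if h : ∃ γ : ℝ → G, γ 0 = 1 ∧ IsMIntegralCurve (I := 𝓘(ℝ, E)) γ (mulInvariantVectorField X)
  then h.choose 1 else 1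

open Classical in
/-- The logarithm: a local inverse of `exp` from a neighbourhood of `1` to a neighbourhood of `0`.
Only its germ at `1` is meaningful, and this germ does not depend on the choice. -/
def lieLog (g : G) : GroupLieAlgebra 𝓘(ℝ, E) G :=
  if h : ∃ φ : OpenPartialHomeomorph (GroupLieAlgebra 𝓘(ℝ, E) G) G,
    0 ∈ φ.source ∧ EqOn φ lieExp φ.source
  then h.choose.symm g else 0

/-- The operation `X · Y = log (exp X exp Y)`, defined near `0` in the Lie algebra. -/
def logMul (X Y : GroupLieAlgebra 𝓘(ℝ, E) G) : GroupLieAlgebra 𝓘(ℝ, E) G :=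
  lieLog (lieExp X * lieExp Y)

end Lie

/-- A simply connected Lie group modelled on `E`, with an identification of its Lie algebra
with `𝔫`. -/
structure SimplyConnectedLieGroup (E : Type u) [NormedAddCommGroup E] [NormedSpace ℝ E]
    [CompleteSpace E] (𝔫 : Type*) [LieRing 𝔫] [LieAlgebra ℝ 𝔫] where
  carrier : Type u
  [topologicalSpace : TopologicalSpace carrier]
  [t2Space : T2Space carrier]
  [chartedSpace : ChartedSpace E carrier]
  [group : Group carrier]
  [lieGroup : LieGroup 𝓘(ℝ, E) ∞ carrier]
  [simplyConnectedSpace : SimplyConnectedSpace carrier]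
  lieAlgebraEquiv : GroupLieAlgebra 𝓘(ℝ, E) carrier ≃ₗ⁅ℝ⁆ 𝔫

attribute [instance] SimplyConnectedLieGroup.topologicalSpace SimplyConnectedLieGroup.t2Space
  SimplyConnectedLieGroup.chartedSpace SimplyConnectedLieGroup.group
  SimplyConnectedLieGroup.lieGroup SimplyConnectedLieGroup.simplyConnectedSpace

/-! ## Local groups with dilatations and their virtual tangent space -/

/-- The data of a local group with a local action of `(0, ∞)`. All operations are total functions,
but only their germs at the neutral element are meaningful. -/
structure DilatationGroup (M : Type*) where
  one : M
  mul : M → M → M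
  inv : M → M
  dil : ℝ → M → M

namespace DilatationGroup

variable {M : Type*} (P : DilatationGroup M)

/-- `δ_ε⁻¹ ((δ_ε x) (δ_ε y))` -/
def rescaledMul (ε : ℝ) (x y : M) : M := P.dil ε⁻¹ (P.mul (P.dil ε x) (P.dil ε y))

/-- `δ_ε⁻¹ ((δ_ε x)⁻¹)` -/
def rescaledInv (ε : ℝ) (x : M) : M := P.dil ε⁻¹ (P.inv (P.dil ε x))

/-- `β(x, y) = lim_{ε → 0} δ_ε⁻¹ ((δ_ε x) (δ_ε y))` -/
def virtualMul [TopologicalSpace M] (x y : M) : M :=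
  haveI : Nonempty M := ⟨P.one⟩
  limUnder (𝓝[>] (0 : ℝ)) fun ε => P.rescaledMul ε x y

/-- `lim_{ε → 0} δ_ε⁻¹ ((δ_ε x)⁻¹)` -/
def virtualInv [TopologicalSpace M] (x : M) : M :=
  haveI : Nonempty M := ⟨P.one⟩
  limUnder (𝓝[>] (0 : ℝ)) fun ε => P.rescaledInv ε x

/-- The transformation `L^N_x y = β(x, y)`. The virtual tangent space at the neutral element is the
local group formed by these transformations, with composition as operation. -/
def virtualTranslation [TopologicalSpace M] (x : M) : M → M := fun y => P.virtualMul x y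

/-- The dilatations form a local action of `(0, ∞)` at the neutral element and satisfy
* H0: `δ_ε e = e`, and `δ_ε x → e` as `ε → 0`, uniformly in `x` near `e`;
* H1: the limit `β(x, y)` exists, uniformly in `x`, `y` near `e`;
* H2: the limit of `δ_ε⁻¹ ((δ_ε x)⁻¹)` exists, uniformly in `x` near `e`. -/
structure HasVirtualTangent [UniformSpace M] : Prop where
  action_one : ∀ᶠ x in 𝓝 P.one, P.dil 1 x = x
  action_mul : ∀ ε > 0, ∀ μ > 0, ∀ᶠ x in 𝓝 P.one, P.dil (ε * μ) x = P.dil ε (P.dil μ x)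
  action_uniform : ∀ ε > 0, ∃ W ∈ 𝓝 ε, ∃ U ∈ 𝓝 P.one,
    UniformContinuousOn (fun p : ℝ × M => P.dil p.1 p.2) (W ×ˢ U)
  dil_one : ∀ ε > 0, P.dil ε P.one = P.one
  dil_tendsto : ∃ U ∈ 𝓝 P.one, TendstoUniformlyOn P.dil (fun _ => P.one) (𝓝[>] 0) U
  mul_tendsto : ∃ U ∈ 𝓝 P.one, TendstoUniformlyOn (fun ε (p : M × M) => P.rescaledMul ε p.1 p.2)
    (fun p => P.virtualMul p.1 p.2) (𝓝[>] 0) (U ×ˢ U)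
  inv_tendsto : ∃ U ∈ 𝓝 P.one, TendstoUniformlyOn P.rescaledInv P.virtualInv (𝓝[>] 0) U

/-- The transformations `L^N_x`, for `x` near `e`, form under composition a local group, with
`L^N_x ∘ L^N_y = L^N_{β(x, y)}`, in which `x` is recovered from `L^N_x` as `L^N_x e`. -/
def VirtualTangentIsLocalGroup [TopologicalSpace M] : Prop :=
  (∀ᶠ x in 𝓝 P.one, P.virtualTranslation x P.one = x) ∧
  (∀ᶠ p : M × M × M in 𝓝 (P.one, P.one, P.one),
    P.virtualTranslation p.1 (P.virtualTranslation p.2.1 p.2.2) =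
      P.virtualTranslation (P.virtualMul p.1 p.2.1) p.2.2) ∧
  (∀ᶠ p : M × M in 𝓝 (P.one, P.one),
    P.virtualTranslation p.1 (P.virtualTranslation (P.virtualInv p.1) p.2) = p.2 ∧
    P.virtualTranslation (P.virtualInv p.1) (P.virtualTranslation p.1 p.2) = p.2)

end DilatationGroup

/-- The germ of `f` at `e` is an isomorphism of local groups: `f` is a homeomorphism from a
neighbourhood of `e` to a neighbourhood of `e'`, and intertwines the operations near `e`. -/
def IsLocalGroupIso {M M' : Type*} [TopologicalSpace M] [TopologicalSpace M']
    (e : M) (mul : M → M → M) (e' : M') (mul' : M' → M' → M') (f : M → M') : Prop :=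
  f e = e' ∧ (∃ φ : OpenPartialHomeomorph M M', e ∈ φ.source ∧ EqOn φ f φ.source) ∧
    ∀ᶠ p : M × M in 𝓝 (e, e), f (mul p.1 p.2) = mul' (f p.1) (f p.2)

section Main

variable {E : Type*} [NormedAddCommGroup E] [NormedSpace ℝ E] [CompleteSpace E]
  {G : Type*} [TopologicalSpace G] [ChartedSpace E G] [Group G] [LieGroup 𝓘(ℝ, E) ∞ G]
  {D : Submodule ℝ (GroupLieAlgebra 𝓘(ℝ, E) G)}

/-- The local group `log G` with the dilatations `δ_ε`. -/
def logGroup (B : AdaptedBasis D) : DilatationGroup (GroupLieAlgebra 𝓘(ℝ, E) G) where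
  one := 0
  mul := logMul
  inv X := lieLog (lieExp X)⁻¹
  dil ε X := B.dil ε X

/-- The group `G` with the dilatations given near `1` by `exp X ↦ exp (δ_ε X)`. -/
def dilatedGroup (B : AdaptedBasis D) : DilatationGroup G where
  one := 1
  mul := (· * ·)
  inv := (·⁻¹)
  dil ε g := lieExp (B.dil ε (lieLog (E := E) g))

/-- The chart `𝔤 → N` near `0`: the identification `b` of `𝔤` with `𝔫(𝔤, D)`, followed by the
exponential of `N`. -/
def nilExp (B : AdaptedBasis D) (N : SimplyConnectedLieGroup E (Nilpotentisation D)) :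
    GroupLieAlgebra 𝓘(ℝ, E) G → N.carrier :=
  fun X => lieExp (N.lieAlgebraEquiv.symm (B.toNil X))

/-- The operation of `N`, transported to a neighbourhood of `0` in `𝔤` by the identifications of
`N` with `𝔫(𝔤, D)` (the exponential) and of `𝔫(𝔤, D)` with `𝔤` (the map `b`). -/
def nilMul (B : AdaptedBasis D) (N : SimplyConnectedLieGroup E (Nilpotentisation D))
    (X Y : GroupLieAlgebra 𝓘(ℝ, E) G) : GroupLieAlgebra 𝓘(ℝ, E) G :=
  B.toNil.symm (N.lieAlgebraEquiv
    (logMul (N.lieAlgebraEquiv.symm (B.toNil X)) (N.lieAlgebraEquiv.symm (B.toNil Y))))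

variable (E G) in
/-- The uniformity of the Lie algebra, as a finite-dimensional vector space. -/
abbrev algebraUniformSpace : UniformSpace (GroupLieAlgebra 𝓘(ℝ, E) G) :=
  IsTopologicalAddGroup.leftUniformSpace _

variable (E G) in
/-- The left uniformity of the Lie group `G`, which is that of any left-invariant Riemannian
distance. -/
abbrev groupUniformSpace : UniformSpace G :=
  haveI : IsTopologicalGroup G := topologicalGroup_of_lieGroup 𝓘(ℝ, E) ∞
  IsTopologicalGroup.leftUniformSpace G

end Main

end SubRiemLie

end

/-! In a Lie group with bracket c, the differential of exp at z is, up to a left translation, the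
operator (1 - exp(-ad z))/ad z, which is `lieKernel (c z)`. Hence z(t) = log(exp x exp(ty)) solves
`lieKernel (c z) z' = y`, z(0) = x, an equation in which the group enters only through c. Near 0 the
operation of log G is therefore the time-one value of a flow that depends smoothly on (c, x, y), and
small solutions are unique (`exists_lieExp_logCurve`, `exists_logCurve`, `exists_logCurve_unique`).
This takes the place of the Campbell–Hausdorff series.

A linear map that intertwines two brackets carries log curves to log curves (`IsLogCurve.map`). For
the map δ_ε this says that δ_ε⁻¹((δ_ε x)(δ_ε y)) is the operation attached to the bracket c_ε =
δ_ε⁻¹[δ_ε ·, δ_ε ·]. In an adapted basis the coefficients of c_ε are the structure constants times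
ε^(l_i + l_j - l_k), and those with l_k > l_i + l_j vanish. So c_ε is polynomial in ε, and c_0
retains exactly the terms with l_k = l_i + l_j: it is the bracket of 𝔫(𝔤, D) carried over by b
(`AdaptedBasis.toNil_scaledBracket_zero`). Joint continuity in (ε, x, y) up to ε = 0 gives the
uniform limits, and β is the operation attached to c_0. As b intertwines c_0 with the bracket of N,
the same principle applied to b gives exp_N(b β(X, Y)) = exp_N(bX) exp_N(bY), which is the
comparison with N(G, D).

The group laws of β are limits of those of G (`eventually_eq_of_continuousAt`). Since β commutes
with the dilatations, it extends to a smooth group law on the whole vector space; the mixed second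
derivative of this law at 0 is c_0/2, so its Lie bracket is c_0. This constructs N(G, D)
(`nonempty_simplyConnectedLieGroup`). The analysis takes place on the model space E and is
transported by charts (`DilatationGroup.IsChart`): the linear identification for log G, the
exponential for G. -/

noncomputable section

namespace SubRiemLie

/-! ## Composition operators on spaces of continuous maps -/

section Nemytskii

variable {K : Type*} [TopologicalSpace K] [CompactSpace K]

open Classical in
/-- The composition operator `u ↦ f ∘ u` on continuous maps, with value `0` where `f ∘ u` is not
continuous. -/
def nemytskii {X Y : Type*} [TopologicalSpace X] [TopologicalSpace Y] [Zero Y] (f : X → Y)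
    (w : C(K, X)) : C(K, Y) :=
  if h : Continuous (f ∘ w) then ⟨f ∘ w, h⟩ else 0

lemma nemytskii_apply {X Y : Type*} [TopologicalSpace X] [TopologicalSpace Y] [Zero Y]
    {f : X → Y} {U : Set X} (hf : ContinuousOn f U) {w : C(K, X)} (hw : ∀ t, w t ∈ U) (t : K) :
    nemytskii f w t = f (w t) := by
  have h : Continuous (f ∘ w) := hf.comp_continuous w.continuous hw
  simp [nemytskii, h]

variable {X Y : Type*} [NormedAddCommGroup X] [NormedSpace ℝ X]
  [NormedAddCommGroup Y] [NormedSpace ℝ Y]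

/-- The action of a continuous family of operators on continuous maps. -/
def pointwiseApply : C(K, X →L[ℝ] Y) →L[ℝ] C(K, X) →L[ℝ] C(K, Y) :=
  LinearMap.mkContinuous₂
    (LinearMap.mk₂ ℝ (fun (g : C(K, X →L[ℝ] Y)) (h : C(K, X)) =>
        (⟨fun t => g t (h t), g.continuous.clm_apply h.continuous⟩ : C(K, Y)))
      (fun _ _ _ => by ext; simp) (fun _ _ _ => by ext; simp)
      (fun _ _ _ => by ext; simp) (fun _ _ _ => by ext; simp)) 1
    (fun g h => by
      rw [ContinuousMap.norm_le _ (by positivity)]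
      intro t
      rw [one_mul]
      exact (g t).le_of_opNorm_le_of_le (g.norm_coe_le_norm t) (h.norm_coe_le_norm t))

lemma pointwiseApply_apply (g : C(K, X →L[ℝ] Y)) (h : C(K, X)) (t : K) :
    pointwiseApply g h t = g t (h t) := rfl

lemma isOpen_forall_mem {Z : Type*} [TopologicalSpace Z] {U : Set Z} (hU : IsOpen U) :
    IsOpen {w : C(K, Z) | ∀ t, w t ∈ U} := by
  have := ContinuousMap.isOpen_setOfPred_mapsTo (isCompact_univ : IsCompact (univ : Set K)) hU
  simpa [MapsTo] using this

/-- The range of `w` is compact, so both the room left inside `U` and the modulus of continuity of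
`f` can be chosen independently of `t`. This turns pointwise facts on `f` into facts in the sup
norm. -/
lemma exists_uniform_of_continuousOn {Z : Type*} [NormedAddCommGroup Z] {f : X → Z} {U : Set X}
    (hU : IsOpen U) (hf : ContinuousOn f U) {w : C(K, X)} (hw : ∀ t, w t ∈ U) {ε : ℝ}
    (hε : 0 < ε) : ∃ δ > 0, ∀ t x, dist (w t) x < δ → x ∈ U ∧ dist (f x) (f (w t)) < ε := by
  have hc : IsCompact (range w) := isCompact_range w.continuous
  have h1 := hc.uniformContinuousAt_of_continuousAt f
    (by rintro _ ⟨t, rfl⟩; exact hf.continuousAt (hU.mem_nhds (hw t)))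
    (Metric.dist_mem_uniformity hε)
  obtain ⟨δ, hδ, h⟩ := Metric.mem_uniformity_dist.1 h1
  obtain ⟨δ', hδ', h'⟩ := hc.exists_thickening_subset_open hU
    (by rintro _ ⟨t, rfl⟩; exact hw t)
  refine ⟨min δ δ', lt_min hδ hδ', fun t x hx => ⟨h' ?_, ?_⟩⟩
  · rw [Metric.mem_thickening_iff]
    exact ⟨w t, mem_range_self t, by rw [dist_comm]; exact hx.trans_le (min_le_right _ _)⟩
  · have := h (hx.trans_le (min_le_left _ _)) (mem_range_self t)
    rw [dist_comm]; exact this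

lemma continuousOn_nemytskii {Z : Type*} [NormedAddCommGroup Z] {f : X → Z} {U : Set X}
    (hU : IsOpen U) (hf : ContinuousOn f U) :
    ContinuousOn (nemytskii f : C(K, X) → C(K, Z)) {w | ∀ t, w t ∈ U} := by
  intro w hw
  refine ContinuousAt.continuousWithinAt ?_
  rw [Metric.continuousAt_iff]
  intro ε hε
  obtain ⟨δ, hδ, h⟩ := exists_uniform_of_continuousOn hU hf hw (half_pos hε)
  refine ⟨δ, hδ, fun v hv => ?_⟩
  have hv' : ∀ t, dist (w t) (v t) < δ := fun t => by
    rw [dist_comm]; exact (ContinuousMap.dist_apply_le_dist t).trans_lt hv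
  refine lt_of_le_of_lt ?_ (half_lt_self hε)
  rw [ContinuousMap.dist_le (half_pos hε).le]
  intro t
  rw [nemytskii_apply hf hw, nemytskii_apply hf fun t => (h t _ (hv' t)).1]
  exact (h t _ (hv' t)).2.le

/-- On a ball about `w t` of radius independent of `t`, the derivative of `f` varies by less than
`ε`; the mean value inequality then bounds the remainder at every `t` by `ε` times the sup norm of
the increment. -/
lemma hasFDerivAt_nemytskii {f : X → Y} {U : Set X} (hU : IsOpen U) (hf : ContDiffOn ℝ 1 f U)
    {w : C(K, X)} (hw : ∀ t, w t ∈ U) :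
    HasFDerivAt (nemytskii f : C(K, X) → C(K, Y)) (pointwiseApply (nemytskii (fderiv ℝ f) w)) w := by
  have hf' : ContinuousOn (fderiv ℝ f) U := hf.continuousOn_fderiv_of_isOpen hU le_rfl
  rw [hasFDerivAt_iff_isLittleO, Asymptotics.isLittleO_iff]
  intro ε hε
  obtain ⟨δ, hδ, h⟩ := exists_uniform_of_continuousOn hU hf' hw hε
  filter_upwards [Metric.ball_mem_nhds w hδ] with v hv
  have hv' : ∀ t, dist (w t) (v t) < δ := fun t => by
    rw [dist_comm]; exact (ContinuousMap.dist_apply_le_dist t).trans_lt hv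
  rw [ContinuousMap.norm_le _ (by positivity)]
  intro t
  rw [ContinuousMap.sub_apply, ContinuousMap.sub_apply, pointwiseApply_apply,
    nemytskii_apply hf.continuousOn hw, nemytskii_apply hf' hw,
    nemytskii_apply hf.continuousOn fun t => (h t _ (hv' t)).1]
  have key := (convex_ball (w t) δ).norm_image_sub_le_of_norm_hasFDerivWithin_le' (f := f)
    (f' := fderiv ℝ f) (φ := fderiv ℝ f (w t)) (C := ε) (x := w t) (y := v t)
    (fun x hx => ((hf.differentiableOn one_ne_zero).differentiableAt (hU.mem_nhds
      (h t x (by rw [dist_comm]; exact hx)).1)).hasFDerivAt.hasFDerivWithinAt)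
    (fun x hx => by
      rw [← dist_eq_norm]; exact (h t x (by rw [dist_comm]; exact hx)).2.le)
    (Metric.mem_ball_self hδ) (by rw [Metric.mem_ball, dist_comm]; exact hv' t)
  exact key.trans (by gcongr; exact (v - w).norm_coe_le_norm t)

end Nemytskii

/-! ### Higher differentiability of composition operators -/

section NemytskiiSmooth

variable {K : Type*} [TopologicalSpace K] [CompactSpace K]
  {X : Type u} [NormedAddCommGroup X] [NormedSpace ℝ X]

/-- The derivative of the composition operator of `f` is that of `fderiv ℝ f` followed by a
continuous linear map, so induction on the order applies. It replaces `Y` by `X →L[ℝ] Y`, whence the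
quantification over `Y` and the common universe. -/
lemma contDiffOn_nemytskii_nat (n : ℕ) : ∀ {Y : Type u} [NormedAddCommGroup Y] [NormedSpace ℝ Y]
    {f : X → Y} {U : Set X}, IsOpen U → ContDiffOn ℝ n f U →
    ContDiffOn ℝ n (nemytskii f : C(K, X) → C(K, Y)) {w | ∀ t, w t ∈ U} := by
  induction n with
  | zero =>
    intro Y _ _ f U hU hf
    simp only [Nat.cast_zero, contDiffOn_zero] at hf ⊢
    exact continuousOn_nemytskii hU hf
  | succ n ih =>
    intro Y _ _ f U hU hf
    have hf1 : ContDiffOn ℝ 1 f U := hf.of_le (by exact_mod_cast Nat.le_add_left 1 n)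
    push_cast at hf ⊢
    rw [contDiffOn_succ_iff_fderiv_of_isOpen hU] at hf
    rw [contDiffOn_succ_iff_fderiv_of_isOpen (isOpen_forall_mem hU)]
    refine ⟨fun w hw => (hasFDerivAt_nemytskii hU hf1 hw).differentiableAt.differentiableWithinAt,
      fun h => by simp at h, ?_⟩
    refine ((pointwiseApply (K := K)).contDiff.comp_contDiffOn (ih hU hf.2.2)).congr
      fun w hw => ?_
    exact (hasFDerivAt_nemytskii hU hf1 hw).fderiv

lemma contDiffOn_nemytskii {n : ℕ∞} {Y : Type u} [NormedAddCommGroup Y] [NormedSpace ℝ Y]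
    {f : X → Y} {U : Set X} (hU : IsOpen U) (hf : ContDiffOn ℝ n f U) :
    ContDiffOn ℝ n (nemytskii f : C(K, X) → C(K, Y)) {w | ∀ t, w t ∈ U} := by
  rw [contDiffOn_iff_forall_nat_le]
  exact fun m hm => contDiffOn_nemytskii_nat m hU (hf.of_le (by exact_mod_cast hm))

end NemytskiiSmooth

/-! ## Smooth dependence of solutions of differential equations near an equilibrium -/

section Flow

/-- The time interval `[-2, 2]`. -/
abbrev TimeInterval : Type := Icc (-2 : ℝ) 2

/-- The extension of a curve on `[-2, 2]` to the real line. -/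
def extendCurve {E : Type*} [TopologicalSpace E] (w : C(TimeInterval, E)) (t : ℝ) : E :=
  w (projIcc (-2) 2 (by norm_num) t)

lemma continuous_extendCurve {E : Type*} [TopologicalSpace E] (w : C(TimeInterval, E)) :
    Continuous (extendCurve w) := w.continuous.comp continuous_projIcc

lemma extendCurve_of_mem {E : Type*} [TopologicalSpace E] (w : C(TimeInterval, E)) {t : ℝ}
    (ht : t ∈ Icc (-2 : ℝ) 2) : extendCurve w t = w ⟨t, ht⟩ := by
  rw [extendCurve, projIcc_of_mem]

variable {E : Type u} [NormedAddCommGroup E] [NormedSpace ℝ E]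

lemma norm_extendCurve_le (w : C(TimeInterval, E)) (t : ℝ) : ‖extendCurve w t‖ ≤ ‖w‖ :=
  w.norm_coe_le_norm _

variable [CompleteSpace E]

lemma hasDerivAt_integral_extendCurve (w : C(TimeInterval, E)) (t : ℝ) :
    HasDerivAt (fun t => ∫ s in (0 : ℝ)..t, extendCurve w s) (extendCurve w t) t :=
  intervalIntegral.integral_hasDerivAt_right
    ((continuous_extendCurve w).intervalIntegrable _ _)
    ((continuous_extendCurve w).stronglyMeasurableAtFilter _ _)
    (continuous_extendCurve w).continuousAt

/-- The primitive vanishing at `0` of a curve on `[-2, 2]`. -/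
def primitive : C(TimeInterval, E) →L[ℝ] C(TimeInterval, E) :=
  LinearMap.mkContinuous
    { toFun := fun w => ⟨fun t => ∫ s in (0 : ℝ)..t, extendCurve w s,
        (continuous_iff_continuousAt.2 fun t =>
          (hasDerivAt_integral_extendCurve w t).continuousAt).comp continuous_subtype_val⟩
      map_add' := fun v w => by
        ext t
        exact intervalIntegral.integral_add ((continuous_extendCurve v).intervalIntegrable _ _)
          ((continuous_extendCurve w).intervalIntegrable _ _)
      map_smul' := fun c w => by
        ext t
        exact intervalIntegral.integral_smul c _ } 2
    (fun w => by
      rw [ContinuousMap.norm_le _ (by positivity)]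
      intro t
      refine (intervalIntegral.norm_integral_le_of_norm_le_const
        fun s _ => norm_extendCurve_le w s).trans ?_
      rw [mul_comm]
      gcongr
      rw [sub_zero, abs_le]
      exact t.2)

lemma primitive_apply (w : C(TimeInterval, E)) (t : TimeInterval) :
    primitive w t = ∫ s in (0 : ℝ)..t, extendCurve w s := rfl

lemma extendCurve_primitive_zero (w : C(TimeInterval, E)) : extendCurve (primitive w) 0 = 0 := by
  rw [extendCurve_of_mem _ (by norm_num), primitive_apply, intervalIntegral.integral_same]

/-- In the open interval the constant extension does not interfere. Taking [-2, 2] rather than [0,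
1] makes the times 0 and 1 interior, so that two-sided derivatives are available there. -/
lemma hasDerivAt_extendCurve_primitive (w : C(TimeInterval, E)) {t : ℝ}
    (ht : t ∈ Ioo (-2 : ℝ) 2) : HasDerivAt (extendCurve (primitive w)) (extendCurve w t) t := by
  refine (hasDerivAt_integral_extendCurve w t).congr_of_eventuallyEq ?_
  filter_upwards [Ioo_mem_nhds ht.1 ht.2] with s hs
  rw [extendCurve_of_mem _ ⟨hs.1.le, hs.2.le⟩, primitive_apply]

variable {Q : Type u} [NormedAddCommGroup Q] [NormedSpace ℝ Q] [CompleteSpace Q]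

/-- The curve `t ↦ (q, w t)`. -/
def pairCurve : Q × C(TimeInterval, E) →L[ℝ] C(TimeInterval, Q × E) :=
  LinearMap.mkContinuous
    { toFun := fun p => ⟨fun t => (p.1, p.2 t), by fun_prop⟩
      map_add' := fun _ _ => by ext <;> rfl
      map_smul' := fun _ _ => by ext <;> rfl } 1
    (fun p => by
      rw [ContinuousMap.norm_le _ (by positivity), one_mul]
      intro t
      exact max_le_max le_rfl (p.2.norm_coe_le_norm t))

lemma pairCurve_apply (p : Q × C(TimeInterval, E)) (t : TimeInterval) :
    pairCurve p t = (p.1, p.2 t) := rfl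

/-- Near a parameter `q₀` for which every point is an equilibrium, the solution on `[-2, 2]` of
`w' = f (q, w)`, `w 0 = 0` depends smoothly on the parameter `q`, as a continuous curve. -/
theorem exists_smooth_solution {n : ℕ∞} (hn : n ≠ 0) {f : Q × E → E} {U : Set (Q × E)}
    (hU : IsOpen U) (hf : ContDiffOn ℝ n f U) {q₀ : Q} (h0 : (q₀, (0 : E)) ∈ U)
    (hq₀ : ∀ x, (q₀, x) ∈ U → f (q₀, x) = 0) :
    ∃ S : Q → C(TimeInterval, E), ContDiffAt ℝ n S q₀ ∧ S q₀ = 0 ∧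
      ∀ᶠ q in 𝓝 q₀, (∀ t, (q, S q t) ∈ U) ∧
        S q = primitive (nemytskii f (pairCurve (q, S q))) := by
  have hn' : ((n : ℕ∞) : WithTop ℕ∞) ≠ 0 := by exact_mod_cast hn
  have hn1 : (1 : WithTop ℕ∞) ≤ n := by
    exact_mod_cast Order.one_le_iff_ne_zero.2 hn
  have hf1 : ContDiffOn ℝ 1 f U := hf.of_le hn1
  set V : Set (Q × C(TimeInterval, E)) := {p | ∀ t, (p.1, p.2 t) ∈ U} with hV
  have hVo : IsOpen V := (isOpen_forall_mem hU).preimage pairCurve.continuous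
  have h0V : (q₀, (0 : C(TimeInterval, E))) ∈ V := fun t => h0
  -- Zeros of `Φ` are the solutions of the integral equation; the implicit function theorem in the
  -- Banach space of curves gives their smooth dependence on `q`.
  let Φ : Q × C(TimeInterval, E) → C(TimeInterval, E) :=
    fun p => p.2 - primitive (nemytskii f (pairCurve p))
  have hΦ : ContDiffOn ℝ n Φ V :=
    contDiffOn_snd.sub (primitive.contDiff.comp_contDiffOn
      ((contDiffOn_nemytskii hU hf).comp pairCurve.contDiff.contDiffOn fun p hp => hp))
  have hΦa : ContDiffAt ℝ n Φ (q₀, 0) := hΦ.contDiffAt (hVo.mem_nhds h0V)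
  have hΦ0 : Φ (q₀, 0) = 0 := by
    have : nemytskii f (pairCurve (q₀, (0 : C(TimeInterval, E)))) = 0 := by
      ext t
      rw [nemytskii_apply hf.continuousOn (fun t => h0V t)]
      exact hq₀ _ h0
    simp only [Φ, this, map_zero, sub_zero]
  -- As `f (q₀, ·)` vanishes near 0, its derivative there is zero and the integral term contributes
  -- nothing: the partial derivative of `Φ` in the curve is the identity.
  have hder : fderiv ℝ Φ (q₀, 0) ∘L .inr ℝ Q C(TimeInterval, E) = .id ℝ _ := by
    have h1 : HasFDerivAt Φ (.snd ℝ _ _ - primitive ∘L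
        (pointwiseApply (nemytskii (fderiv ℝ f) (pairCurve (q₀, 0)))) ∘L pairCurve) (q₀, 0) :=
      hasFDerivAt_snd.sub (primitive.hasFDerivAt.comp _
        ((hasFDerivAt_nemytskii hU hf1 fun t => h0V t).comp _ pairCurve.hasFDerivAt))
    rw [h1.fderiv]
    ext w t
    have h2 : pointwiseApply (nemytskii (fderiv ℝ f) (pairCurve (q₀, 0))) (pairCurve (0, w)) = 0 := by
      ext t
      rw [pointwiseApply_apply, nemytskii_apply (hf1.continuousOn_fderiv_of_isOpen hU le_rfl)
        (fun t => h0V t), pairCurve_apply, pairCurve_apply]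
      have hd : HasFDerivAt f (fderiv ℝ f (q₀, 0)) (q₀, 0) :=
        ((hf1.differentiableOn one_ne_zero).differentiableAt (hU.mem_nhds h0)).hasFDerivAt
      have hd2 : HasFDerivAt (fun x => f (q₀, x)) (fderiv ℝ f (q₀, 0) ∘L .inr ℝ Q E) 0 :=
        hd.comp (0 : E) (hasFDerivAt_prodMk_right q₀ (0 : E))
      have hd3 : (fun x => f (q₀, x)) =ᶠ[𝓝 0] fun _ => 0 := by
        filter_upwards [(hU.preimage (Continuous.prodMk_right q₀)).mem_nhds h0] with x hx
        exact hq₀ x hx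
      have := hd2.unique ((hasFDerivAt_const (0 : E) (0 : E)).congr_of_eventuallyEq hd3)
      exact DFunLike.congr_fun this (w t)
    simp [h2]
  have hinv : (fderiv ℝ Φ (q₀, 0) ∘L .inr ℝ Q C(TimeInterval, E)).IsInvertible := by
    rw [hder]; exact ContinuousLinearMap.isInvertible_equiv (f := .refl ℝ _)
  refine ⟨hΦa.implicitFunction hn' hinv, hΦa.contDiffAt_implicitFunction hn' hinv,
    hΦa.implicitFunction_apply_self hn' hinv, ?_⟩
  have hS := hΦa.contDiffAt_implicitFunction hn' hinv
  have hS0 := hΦa.implicitFunction_apply_self hn' hinv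
  have hc : ContinuousAt (fun q => (q, hΦa.implicitFunction hn' hinv q)) q₀ :=
    continuousAt_id.prodMk hS.continuousAt
  have hmem : ∀ᶠ q in 𝓝 q₀, (q, hΦa.implicitFunction hn' hinv q) ∈ V :=
    hc.eventually_mem (hVo.mem_nhds (by simp only [hS0]; exact h0V))
  filter_upwards [hmem, hΦa.eventually_apply_implicitFunction hn' hinv] with q hq1 hq2
  refine ⟨hq1, ?_⟩
  rw [hΦ0] at hq2
  exact sub_eq_zero.1 hq2

end Flow

/-! ## The operator `(1 - exp (-T)) / T` -/

section LieKernel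

variable {E : Type*} [NormedAddCommGroup E] [NormedSpace ℝ E]

/-- The generator `(a, b) ↦ (b - T a, 0)` of the equation `a' = b - T a`, `b' = 0`. -/
def kernelGenerator (T : E →L[ℝ] E) : (E × E) →L[ℝ] (E × E) :=
  .inl ℝ E E ∘L (.snd ℝ E E - T ∘L .fst ℝ E E)

lemma contDiff_kernelGenerator {n : WithTop ℕ∞} :
    ContDiff ℝ n (kernelGenerator : (E →L[ℝ] E) → _) := by
  unfold kernelGenerator
  exact contDiff_const.clm_comp (contDiff_const.sub (contDiff_id.clm_comp contDiff_const))

/-- The solution at time `s` of `w' = v - T w`, `w 0 = 0`, as an operator applied to `v`. -/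
def kernelSolution (T : E →L[ℝ] E) (s : ℝ) : E →L[ℝ] E :=
  .fst ℝ E E ∘L NormedSpace.exp (s • kernelGenerator T) ∘L .inr ℝ E E

/-- The operator `(1 - exp (-T)) / T`. -/
def lieKernel (T : E →L[ℝ] E) : E →L[ℝ] E := kernelSolution T 1

lemma kernelSolution_zero (T : E →L[ℝ] E) : kernelSolution T 0 = 0 := by
  ext v
  simp [kernelSolution]

variable [CompleteSpace E]

lemma contDiff_lieKernel {n : WithTop ℕ∞} : ContDiff ℝ n (lieKernel : (E →L[ℝ] E) → _) := by
  have h : ContDiff ℝ n fun T : E →L[ℝ] E => NormedSpace.exp (kernelGenerator T) :=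
    (contDiff_iff_contDiffAt.2 fun x => (NormedSpace.exp_analytic (𝕂 := ℝ) x).contDiffAt).comp
      contDiff_kernelGenerator
  unfold lieKernel kernelSolution
  simp only [one_smul]
  exact contDiff_const.clm_comp (h.clm_comp contDiff_const)

/-- Under the flow of `kernelGenerator T` the second component stays equal to `v`, so the first one
solves a' = v - T a. Using the exponential of this block operator gives a meaning to (1 - exp(-T))/T
for every `T`, invertible or not. -/
lemma hasDerivAt_kernelSolution (T : E →L[ℝ] E) (v : E) (s : ℝ) :
    HasDerivAt (fun s => kernelSolution T s v) (v - T (kernelSolution T s v)) s := by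
  have hsnd : ∀ s : ℝ, (NormedSpace.exp (s • kernelGenerator T) (0, v)).2 = v := by
    intro s
    have hd : ∀ s : ℝ, HasDerivAt (fun s : ℝ => (NormedSpace.exp (s • kernelGenerator T) (0, v)).2) 0 s := by
      intro s
      have := (ContinuousLinearMap.snd ℝ E E).hasFDerivAt.comp_hasDerivAt s
        ((hasDerivAt_exp_smul_const' (𝕂 := ℝ) (kernelGenerator T) s).clm_apply
          (hasDerivAt_const s ((0 : E), v)))
      simpa [kernelGenerator, Function.comp_def] using this
    have := is_const_of_deriv_eq_zero (fun s => (hd s).differentiableAt) (fun s => (hd s).deriv) s 0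
    simpa using this
  have h := (ContinuousLinearMap.fst ℝ E E).hasFDerivAt.comp_hasDerivAt s
    ((hasDerivAt_exp_smul_const' (𝕂 := ℝ) (kernelGenerator T) s).clm_apply
      (hasDerivAt_const s ((0 : E), v)))
  refine h.congr_deriv ?_
  have hgen : ∀ p : E × E, (kernelGenerator T p).1 = p.2 - T p.1 := fun p => by
    simp [kernelGenerator]
  have : (kernelGenerator T (NormedSpace.exp (s • kernelGenerator T) (0, v))).1 =
      v - T (NormedSpace.exp (s • kernelGenerator T) (0, v)).1 := by
    rw [hgen, hsnd]
  simpa [kernelSolution] using this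

/-- The solution of `w' = v - T w`, `w 0 = 0` is unique. -/
lemma eq_kernelSolution {T : E →L[ℝ] E} {v : E} {w : ℝ → E} (h0 : w 0 = 0)
    (hw : ∀ s, HasDerivAt w (v - T (w s)) s) (s : ℝ) : w s = kernelSolution T s v := by
  have hv : ∀ t : ℝ, LipschitzOnWith ‖T‖₊ (fun x => v - T x) univ := fun t => by
    refine LipschitzWith.lipschitzOnWith (LipschitzWith.of_dist_le_mul fun x y => ?_)
    rw [dist_sub_left]
    exact T.lipschitz.dist_le_mul x y
  exact congrFun (ODE_solution_unique_univ (t₀ := 0) (v := fun _ x => v - T x) hv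
    (fun t => ⟨hw t, mem_univ _⟩) (fun t => ⟨hasDerivAt_kernelSolution T v t, mem_univ _⟩)
    (by simp [h0, kernelSolution_zero])) s

lemma lieKernel_zero : lieKernel (0 : E →L[ℝ] E) = .id ℝ E := by
  ext v
  have := eq_kernelSolution (T := (0 : E →L[ℝ] E)) (v := v) (w := fun s => s • v) (by simp)
    (fun s => by simpa using (hasDerivAt_id s).smul_const v) 1
  simpa [lieKernel] using this.symm

/-- This is a change of time scale: q ↦ r⁻¹ w(rq) turns a solution for `T` into a solution for `r •
T`, and solutions are unique. -/
lemma smul_lieKernel_smul (T : E →L[ℝ] E) (s : ℝ) (v : E) :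
    s • lieKernel (s • T) v = kernelSolution T s v := by
  have := eq_kernelSolution (T := T) (v := v) (w := fun r => r • lieKernel (r • T) v)
    (by simp) ?_ s
  · exact this
  intro r
  have key : ∀ r : ℝ, r • lieKernel (r • T) v = kernelSolution T r v := by
    intro r
    rcases eq_or_ne r 0 with rfl | hr
    · simp [kernelSolution_zero]
    have h := eq_kernelSolution (T := r • T) (v := v)
      (w := fun q => r⁻¹ • kernelSolution T (r * q) v) (by simp [kernelSolution_zero]) (fun q => by
        have h1 := (hasDerivAt_kernelSolution T v (r * q)).scomp q
          ((hasDerivAt_id q).const_mul r)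
        have h2 := h1.const_smul r⁻¹
        refine h2.congr_deriv ?_
        simp [smul_smul, hr]) 1
    rw [lieKernel, ← h, smul_smul, mul_inv_cancel₀ hr, one_smul, mul_one]
  simp only [key]
  exact hasDerivAt_kernelSolution T v r

/-- `L` maps solutions for `T` to solutions for `T'`. No invertibility of `L` enters, which allows
the degenerate dilatation δ_0 = 0. -/
lemma lieKernel_conj {E' : Type*} [NormedAddCommGroup E'] [NormedSpace ℝ E'] [CompleteSpace E']
    {T : E →L[ℝ] E} {T' : E' →L[ℝ] E'} (L : E →L[ℝ] E') (h : ∀ x, T' (L x) = L (T x)) (v : E) :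
    lieKernel T' (L v) = L (lieKernel T v) :=
  (eq_kernelSolution (T := T') (v := L v) (w := fun s => L (kernelSolution T s v))
    (by simp [kernelSolution_zero])
    (fun s => by
      have := L.hasFDerivAt.comp_hasDerivAt s (hasDerivAt_kernelSolution T v s)
      simpa [h, Function.comp_def] using this) 1).symm

lemma hasDerivAt_comp_smul_const {A B : Type*} [NormedAddCommGroup A] [NormedSpace ℝ A]
    [NormedAddCommGroup B] [NormedSpace ℝ B] {f : A → B} (hf : DifferentiableAt ℝ f 0) (a : A) :
    HasDerivAt (fun s : ℝ => f (s • a)) (fderiv ℝ f 0 a) 0 := by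
  have h := hf.hasFDerivAt.hasLineDerivAt a
  simpa [HasLineDerivAt] using h

/-- With g(s) = `lieKernel (s • T) v`, the curve s g(s) solves the kernel equation, so g + s g' = v
- s T g. Dividing by s and letting s → 0 gives g'(0) = -g'(0) - T v. The coefficient 1/2 obtained
here is the one of [x, y]/2 in the Campbell–Hausdorff formula. -/
lemma fderiv_lieKernel_zero (T : E →L[ℝ] E) (v : E) :
    fderiv ℝ lieKernel (0 : E →L[ℝ] E) T v = -((1 / 2 : ℝ) • T v) := by
  set g : ℝ → E := fun s => lieKernel (s • T) v with hg
  have hgc : ContDiff ℝ 1 g :=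
    (contDiff_lieKernel.comp (contDiff_id.smul contDiff_const)).clm_apply contDiff_const
  have hgd : ∀ s, HasDerivAt g (deriv g s) s := fun s =>
    (hgc.differentiable one_ne_zero s).hasDerivAt
  have hg' : Continuous (deriv g) := hgc.continuous_deriv le_rfl
  have hg0 : g 0 = v := by simp [hg, lieKernel_zero]
  have hd : deriv g 0 = fderiv ℝ lieKernel (0 : E →L[ℝ] E) T v := by
    have h1 := (ContinuousLinearMap.apply ℝ E v).hasFDerivAt.comp_hasDerivAt (0 : ℝ)
      (hasDerivAt_comp_smul_const
        ((contDiff_lieKernel (E := E) (n := 1)).differentiable one_ne_zero 0) T)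
    exact h1.deriv
  rw [← hd]
  have hlim : Tendsto (fun s : ℝ => -slope g 0 s - T (g s)) (𝓝[≠] 0) (𝓝 (-deriv g 0 - T v)) := by
    refine ((hasDerivAt_iff_tendsto_slope.1 (hgd 0)).neg).sub ?_
    rw [← hg0]
    exact ((T.continuous.comp hgc.continuous).tendsto 0).mono_left nhdsWithin_le_nhds
  have heq : ∀ᶠ s in 𝓝[≠] (0 : ℝ), deriv g s = -slope g 0 s - T (g s) := by
    filter_upwards [self_mem_nhdsWithin] with s hs
    have hs' : s ≠ 0 := hs
    have h1 : HasDerivAt (fun s => s • g s) (g s + s • deriv g s) s := by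
      have := (hasDerivAt_id s).smul (hgd s)
      rw [one_smul, add_comm] at this
      exact this
    have h2 : HasDerivAt (fun s => s • g s) (v - T (s • g s)) s := by
      have : (fun s => s • g s) = fun s => kernelSolution T s v := by
        funext r; exact smul_lieKernel_smul T r v
      rw [this]
      have h3 := hasDerivAt_kernelSolution T v s
      rwa [← smul_lieKernel_smul T s v] at h3
    have h3 := h1.unique h2
    have h4 : s • deriv g s = s • (-slope g 0 s - T (g s)) := by
      rw [smul_sub, smul_neg, slope, sub_zero, smul_smul, mul_inv_cancel₀ hs', one_smul, hg0,
        vsub_eq_sub, neg_sub, ← map_smul]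
      rw [eq_sub_of_add_eq' h3]; abel
    exact smul_right_injective E hs' h4
  have hlim2 : Tendsto (deriv g) (𝓝[≠] 0) (𝓝 (deriv g 0)) :=
    (hg'.tendsto 0).mono_left nhdsWithin_le_nhds
  have := tendsto_nhds_unique (hlim2.congr' heq) hlim
  have h2 : (2 : ℝ) • deriv g 0 = -T v := by
    rw [two_smul]; nth_rewrite 1 [this]; abel
  rw [← smul_neg, ← h2, smul_smul]; norm_num

/-- The curves `z` for which `exp (z t) = exp (z 0) exp (t y)` in a Lie group with bracket `c`. -/
def IsLogCurve (c : E →L[ℝ] E →L[ℝ] E) (y : E) (z : ℝ → E) : Prop :=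
  ∀ t ∈ Ioo (-2 : ℝ) 2, ∃ z', HasDerivAt z z' t ∧ lieKernel (c (z t)) z' = y

/-- Naturality of the operation in the bracket, from `lieKernel_conj`. It yields the homogeneity of
β, the formula for the rescaled operations of G and the comparison with N. -/
lemma IsLogCurve.map {E' : Type*} [NormedAddCommGroup E'] [NormedSpace ℝ E'] [CompleteSpace E']
    {c : E →L[ℝ] E →L[ℝ] E} {c' : E' →L[ℝ] E' →L[ℝ] E'} {L : E →L[ℝ] E'}
    (hL : ∀ x y, c' (L x) (L y) = L (c x y)) {y : E} {z : ℝ → E} (h : IsLogCurve c y z) :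
    IsLogCurve c' (L y) (L ∘ z) := by
  intro t ht
  obtain ⟨z', hz, hz'⟩ := h t ht
  refine ⟨L z', L.hasFDerivAt.comp_hasDerivAt t hz, ?_⟩
  rw [← hz']
  exact lieKernel_conj L (fun x => hL (z t) x) z'

end LieKernel

/-! ## The exponential map of a frame satisfying the Maurer–Cartan equation -/

section LocalExp

variable {E : Type u} [NormedAddCommGroup E] [NormedSpace ℝ E] [CompleteSpace E]

/-- Evaluation of the extended curve at a given time, as a continuous linear map. -/
def evalCurve (t : ℝ) : C(TimeInterval, E) →L[ℝ] E :=
  ContinuousMap.evalCLM ℝ (projIcc (-2 : ℝ) 2 (by norm_num) t)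

/-- If `ξ` solves the linearisation of `e' = A(e) x` in the direction `v`, with `ξ 0 = 0`, and `A`
satisfies the Maurer–Cartan equation, then `ξ 1 = A(e 1) (lieKernel (ad x) v)`. -/
lemma linearised_eq_lieKernel {A : E → E →L[ℝ] E} {c : E →L[ℝ] E →L[ℝ] E} {U : Set E}
    (hU : IsOpen U) (hA : ContDiffOn ℝ 1 A U)
    (hMC : ∀ p ∈ U, ∀ X Y, fderiv ℝ A p (A p X) Y - fderiv ℝ A p (A p Y) X = A p (c X Y))
    {x v : E} {e ξ : ℝ → E} (he : ∀ t ∈ Ioo (-2 : ℝ) 2, e t ∈ U ∧ HasDerivAt e (A (e t) x) t)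
    (hξ0 : ξ 0 = 0)
    (hξ : ∀ t ∈ Ioo (-2 : ℝ) 2, HasDerivAt ξ (fderiv ℝ A (e t) (ξ t) x + A (e t) v) t) :
    ξ 1 = A (e 1) (lieKernel (c x) v) := by
  have hsub : Icc (0 : ℝ) 1 ⊆ Ioo (-2) 2 := fun t ht =>
    ⟨by linarith [ht.1], by linarith [ht.2]⟩
  have hsub' : Ico (0 : ℝ) 1 ⊆ Ioo (-2) 2 := Ico_subset_Icc_self.trans hsub
  have hA' : ContinuousOn (fderiv ℝ A) U := hA.continuousOn_fderiv_of_isOpen hU le_rfl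
  have hec : ContinuousOn e (Icc 0 1) := fun t ht =>
    (he t (hsub ht)).2.continuousAt.continuousWithinAt
  have hdc : ContinuousOn (fun t => fderiv ℝ A (e t)) (Icc (0 : ℝ) 1) :=
    hA'.comp hec fun t ht => (he t (hsub ht)).1
  obtain ⟨K, hK⟩ := IsCompact.exists_bound_of_continuousOn (E := E →L[ℝ] E →L[ℝ] E)
    isCompact_Icc hdc
  set w : ℝ → E := fun s => kernelSolution (c x) s v with hw
  -- The candidate A(e) w has derivative DA(A x) w + A(v - c(x, w)); the Maurer–Cartan equation
  -- rewrites this as DA(A w) x + A v, the linear equation satisfied by `ξ`.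
  have hη : ∀ t ∈ Ioo (-2 : ℝ) 2, HasDerivAt (fun t => A (e t) (w t))
      (fderiv ℝ A (e t) (A (e t) (w t)) x + A (e t) v) t := by
    intro t ht
    have h1 : HasFDerivAt A (fderiv ℝ A (e t)) (e t) :=
      ((hA.differentiableOn one_ne_zero).differentiableAt (hU.mem_nhds (he t ht).1)).hasFDerivAt
    have h2 := (h1.comp_hasDerivAt t (he t ht).2).clm_apply (hasDerivAt_kernelSolution (c x) v t)
    refine h2.congr_deriv ?_
    have h3 := hMC _ (he t ht).1 x (w t)
    simp only [hw, Function.comp_apply] at h3 ⊢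
    rw [map_sub, ← h3]
    abel
  have hlip : ∀ t ∈ Ico (0 : ℝ) 1, LipschitzOnWith (Real.toNNReal (K * ‖x‖))
      (fun u => fderiv ℝ A (e t) u x + A (e t) v) univ := by
    intro t ht
    refine LipschitzWith.lipschitzOnWith (LipschitzWith.of_dist_le_mul fun a b => ?_)
    rw [dist_add_right, dist_eq_norm, dist_eq_norm, ← sub_apply, ← map_sub]
    calc ‖fderiv ℝ A (e t) (a - b) x‖ ≤ ‖fderiv ℝ A (e t) (a - b)‖ * ‖x‖ :=
          ContinuousLinearMap.le_opNorm _ _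
      _ ≤ (K * ‖a - b‖) * ‖x‖ := by
          gcongr
          exact ContinuousLinearMap.le_of_opNorm_le _ (hK t (Ico_subset_Icc_self ht)) _
      _ = K * ‖x‖ * ‖a - b‖ := by ring
      _ ≤ _ := by gcongr; exact Real.le_coe_toNNReal _
  have := ODE_solution_unique_of_mem_Icc_right (a := 0) (b := 1) (f := ξ)
    (g := fun t => A (e t) (w t)) (v := fun t u => fderiv ℝ A (e t) u x + A (e t) v)
    (s := fun _ => univ) hlip
    (fun t ht => (hξ t (hsub ht)).continuousAt.continuousWithinAt)
    (fun t ht => (hξ t (hsub' ht)).hasDerivWithinAt) (fun _ _ => mem_univ _)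
    (fun t ht => (hη t (hsub ht)).continuousAt.continuousWithinAt)
    (fun t ht => (hη t (hsub' ht)).hasDerivWithinAt) (fun _ _ => mem_univ _)
    (by simp [hξ0, hw, kernelSolution_zero])
  exact this (right_mem_Icc.2 zero_le_one)

/-- The exponential map of a frame `A` satisfying the Maurer–Cartan equation with bracket `c`, and
its derivative. -/
theorem exists_local_exp {A : E → E →L[ℝ] E} {c : E →L[ℝ] E →L[ℝ] E} {U : Set E}
    (hU : IsOpen U) (hA : ContDiffOn ℝ 1 A U)
    (hMC : ∀ p ∈ U, ∀ X Y, fderiv ℝ A p (A p X) Y - fderiv ℝ A p (A p Y) X = A p (c X Y))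
    {p₀ : E} (hp₀ : p₀ ∈ U) :
    ∃ e : E → ℝ → E, ContDiffAt ℝ 1 (fun x => e x 1) 0 ∧ (∀ t, e 0 t = p₀) ∧
      ∀ᶠ x in 𝓝 0, e x 0 = p₀ ∧
        (∀ t ∈ Ioo (-2 : ℝ) 2, e x t ∈ U ∧ HasDerivAt (e x) (A (e x t) x) t) ∧
        HasFDerivAt (fun x => e x 1) (A (e x 1) ∘L lieKernel (c x)) x := by
  -- The Lie algebra element is the parameter and the displacement from `p₀` is the unknown. At
  -- parameter 0 the field vanishes identically, as `exists_smooth_solution` requires.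
  set f : E × E → E := fun p => A (p₀ + p.2) p.1 with hf
  set U' : Set (E × E) := {p | p₀ + p.2 ∈ U} with hU'
  have hU'o : IsOpen U' := hU.preimage (by fun_prop)
  have hfc : ContDiffOn ℝ 1 f U' :=
    (hA.comp (contDiffOn_const.add contDiffOn_snd) fun p hp => hp).clm_apply contDiffOn_fst
  obtain ⟨S, hS, hS0, hSe⟩ := exists_smooth_solution (n := 1) one_ne_zero hU'o hfc (q₀ := 0)
    (by simpa [hU'] using hp₀) (fun x _ => by simp [hf])
  refine ⟨fun x t => p₀ + extendCurve (S x) t, ?_, fun t => by simp [hS0, extendCurve], ?_⟩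
  · exact contDiffAt_const.add ((evalCurve (E := E) 1).contDiff.contDiffAt.comp 0 hS)
  have hSd : ∀ᶠ x in 𝓝 0, ContDiffAt ℝ 1 S x := hS.eventually (by simp)
  filter_upwards [hSe.eventually_nhds, hSd] with x hx hdx
  have hx0 := hx.self_of_nhds
  have hmem : ∀ t, p₀ + extendCurve (S x) t ∈ U := fun t => hx0.1 _
  have hpair : ∀ t, pairCurve (x, S x) t ∈ U' := fun t => hx0.1 t
  have hder : ∀ t ∈ Ioo (-2 : ℝ) 2, HasDerivAt (fun t => p₀ + extendCurve (S x) t)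
      (A (p₀ + extendCurve (S x) t) x) t := by
    intro t ht
    have h1 := (hasDerivAt_extendCurve_primitive
      (nemytskii f (pairCurve (x, S x))) ht).const_add p₀
    rw [← hx0.2] at h1
    refine h1.congr_deriv ?_
    rw [extendCurve, nemytskii_apply hfc.continuousOn hpair, pairCurve_apply]
    rfl
  refine ⟨?_, fun t ht => ⟨hmem t, hder t ht⟩, ?_⟩
  · have := extendCurve_primitive_zero (nemytskii f (pairCurve (x, S x)))
    rw [← hx0.2] at this
    rw [this, add_zero]
  have hS' : HasFDerivAt S (fderiv ℝ S x) x := (hdx.differentiableAt one_ne_zero).hasFDerivAt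
  have heval : HasFDerivAt (fun x => p₀ + extendCurve (S x) 1)
      (evalCurve 1 ∘L fderiv ℝ S x) x :=
    ((evalCurve (E := E) 1).hasFDerivAt.comp x hS').const_add p₀
  refine heval.congr_fderiv ?_
  ext v
  -- Differentiating the integral equation in the parameter gives the integral form of the
  -- variational equation; this needs the integral equation on a whole neighbourhood of `x`.
  have hS'' : fderiv ℝ S x v = primitive (pointwiseApply
      (nemytskii (fderiv ℝ f) (pairCurve (x, S x))) (pairCurve (v, fderiv ℝ S x v))) := by
    have h1 : HasFDerivAt (fun x => (x, S x)) ((ContinuousLinearMap.id ℝ E).prod (fderiv ℝ S x)) x :=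
      (hasFDerivAt_id x).prodMk hS'
    have h2 : HasFDerivAt (fun x => pairCurve (x, S x))
        (pairCurve ∘L (ContinuousLinearMap.id ℝ E).prod (fderiv ℝ S x)) x :=
      (pairCurve (Q := E) (E := E)).hasFDerivAt.comp x h1
    have h3 := primitive.hasFDerivAt.comp x ((hasFDerivAt_nemytskii hU'o hfc hpair).comp x h2)
    have h4 := hS'.unique (h3.congr_of_eventuallyEq (hx.mono fun y hy => hy.2))
    exact DFunLike.congr_fun h4 v
  refine linearised_eq_lieKernel hU hA hMC (e := fun t => p₀ + extendCurve (S x) t)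
    (ξ := extendCurve (fderiv ℝ S x v)) (fun t ht => ⟨hmem t, hder t ht⟩) ?_ fun t ht => ?_
  · rw [hS'']; exact extendCurve_primitive_zero _
  · have h1 := hasDerivAt_extendCurve_primitive (pointwiseApply
      (nemytskii (fderiv ℝ f) (pairCurve (x, S x))) (pairCurve (v, fderiv ℝ S x v))) ht
    rw [← hS''] at h1
    refine h1.congr_deriv ?_
    rw [extendCurve, pointwiseApply_apply,
      nemytskii_apply (hfc.continuousOn_fderiv_of_isOpen hU'o le_rfl) hpair, pairCurve_apply,
      pairCurve_apply]
    set τ := projIcc (-2 : ℝ) 2 (by norm_num) t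
    have hA' : HasFDerivAt A (fderiv ℝ A (p₀ + S x τ)) (p₀ + S x τ) :=
      ((hA.differentiableOn one_ne_zero).differentiableAt (hU.mem_nhds (hmem t))).hasFDerivAt
    have h2 : HasFDerivAt (fun p : E × E => A (p₀ + p.2))
        (fderiv ℝ A (p₀ + S x τ) ∘L .snd ℝ E E) (x, S x τ) :=
      HasFDerivAt.comp (x, S x τ) (f := fun p : E × E => p₀ + p.2) hA' (hasFDerivAt_snd.const_add p₀)
    have h3 : HasFDerivAt f _ (x, S x τ) := h2.clm_apply hasFDerivAt_fst
    rw [h3.fderiv]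
    simp [extendCurve, τ, add_comm]

end LocalExp

/-! ## The flow defining the operation of a Lie group in exponential coordinates -/

section LogFlow

variable {E : Type u} [NormedAddCommGroup E] [NormedSpace ℝ E] [CompleteSpace E]

lemma eventually_isUnit_lieKernel : ∀ᶠ T in 𝓝 (0 : E →L[ℝ] E), IsUnit (lieKernel T) := by
  have h : ContinuousAt lieKernel (0 : E →L[ℝ] E) :=
    (contDiff_lieKernel (n := 0)).continuous.continuousAt
  refine h.eventually_mem (s := {T | IsUnit T}) (Units.isOpen.mem_nhds ?_)
  rw [mem_ofPred_eq, lieKernel_zero]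
  exact isUnit_one

lemma inverse_lieKernel_apply {T : E →L[ℝ] E} (h : IsUnit (lieKernel T)) (y : E) :
    lieKernel T (Ring.inverse (lieKernel T) y) = y := by
  have := Ring.mul_inverse_cancel _ h
  exact DFunLike.congr_fun this y

lemma eq_inverse_lieKernel {T : E →L[ℝ] E} (h : IsUnit (lieKernel T)) {y z : E}
    (hz : lieKernel T z = y) : z = Ring.inverse (lieKernel T) y := by
  have := Ring.inverse_mul_cancel _ h
  rw [← hz]
  exact (DFunLike.congr_fun this z).symm

/-- The right-hand side `(c, x, y, u) ↦ (lieKernel (c (x + u)))⁻¹ y`. -/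
def logField (p : ((E →L[ℝ] E →L[ℝ] E) × E × E) × E) : E :=
  Ring.inverse (lieKernel (p.1.1 (p.1.2.1 + p.2))) p.1.2.2

/-- The set where `logField` is smooth. -/
def logFieldDomain (E : Type u) [NormedAddCommGroup E] [NormedSpace ℝ E] :
    Set (((E →L[ℝ] E →L[ℝ] E) × E × E) × E) :=
  {p | IsUnit (lieKernel (p.1.1 (p.1.2.1 + p.2)))}

lemma contDiff_lieKernel_comp : ContDiff ℝ ∞ fun p : ((E →L[ℝ] E →L[ℝ] E) × E × E) × E =>
    lieKernel (p.1.1 (p.1.2.1 + p.2)) := by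
  have h : ContDiff ℝ ∞ fun p : ((E →L[ℝ] E →L[ℝ] E) × E × E) × E => p.1.1 (p.1.2.1 + p.2) :=
    contDiff_fst.fst.clm_apply (contDiff_fst.snd.fst.add contDiff_snd)
  exact contDiff_lieKernel.comp h

lemma isOpen_logFieldDomain : IsOpen (logFieldDomain E) :=
  Units.isOpen.preimage contDiff_lieKernel_comp.continuous

lemma contDiffOn_logField : ContDiffOn ℝ ∞ logField (logFieldDomain E) := by
  intro p hp
  obtain ⟨g, hg⟩ := hp
  have h1 : ContDiffAt ℝ ∞ Ring.inverse (lieKernel (p.1.1 (p.1.2.1 + p.2))) := by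
    rw [← hg]; exact contDiffAt_ringInverse ℝ g
  have h2 := h1.comp p contDiff_lieKernel_comp.contDiffAt
  exact (h2.clm_apply contDiffAt_fst.snd.snd).contDiffWithinAt

/-- The solution of `lieKernel (c z) z' = y`, `z 0 = x` depends smoothly on `(c, x, y)`. -/
theorem exists_logCurve (c₀ : E →L[ℝ] E →L[ℝ] E) :
    ∃ Z : (E →L[ℝ] E →L[ℝ] E) × E × E → ℝ → E,
      ContDiffAt ℝ ∞ (fun q => Z q 1) (c₀, 0, 0) ∧
      (∀ r > 0, ∀ᶠ q in 𝓝 (c₀, (0 : E), (0 : E)), ∀ t, ‖Z q t‖ < r) ∧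
      ∀ᶠ q in 𝓝 (c₀, (0 : E), (0 : E)), Z q 0 = q.2.1 ∧ IsLogCurve q.1 q.2.2 (Z q) := by
  have h0 : ((c₀, (0 : E), (0 : E)), (0 : E)) ∈ logFieldDomain E := by
    change IsUnit (lieKernel (c₀ (0 + 0)))
    rw [add_zero, map_zero, lieKernel_zero]
    exact isUnit_one
  have hf : ContDiffOn ℝ ((⊤ : ℕ∞) : WithTop ℕ∞) (logField (E := E)) (logFieldDomain E) :=
    contDiffOn_logField
  have hflow := @exists_smooth_solution E _ _ _ ((E →L[ℝ] E →L[ℝ] E) × E × E) _ _ _ ⊤ (by simp)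
    logField (logFieldDomain E) isOpen_logFieldDomain
  -- The bracket belongs to the parameter. At y = 0 the field vanishes because it is linear in y, so
  -- every point is an equilibrium there.
  obtain ⟨S, hS, hS0, hSe⟩ := hflow hf h0 fun x _ => map_zero _
  refine ⟨fun q t => q.2.1 + extendCurve (S q) t, ?_, ?_, ?_⟩
  · have h1 : ContDiff ℝ ∞ (evalCurve (E := E) 1) := (evalCurve (E := E) 1).contDiff
    have h2 : ContDiffAt ℝ ∞ (fun q => evalCurve 1 (S q)) (c₀, (0 : E), (0 : E)) :=
      ContDiffAt.comp _ h1.contDiffAt hS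
    have h3 : ContDiffAt ℝ ∞ (fun q : (E →L[ℝ] E →L[ℝ] E) × E × E => q.2.1) (c₀, 0, 0) :=
      contDiffAt_snd.fst
    exact h3.add h2
  · intro r hr
    have h2 : ContinuousAt (fun q : (E →L[ℝ] E →L[ℝ] E) × E × E => ‖q.2.1‖ + ‖S q‖)
        (c₀, 0, 0) := continuousAt_snd.fst.norm.add hS.continuousAt.norm
    have h3 := h2.tendsto
    simp only [hS0, norm_zero, add_zero] at h3
    filter_upwards [h3.eventually_lt_const hr] with q hq t
    exact (norm_add_le _ _).trans_lt (lt_of_le_of_lt (by gcongr; exact norm_extendCurve_le _ _) hq)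
  · filter_upwards [hSe] with q hq
    have hpair : ∀ t, pairCurve (q, S q) t ∈ logFieldDomain E := fun t => hq.1 t
    refine ⟨?_, fun t ht => ⟨logField (q, extendCurve (S q) t), ?_, ?_⟩⟩
    · have := extendCurve_primitive_zero (nemytskii logField (pairCurve (q, S q)))
      rw [← hq.2] at this
      rw [this, add_zero]
    · have h1 := (hasDerivAt_extendCurve_primitive
        (nemytskii logField (pairCurve (q, S q))) ht).const_add q.2.1
      rw [← hq.2] at h1
      refine h1.congr_deriv ?_
      rw [extendCurve, nemytskii_apply contDiffOn_logField.continuousOn hpair]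
      rfl
    · exact inverse_lieKernel_apply (hq.1 _) _

/-- Small solutions of `lieKernel (c z) z' = y` are determined by their initial value. -/
theorem exists_logCurve_unique (c : E →L[ℝ] E →L[ℝ] E) :
    ∃ r > 0, ∀ (y : E) (z₁ z₂ : ℝ → E), (∀ t ∈ Ioo (-2 : ℝ) 2, ‖z₁ t‖ < r) →
      (∀ t ∈ Ioo (-2 : ℝ) 2, ‖z₂ t‖ < r) → IsLogCurve c y z₁ → IsLogCurve c y z₂ →
      z₁ 0 = z₂ 0 → EqOn z₁ z₂ (Ioo (-2) 2) := by
  have h1 : ContDiffAt ℝ 1 (fun z : E => Ring.inverse (lieKernel (c z))) 0 := by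
    have h2 : ContDiffAt ℝ 1 Ring.inverse (lieKernel (c (0 : E))) := by
      have h4 : lieKernel (c (0 : E)) = ((1 : (E →L[ℝ] E)ˣ) : E →L[ℝ] E) := by
        rw [map_zero, lieKernel_zero]; rfl
      rw [h4]
      exact contDiffAt_ringInverse ℝ _
    have h3 : ContDiffAt ℝ 1 (fun z : E => lieKernel (c z)) 0 :=
      (contDiff_lieKernel.comp c.contDiff).contDiffAt
    exact h2.comp (0 : E) h3
  -- The Lipschitz bound is on the inverse operator as a function of z; multiplied by the norm of
  -- `y` it bounds the field, so the radius `r` does not depend on `y`.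
  obtain ⟨K, V, hV, hK⟩ := h1.exists_lipschitzOnWith
  have h2 : ∀ᶠ z in 𝓝 (0 : E), IsUnit (lieKernel (c z)) := by
    have : ContinuousAt c (0 : E) := c.continuous.continuousAt
    rw [ContinuousAt, map_zero] at this
    exact this.eventually eventually_isUnit_lieKernel
  obtain ⟨r, hr, hrV⟩ := Metric.mem_nhds_iff.1 (inter_mem hV h2)
  refine ⟨r, hr, fun y z₁ z₂ hz₁ hz₂ h₁ h₂ h0 => ?_⟩
  refine ODE_solution_unique_of_mem_Ioo (K := K * ‖y‖₊) (t₀ := 0)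
    (v := fun _ z => Ring.inverse (lieKernel (c z)) y) (s := fun _ => Metric.ball 0 r)
    (fun t _ => ?_) (by norm_num) (fun t ht => ?_) (fun t ht => ?_) h0
  · refine LipschitzOnWith.of_dist_le_mul fun a ha b hb => ?_
    rw [dist_eq_norm, ← sub_apply]
    refine (ContinuousLinearMap.le_opNorm _ _).trans ?_
    have := hK.dist_le_mul a (hrV ha).1 b (hrV hb).1
    rw [dist_eq_norm] at this
    calc _ ≤ (K * dist a b) * ‖y‖ := by gcongr
      _ = _ := by push_cast; ring
  · have hm : z₁ t ∈ Metric.ball (0 : E) r := by simpa using hz₁ t ht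
    obtain ⟨z', hz, hz'⟩ := h₁ t ht
    exact ⟨hz.congr_deriv (eq_inverse_lieKernel (hrV hm).2 hz'), hm⟩
  · have hm : z₂ t ∈ Metric.ball (0 : E) r := by simpa using hz₂ t ht
    obtain ⟨z', hz, hz'⟩ := h₂ t ht
    exact ⟨hz.congr_deriv (eq_inverse_lieKernel (hrV hm).2 hz'), hm⟩

end LogFlow

/-! ## Left-invariant vector fields in the chart at the identity -/

section Frame

open VectorField

variable {E : Type*} [NormedAddCommGroup E] [NormedSpace ℝ E] [FiniteDimensional ℝ E]
  [CompleteSpace E]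

variable (E) in
/-- The Lie algebra of a Lie group modelled on `E`, identified with `E`. -/
def algebraEquiv (G : Type*) [TopologicalSpace G] [ChartedSpace E G] [Group G] :
    E ≃L[ℝ] GroupLieAlgebra 𝓘(ℝ, E) G :=
  ContinuousLinearEquiv.refl ℝ E

variable {G : Type*} [TopologicalSpace G] [ChartedSpace E G] [Group G] [LieGroup 𝓘(ℝ, E) ∞ G]

instance : IsManifold 𝓘(ℝ, E) 1 G := IsManifold.of_le (n := ∞) (by exact_mod_cast le_top)

variable (E G) in
/-- The Lie bracket, as a continuous bilinear map on `E`. -/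
def groupBracket : E →L[ℝ] E →L[ℝ] E :=
  LinearMap.toContinuousLinearMap (LinearMap.toContinuousLinearMap.toLinearMap ∘ₗ
    LinearMap.mk₂ ℝ (fun X Y => (algebraEquiv E G).symm ⁅algebraEquiv E G X, algebraEquiv E G Y⁆)
      (by simp) (by simp) (by simp) (by simp))

variable (E G) in
/-- The left-invariant vector fields in the chart at the identity. -/
def leftFrame (p : E) : E →L[ℝ] E :=
  LinearMap.toContinuousLinearMap
    { toFun := fun X => mpullback 𝓘(ℝ, E) 𝓘(ℝ, E) (extChartAt 𝓘(ℝ, E) (1 : G)).symm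
        (mulInvariantVectorField (algebraEquiv E G X)) p
      map_add' := fun X Y => by
        rw [map_add, mulInvariantVectorField_add, mpullback_add]; rfl
      map_smul' := fun c X => by
        rw [map_smul, mulInvariantVectorField_smul, mpullback_const_smul]; rfl }

lemma contMDiffAt_chart_symm {p : E} (hp : p ∈ (extChartAt 𝓘(ℝ, E) (1 : G)).target) :
    ContMDiffAt 𝓘(ℝ, E) 𝓘(ℝ, E) ∞ (extChartAt 𝓘(ℝ, E) (1 : G)).symm p :=
  (contMDiffOn_extChartAt_symm (1 : G)).contMDiffAt
    ((isOpen_extChartAt_target (1 : G)).mem_nhds hp)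

lemma isInvertible_mfderiv_chart_symm {p : E} (hp : p ∈ (extChartAt 𝓘(ℝ, E) (1 : G)).target) :
    (mfderiv 𝓘(ℝ, E) 𝓘(ℝ, E) (extChartAt 𝓘(ℝ, E) (1 : G)).symm p).IsInvertible := by
  have := isInvertible_mfderivWithin_extChartAt_symm (I := 𝓘(ℝ, E)) hp
  simpa using this

lemma contMDiff_mulInvariantVectorField_one (X : GroupLieAlgebra 𝓘(ℝ, E) G) :
    ContMDiff 𝓘(ℝ, E) 𝓘(ℝ, E).tangent 1
      (fun g : G => (⟨g, mulInvariantVectorField X g⟩ : TangentBundle 𝓘(ℝ, E) G)) :=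
  (contMDiff_mulInvariantVectorField X).of_le
    (by rw [minSmoothness_of_isRCLikeNormedField]; norm_num)

/-- Class C¹ suffices: the frame only serves to differentiate exp once. The smoothness of the limit
operation comes from `logField`. -/
lemma contDiffOn_leftFrame :
    ContDiffOn ℝ 1 (leftFrame E G) (extChartAt 𝓘(ℝ, E) (1 : G)).target := by
  rw [contDiffOn_clm_apply]
  intro X p hp
  refine ContDiffAt.contDiffWithinAt (contMDiffAt_vectorSpace_iff_contDiffAt
    (V := fun p => leftFrame E G p X).1 ?_)
  exact ContMDiffAt.mpullback_vectorField_preimage (n := 2)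
    (contMDiff_mulInvariantVectorField_one _).contMDiffAt
    ((contMDiffAt_chart_symm hp).of_le ENat.LEInfty.out)
    (isInvertible_mfderiv_chart_symm hp) (by norm_num)

/-- Pullback by the chart commutes with the bracket of vector fields, and the bracket of two
left-invariant fields is the left-invariant field of the Lie bracket; in a vector space the former
is DW(V) - DV(W). -/
lemma leftFrame_maurerCartan {p : E} (hp : p ∈ (extChartAt 𝓘(ℝ, E) (1 : G)).target) (X Y : E) :
    fderiv ℝ (leftFrame E G) p (leftFrame E G p X) Y -
      fderiv ℝ (leftFrame E G) p (leftFrame E G p Y) X =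
    leftFrame E G p (groupBracket E G X Y) := by
  have hd : DifferentiableAt ℝ (leftFrame E G) p :=
    (contDiffOn_leftFrame.differentiableOn one_ne_zero).differentiableAt
      ((isOpen_extChartAt_target (1 : G)).mem_nhds hp)
  have h1 : ∀ X : E, fderiv ℝ (fun q => leftFrame E G q X) p =
      (ContinuousLinearMap.apply ℝ E X) ∘L fderiv ℝ (leftFrame E G) p := fun X =>
    ((ContinuousLinearMap.apply ℝ E X).hasFDerivAt.comp p hd.hasFDerivAt).fderiv
  have h2 := mpullback_mlieBracket (I := 𝓘(ℝ, E)) (I' := 𝓘(ℝ, E)) (n := minSmoothness ℝ 3)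
    (f := (extChartAt 𝓘(ℝ, E) (1 : G)).symm)
    (V := mulInvariantVectorField (algebraEquiv E G X))
    (W := mulInvariantVectorField (algebraEquiv E G Y)) (x₀ := p)
    (mdifferentiableAt_mulInvariantVectorField _) (mdifferentiableAt_mulInvariantVectorField _)
    ((contMDiffAt_chart_symm hp).of_le ENat.LEInfty.out)
    (minSmoothness_monotone (by norm_cast))
  rw [← mulInvariantVector_mlieBracket, ← mlieBracketWithin_univ (I := 𝓘(ℝ, E)) (M := E),
    mlieBracketWithin_eq_lieBracketWithin] at h2
  have h3 : lieBracketWithin ℝ (fun q => leftFrame E G q X) (fun q => leftFrame E G q Y) univ p =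
      leftFrame E G p (groupBracket E G X Y) := h2.symm
  rw [lieBracketWithin_univ] at h3
  rw [← h3, lieBracket, h1, h1]
  rfl

lemma mfderiv_chart_symm_leftFrame {p : E} (hp : p ∈ (extChartAt 𝓘(ℝ, E) (1 : G)).target) (X : E) :
    mfderiv 𝓘(ℝ, E) 𝓘(ℝ, E) (extChartAt 𝓘(ℝ, E) (1 : G)).symm p (leftFrame E G p X) =
      mulInvariantVectorField (algebraEquiv E G X) ((extChartAt 𝓘(ℝ, E) (1 : G)).symm p) :=
  (isInvertible_mfderiv_chart_symm hp).self_apply_inverse _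

lemma isMIntegralCurveOn_chart_symm {e : ℝ → E} {X : E} {s : Set ℝ}
    (he : ∀ t ∈ s, e t ∈ (extChartAt 𝓘(ℝ, E) (1 : G)).target ∧
      HasDerivAt e (leftFrame E G (e t) X) t) :
    IsMIntegralCurveOn (I := 𝓘(ℝ, E)) (fun t => (extChartAt 𝓘(ℝ, E) (1 : G)).symm (e t))
      (mulInvariantVectorField (algebraEquiv E G X)) s := by
  intro t ht
  have h1 : HasMFDerivAt 𝓘(ℝ, ℝ) 𝓘(ℝ, E) e t
      ((1 : ℝ →L[ℝ] ℝ).smulRight (leftFrame E G (e t) X)) :=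
    hasMFDerivAt_iff_hasFDerivAt.2 (he t ht).2.hasFDerivAt
  have h2 := (((contMDiffAt_chart_symm (he t ht).1).mdifferentiableAt
    (by simp)).hasMFDerivAt.comp t h1).hasMFDerivWithinAt (s := s)
  refine h2.congr_mfderiv ?_
  rw [← mfderiv_chart_symm_leftFrame (he t ht).1]
  refine ContinuousLinearMap.ext_ring ?_
  change mfderiv 𝓘(ℝ, E) 𝓘(ℝ, E) (extChartAt 𝓘(ℝ, E) (1 : G)).symm (e t)
    ((1 : ℝ) • leftFrame E G (e t) X) = (1 : ℝ) • mfderiv 𝓘(ℝ, E) 𝓘(ℝ, E)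
      (extChartAt 𝓘(ℝ, E) (1 : G)).symm (e t) (leftFrame E G (e t) X)
  rw [one_smul]
  exact (one_smul ℝ _).symm

lemma mulInvariantVectorField_one_eq (X : GroupLieAlgebra 𝓘(ℝ, E) G) :
    mulInvariantVectorField X (1 : G) = X := by
  have : (fun x : G => 1 * x) = id := by ext; simp
  rw [mulInvariantVectorField, this, mfderiv_id]
  rfl

lemma exists_equiv_leftFrame_one : ∃ A : E ≃L[ℝ] E,
    (A : E →L[ℝ] E) = leftFrame E G (extChartAt 𝓘(ℝ, E) (1 : G) 1) := by
  have hinj : Function.Injective (leftFrame E G (extChartAt 𝓘(ℝ, E) (1 : G) 1)) := by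
    rw [injective_iff_map_eq_zero]
    intro X hX
    have h := mfderiv_chart_symm_leftFrame (G := G) (mem_extChartAt_target (1 : G)) X
    rw [extChartAt_to_inv, mulInvariantVectorField_one_eq] at h
    have h0 : mfderiv 𝓘(ℝ, E) 𝓘(ℝ, E) (extChartAt 𝓘(ℝ, E) (1 : G)).symm
        (extChartAt 𝓘(ℝ, E) (1 : G) 1) (leftFrame E G (extChartAt 𝓘(ℝ, E) (1 : G) 1) X) = 0 :=
      (congrArg _ hX).trans (map_zero (mfderiv 𝓘(ℝ, E) 𝓘(ℝ, E) (extChartAt 𝓘(ℝ, E) (1 : G)).symm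
        (extChartAt 𝓘(ℝ, E) (1 : G) 1)))
    exact h.symm.trans h0
  refine ⟨(LinearEquiv.ofInjectiveEndo (leftFrame E G (extChartAt 𝓘(ℝ, E) (1 : G) 1)).toLinearMap
    hinj).toContinuousLinearEquiv, ?_⟩
  ext X
  rfl

end Frame

/-! ## The exponential map of a Lie group -/

section Exp

variable {E : Type*} [NormedAddCommGroup E] [NormedSpace ℝ E] [FiniteDimensional ℝ E]
  [CompleteSpace E] {G : Type*} [TopologicalSpace G] [ChartedSpace E G]
  [Group G] [LieGroup 𝓘(ℝ, E) ∞ G]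

/-- Left invariance as a pullback becomes this pushforward form because the differential of
translation by g is inverted by that of translation by g⁻¹. -/
lemma mfderiv_mul_left_mulInvariantVectorField (X : GroupLieAlgebra 𝓘(ℝ, E) G) (g h : G) :
    mfderiv 𝓘(ℝ, E) 𝓘(ℝ, E) (g * ·) h (mulInvariantVectorField X h) =
      mulInvariantVectorField X (g * h) := by
  have h1 := mpullback_mulInvariantVectorField (I := 𝓘(ℝ, E)) g X
  have h2 := congrFun h1 h
  rw [VectorField.mpullback_apply] at h2
  have h3 : (mfderiv 𝓘(ℝ, E) 𝓘(ℝ, E) (g * ·) h).IsInvertible := by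
    have hd : ∀ (a b : G), MDifferentiableAt 𝓘(ℝ, E) 𝓘(ℝ, E) (a * ·) b := fun a b =>
      (contMDiff_mul_left (I := 𝓘(ℝ, E)) (n := 1) (a := a)).mdifferentiable one_ne_zero _
    have A : mfderiv 𝓘(ℝ, E) 𝓘(ℝ, E) ((fun x => g⁻¹ * x) ∘ (fun x => g * x)) h =
        ContinuousLinearMap.id _ _ := by
      have : (fun x => g⁻¹ * x) ∘ (fun x => g * x) = id := by ext x; simp
      rw [this, mfderiv_id]
    rw [mfderiv_comp (I' := 𝓘(ℝ, E)) _ (hd _ _) (hd _ _)] at A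
    have A' : mfderiv 𝓘(ℝ, E) 𝓘(ℝ, E) ((fun x => g * x) ∘ (fun x => g⁻¹ * x)) (g * h) =
        ContinuousLinearMap.id _ _ := by
      have : (fun x => g * x) ∘ (fun x => g⁻¹ * x) = id := by ext x; simp
      rw [this, mfderiv_id]
    rw [mfderiv_comp (I' := 𝓘(ℝ, E)) _ (hd _ _) (hd _ _), inv_mul_cancel_left g h] at A'
    exact ContinuousLinearMap.IsInvertible.of_inverse A' A
  rw [← h2]
  exact h3.self_apply_inverse _

lemma _root_.IsMIntegralCurveOn.mul_left_invariant {X : GroupLieAlgebra 𝓘(ℝ, E) G} {γ : ℝ → G} {s : Set ℝ}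
    (h : IsMIntegralCurveOn (I := 𝓘(ℝ, E)) γ (mulInvariantVectorField X) s) (g : G) :
    IsMIntegralCurveOn (I := 𝓘(ℝ, E)) (fun t => g * γ t) (mulInvariantVectorField X) s := by
  intro t ht
  have h1 : MDifferentiableAt 𝓘(ℝ, E) 𝓘(ℝ, E) (g * ·) (γ t) :=
    (contMDiff_mul_left (I := 𝓘(ℝ, E)) (n := 1) (a := g)).mdifferentiable one_ne_zero _
  refine (h1.hasMFDerivAt.comp_hasMFDerivWithinAt t (h t ht)).congr_mfderiv ?_
  refine ContinuousLinearMap.ext_ring ?_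
  rw [← mfderiv_mul_left_mulInvariantVectorField]
  change mfderiv 𝓘(ℝ, E) 𝓘(ℝ, E) (g * ·) (γ t) ((1 : ℝ) • mulInvariantVectorField X (γ t)) =
    (1 : ℝ) • mfderiv 𝓘(ℝ, E) 𝓘(ℝ, E) (g * ·) (γ t) (mulInvariantVectorField X (γ t))
  rw [one_smul]
  exact (one_smul ℝ _).symm

variable [T2Space G]

/-- Left translates of one local integral curve through 1 give integral curves through all points
with the same time of existence, and such a uniform time implies completeness. -/
lemma exists_isMIntegralCurve_mulInvariant (X : GroupLieAlgebra 𝓘(ℝ, E) G) :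
    ∃ γ : ℝ → G, γ 0 = 1 ∧ IsMIntegralCurve (I := 𝓘(ℝ, E)) γ (mulInvariantVectorField X) := by
  have hv := contMDiff_mulInvariantVectorField_one X
  obtain ⟨γ, hγ0, hγ⟩ := exists_isMIntegralCurveAt_of_contMDiffAt_boundaryless 0 (x₀ := (1 : G))
    hv.contMDiffAt
  obtain ⟨ε, hε, h⟩ := isMIntegralCurveAt_iff'.1 hγ
  refine exists_isMIntegralCurve_of_isMIntegralCurveOn hv hε (fun g => ⟨fun t => g * γ t, ?_, ?_⟩) 1
  · simp only [hγ0, mul_one]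
  · rw [Real.ball_eq_Ioo, zero_sub, zero_add] at h
    exact h.mul_left_invariant g

/-- The one-parameter subgroup `t ↦ exp (t X)`. -/
def oneParam (X : GroupLieAlgebra 𝓘(ℝ, E) G) : ℝ → G :=
  (exists_isMIntegralCurve_mulInvariant X).choose

lemma oneParam_zero (X : GroupLieAlgebra 𝓘(ℝ, E) G) : oneParam X 0 = 1 :=
  (exists_isMIntegralCurve_mulInvariant X).choose_spec.1

lemma isMIntegralCurve_oneParam (X : GroupLieAlgebra 𝓘(ℝ, E) G) :
    IsMIntegralCurve (I := 𝓘(ℝ, E)) (oneParam X) (mulInvariantVectorField X) :=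
  (exists_isMIntegralCurve_mulInvariant X).choose_spec.2

lemma eq_mul_oneParam_of_isMIntegralCurveOn {X : GroupLieAlgebra 𝓘(ℝ, E) G} {γ : ℝ → G}
    (hγ : IsMIntegralCurveOn (I := 𝓘(ℝ, E)) γ (mulInvariantVectorField X) (Ioo (-2) 2)) :
    γ 1 = γ 0 * oneParam X 1 :=
  isMIntegralCurveOn_Ioo_eqOn_of_contMDiff_boundaryless (t₀ := 0) (by norm_num)
    (contMDiff_mulInvariantVectorField_one X) hγ
    (((isMIntegralCurve_oneParam X).isMIntegralCurveOn _).mul_left_invariant (γ 0))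
    (by rw [oneParam_zero, mul_one]) (by norm_num)

lemma lieExp_eq_oneParam (X : GroupLieAlgebra 𝓘(ℝ, E) G) : lieExp X = oneParam X 1 := by
  rw [lieExp, dif_pos (exists_isMIntegralCurve_mulInvariant X)]
  rfl

lemma eq_mul_lieExp_of_isMIntegralCurveOn {X : GroupLieAlgebra 𝓘(ℝ, E) G} {γ : ℝ → G}
    (hγ : IsMIntegralCurveOn (I := 𝓘(ℝ, E)) γ (mulInvariantVectorField X) (Ioo (-2) 2)) :
    γ 1 = γ 0 * lieExp X := by
  rw [lieExp_eq_oneParam, eq_mul_oneParam_of_isMIntegralCurveOn hγ]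

lemma lieExp_zero : lieExp (0 : GroupLieAlgebra 𝓘(ℝ, E) G) = 1 := by
  have h : IsMIntegralCurveOn (I := 𝓘(ℝ, E)) (fun _ : ℝ => (1 : G))
      (mulInvariantVectorField (0 : GroupLieAlgebra 𝓘(ℝ, E) G)) (Ioo (-2) 2) :=
    (isMIntegralCurve_const (by rw [mulInvariantVectorField_one_eq])).isMIntegralCurveOn _
  have := eq_mul_lieExp_of_isMIntegralCurveOn h
  rwa [one_mul, eq_comm] at this

/-- The reversed curve t ↦ γ(1 - t), with γ the one-parameter subgroup of `X`, is an integral curve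
for `-X` leading from exp X to 1. -/
lemma lieExp_neg (X : GroupLieAlgebra 𝓘(ℝ, E) G) : lieExp (-X) = (lieExp X)⁻¹ := by
  have h1 := (isMIntegralCurve_oneParam X).comp_add 1
  have h2 := h1.comp_mul (-1)
  have h3 : (-1 : ℝ) • (mulInvariantVectorField X : ∀ g : G, TangentSpace 𝓘(ℝ, E) g) =
      mulInvariantVectorField (-X) := by
    rw [← mulInvariantVectorField_smul, neg_one_smul]
  rw [h3] at h2
  have h4 := eq_mul_lieExp_of_isMIntegralCurveOn (h2.isMIntegralCurveOn _)
  simp only [Function.comp_apply] at h4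
  norm_num [oneParam_zero, ← lieExp_eq_oneParam] at h4
  exact eq_inv_of_mul_eq_one_right h4.symm

/-- The exponential map in the chart at the identity, and its derivative. -/
theorem exists_lieExp_chart : ∃ ε : E → E, ContDiffAt ℝ 1 ε 0 ∧
    ε 0 = extChartAt 𝓘(ℝ, E) (1 : G) 1 ∧
    ∀ᶠ x in 𝓝 0, ε x ∈ (extChartAt 𝓘(ℝ, E) (1 : G)).target ∧
      lieExp (algebraEquiv E G x) = (extChartAt 𝓘(ℝ, E) (1 : G)).symm (ε x) ∧
      HasFDerivAt ε (leftFrame E G (ε x) ∘L lieKernel (groupBracket E G x)) x := by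
  obtain ⟨e, he, he0, h⟩ := exists_local_exp (isOpen_extChartAt_target (I := 𝓘(ℝ, E)) (1 : G))
    contDiffOn_leftFrame (fun p hp => leftFrame_maurerCartan hp) (mem_extChartAt_target (1 : G))
  refine ⟨fun x => e x 1, he, he0 1, ?_⟩
  filter_upwards [h] with x hx
  refine ⟨(hx.2.1 1 (by norm_num)).1, ?_, hx.2.2⟩
  have := eq_mul_lieExp_of_isMIntegralCurveOn (isMIntegralCurveOn_chart_symm hx.2.1)
  rw [this, hx.1, extChartAt_to_inv, one_mul]

/-- In a Lie group, `exp (z 1) = exp (z 0) exp y` along the small solutions of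
`lieKernel (ad z) z' = y`. -/
theorem exists_lieExp_logCurve : ∃ r > 0, ∀ (y : E) (z : ℝ → E),
    (∀ t ∈ Ioo (-2 : ℝ) 2, ‖z t‖ < r) → IsLogCurve (groupBracket E G) y z →
    lieExp (algebraEquiv E G (z 1)) =
      lieExp (algebraEquiv E G (z 0)) * lieExp (algebraEquiv E G y) := by
  obtain ⟨ε, -, -, hε⟩ := exists_lieExp_chart (E := E) (G := G)
  obtain ⟨r, hr, h⟩ := Metric.eventually_nhds_iff_ball.1 hε
  refine ⟨r, hr, fun y z hz hzy => ?_⟩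
  have hm : ∀ t ∈ Ioo (-2 : ℝ) 2, z t ∈ Metric.ball 0 r := fun t ht => by simpa using hz t ht
  -- By the formula for the derivative of `ε`, the velocity of ε(z(t)) is the frame applied to
  -- `lieKernel (ad z) z'`, that is, to the constant `y`: exp(z(t)) is an integral curve of the
  -- left-invariant field of `y`.
  have h1 : ∀ t ∈ Ioo (-2 : ℝ) 2, ε (z t) ∈ (extChartAt 𝓘(ℝ, E) (1 : G)).target ∧
      HasDerivAt (fun t => ε (z t)) (leftFrame E G (ε (z t)) y) t := by
    intro t ht
    refine ⟨(h _ (hm t ht)).1, ?_⟩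
    obtain ⟨z', hz, hz'⟩ := hzy t ht
    refine ((h _ (hm t ht)).2.2.comp_hasDerivAt t hz).congr_deriv ?_
    rw [← hz']; rfl
  have h2 := eq_mul_lieExp_of_isMIntegralCurveOn (isMIntegralCurveOn_chart_symm h1)
  rwa [(h _ (hm 1 (by norm_num))).2.1, (h _ (hm 0 (by norm_num))).2.1]

/-- The exponential map of a Lie group is a local homeomorphism at `0`. -/
theorem exists_openPartialHomeomorph_lieExp :
    ∃ φ : OpenPartialHomeomorph (GroupLieAlgebra 𝓘(ℝ, E) G) G,
      0 ∈ φ.source ∧ EqOn φ lieExp φ.source := by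
  obtain ⟨ε, hεc, hε0, hε⟩ := exists_lieExp_chart (E := E) (G := G)
  obtain ⟨A, hA⟩ := exists_equiv_leftFrame_one (E := E) (G := G)
  -- At 0 the kernel is the identity, so the derivative is the invertible frame at 1 and the inverse
  -- function theorem applies.
  have hd : HasFDerivAt ε (A : E →L[ℝ] E) 0 := by
    refine hε.self_of_nhds.2.2.congr_fderiv ?_
    rw [map_zero, lieKernel_zero, hε0, hA]
    rfl
  set φ₁ := hεc.toOpenPartialHomeomorph ε hd one_ne_zero
  set φ₂ := (algebraEquiv E G).symm.toHomeomorph.toOpenPartialHomeomorph.trans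
    (φ₁.trans (chartAt E (1 : G)).symm)
  obtain ⟨V, hV, hVo, h0V⟩ := eventually_nhds_iff.1 hε
  have hφ : ∀ x, φ₂ x = (extChartAt 𝓘(ℝ, E) (1 : G)).symm (ε ((algebraEquiv E G).symm x)) := by
    intro x
    simp [φ₂, φ₁]
  set W : Set (GroupLieAlgebra 𝓘(ℝ, E) G) := (algebraEquiv E G).symm ⁻¹' V
  have hWo : IsOpen W := hVo.preimage (algebraEquiv E G).symm.continuous
  refine ⟨φ₂.restrOpen W hWo, ?_, fun x hx => ?_⟩
  · rw [OpenPartialHomeomorph.restrOpen_source]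
    refine ⟨?_, by simpa [W] using h0V⟩
    have h1 : (0 : E) ∈ φ₁.source := hεc.mem_toOpenPartialHomeomorph_source hd one_ne_zero
    have h2 : φ₁ 0 ∈ (chartAt E (1 : G)).target := by
      change ε 0 ∈ _
      rw [hε0]
      simp
    simp only [φ₂, OpenPartialHomeomorph.trans_source]
    refine ⟨mem_univ _, ?_, ?_⟩
    · simpa using h1
    · simpa using h2
  · rw [OpenPartialHomeomorph.restrOpen_source] at hx
    change φ₂ x = _
    rw [hφ]
    exact (hV _ hx.2).2.1.symm

end Exp

/-! ## Adapted bases, dilatations and the contraction of the bracket -/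

section AdaptedBasisExists

variable {L : Type*} [LieRing L] [LieAlgebra ℝ L] (D : Submodule ℝ L)

/-- A basis compatible with the flag is built upwards: the independent set found for `m` is enlarged
inside the next stage, and the spanning property of the lower stages survives enlargement. -/
lemma exists_linearIndepOn_span_inter_filtration (m : ℕ) :
    ∃ s : Set L, LinearIndepOn ℝ id s ∧ s ⊆ filtration D m ∧
      ∀ k ≤ m, filtration D k ≤ Submodule.span ℝ (s ∩ filtration D k) := by
  induction m with
  | zero =>
    refine ⟨∅, linearIndepOn_empty ℝ id, empty_subset _, fun k hk => ?_⟩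
    obtain rfl : k = 0 := by omega
    exact bot_le
  | succ m ih =>
    obtain ⟨s, hs, hsm, hsk⟩ := ih
    obtain ⟨b, hbt, hsb, htb, hb⟩ := exists_linearIndepOn_id_extension hs
      (hsm.trans (filtration_succ D m) : s ⊆ (filtration D (m + 1) : Set L))
    refine ⟨b, hb, hbt, fun k hk => ?_⟩
    rcases Nat.le_succ_iff.1 hk with h | rfl
    · exact (hsk k h).trans (Submodule.span_mono (inter_subset_inter_left _ hsb))
    · rw [inter_eq_left.2 hbt]
      exact htb

lemma exists_adaptedBasis [FiniteDimensional ℝ L] (hD : IsBracketGenerating D) :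
    Nonempty (AdaptedBasis D) := by
  classical
  obtain ⟨m, hm⟩ := hD
  obtain ⟨s, hs, -, hsk⟩ := exists_linearIndepOn_span_inter_filtration D m
  have hspan : ⊤ ≤ Submodule.span ℝ (range fun x : s => (x : L)) := by
    rw [Subtype.range_coe, ← hm]
    exact (hsk m le_rfl).trans (Submodule.span_mono inter_subset_left)
  let b₀ : Module.Basis s ℝ L := Module.Basis.mk (v := fun x : s => (x : L)) hs hspan
  have : Fintype s := FiniteDimensional.fintypeBasisIndex b₀
  let e : s ≃ Fin (Module.finrank ℝ L) :=
    Fintype.equivFinOfCardEq (Module.finrank_eq_card_basis b₀).symm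
  let b := b₀.reindex e
  have hb : ∀ j, b j = (e.symm j : L) := fun j => by
    rw [Module.Basis.reindex_apply]
    exact Module.Basis.mk_apply hs hspan _
  have hex : ∀ x : L, ∃ i, x ∈ filtration D i := fun x => ⟨m, by rw [hm]; trivial⟩
  -- The weight of a basis vector is the first stage that contains it.
  have hle : ∀ (x : L) (i : ℕ), Nat.find (hex x) ≤ i ↔ x ∈ filtration D i := fun x i =>
    ⟨fun h => filtration_mono D h (Nat.find_spec (hex x)), fun h => Nat.find_le h⟩
  refine ⟨⟨b, fun j => Nat.find (hex (b j)), fun i => ?_⟩⟩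
  have himg : b '' {j | Nat.find (hex (b j)) ≤ i} = s ∩ filtration D i := by
    ext x
    simp only [hle, mem_image, mem_ofPred_eq]
    constructor
    · rintro ⟨j, hj, rfl⟩
      exact ⟨by rw [hb]; exact (e.symm j).2, hj⟩
    · rintro ⟨hxs, hx⟩
      refine ⟨e ⟨x, hxs⟩, ?_, ?_⟩ <;> simp [hb]
      exact hx
  rw [himg]
  refine le_antisymm ?_ (Submodule.span_le.2 inter_subset_right)
  rcases le_total i m with h | h
  · exact hsk i h
  · have hi : filtration D i = ⊤ := top_le_iff.1 (hm ▸ filtration_mono D h)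
    rw [hi, Submodule.top_coe, inter_univ]
    simpa using hspan

end AdaptedBasisExists

/-! ### Dilatations and rescaled brackets in an adapted basis -/

namespace AdaptedBasis

variable {L : Type*} [LieRing L] [LieAlgebra ℝ L] {D : Submodule ℝ L} (B : AdaptedBasis D)

/-- Stage 0 is zero and contains no basis vector. Positive weights are what makes δ_0 = 0, hence the
dilatations contracting. -/
lemma weight_pos (j : Fin (Module.finrank ℝ L)) : B.weight j ≠ 0 := by
  intro h
  have := B.mem_filtration j
  rw [h] at this
  exact B.basis.ne_zero j (by simpa [filtration] using this)

lemma dil_basis (ε : ℝ) (j : Fin (Module.finrank ℝ L)) :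
    B.dil ε (B.basis j) = ε ^ B.weight j • B.basis j := B.basis.constr_basis ℝ _ j

lemma dil_one (x : L) : B.dil 1 x = x := by
  have : B.dil 1 = LinearMap.id := B.basis.ext fun j => by simp [dil_basis]
  rw [this]; rfl

lemma dil_zero (x : L) : B.dil 0 x = 0 := by
  have : B.dil 0 = 0 := B.basis.ext fun j => by simp [dil_basis, B.weight_pos j]
  rw [this]; rfl

lemma dil_mul (ε μ : ℝ) (x : L) : B.dil (ε * μ) x = B.dil ε (B.dil μ x) := by
  have : B.dil (ε * μ) = B.dil ε ∘ₗ B.dil μ := B.basis.ext fun j => by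
    simp [dil_basis, mul_pow, smul_smul, mul_comm]
  rw [this]; rfl

lemma dil_apply (ε : ℝ) (x : L) :
    B.dil ε x = ∑ j, B.basis.repr x j • ε ^ B.weight j • B.basis j := by
  rw [dil, B.basis.constr_apply_fintype ℝ]
  rfl

lemma repr_eq_zero {n : ℕ} {x : L} (hx : x ∈ filtration D n) {k : Fin (Module.finrank ℝ L)}
    (hk : n < B.weight k) : B.basis.repr x k = 0 := by
  rw [B.span_eq] at hx
  have := B.basis.mem_span_image.1 hx
  by_contra h
  have h2 := this (Finsupp.mem_support_iff.2 h)
  have h3 : B.weight k ≤ n := h2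
  omega

/-- The bracket `δ_ε⁻¹ [δ_ε x, δ_ε y]`, which is polynomial in `ε`. -/
def scaledBracket (ε : ℝ) : L →ₗ[ℝ] L →ₗ[ℝ] L :=
  B.basis.constr ℝ fun i => B.basis.constr ℝ fun j =>
    ∑ k, (ε ^ (B.weight i + B.weight j - B.weight k) *
      B.basis.repr ⁅B.basis i, B.basis j⁆ k) • B.basis k

lemma scaledBracket_basis (ε : ℝ) (i j : Fin (Module.finrank ℝ L)) :
    B.scaledBracket ε (B.basis i) (B.basis j) =
      ∑ k, (ε ^ (B.weight i + B.weight j - B.weight k) *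
        B.basis.repr ⁅B.basis i, B.basis j⁆ k) • B.basis k := by
  rw [scaledBracket, B.basis.constr_basis, B.basis.constr_basis]

lemma scaledBracket_one (x y : L) : B.scaledBracket 1 x y = ⁅x, y⁆ := by
  have : B.scaledBracket 1 = (LieModule.toEnd ℝ L L : L →ₗ[ℝ] Module.End ℝ L) :=
    B.basis.ext fun i => B.basis.ext fun j => by
      rw [scaledBracket_basis]
      simp only [one_pow, one_mul]
      exact B.basis.sum_repr _
  rw [this]; rfl

/-- Compare powers of `s` term by term. The truncated subtraction in the exponent is harmless: where
it truncates, the structure constant vanishes. For ε = 1 this relates c_s to the original bracket;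
for ε = 0 it says that δ_s preserves c_0. -/
lemma dil_scaledBracket (ε s : ℝ) (x y : L) :
    B.dil s (B.scaledBracket (ε * s) x y) = B.scaledBracket ε (B.dil s x) (B.dil s y) := by
  have : (B.scaledBracket (ε * s)).compr₂ (B.dil s) =
      (B.scaledBracket ε).compl₁₂ (B.dil s) (B.dil s) :=
    B.basis.ext fun i => B.basis.ext fun j => by
      simp only [LinearMap.compr₂_apply, LinearMap.compl₁₂_apply, dil_basis, map_smul,
        LinearMap.smul_apply, scaledBracket_basis, map_sum, Finset.smul_sum]
      refine Finset.sum_congr rfl fun k _ => ?_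
      rcases lt_or_ge (B.weight i + B.weight j) (B.weight k) with h | h
      · simp [B.repr_eq_zero (lie_mem_filtration D _ _ (B.mem_filtration i) (B.mem_filtration j)) h]
      · obtain ⟨n, hn⟩ := Nat.exists_eq_add_of_le h
        have hn' : B.weight i + B.weight j - B.weight k = n := by omega
        rw [hn', smul_smul, smul_smul, smul_smul]
        congr 1
        have : s ^ B.weight i * s ^ B.weight j = s ^ B.weight k * s ^ n := by
          rw [← pow_add, hn, pow_add]
        rw [mul_pow]
        linear_combination (-ε ^ n * B.basis.repr ⁅B.basis i, B.basis j⁆ k) * this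
  exact LinearMap.congr_fun₂ this x y

/-- Basis vectors of weight below `n` lie in the previous stage and die in the quotient, so only the
weight-`n` components are seen by the class. -/
lemma cls_eq_toNil_proj (n : ℕ) (x : filtration D n) :
    Nilpotentisation.cls D n x = B.toNil (B.proj n x) := by
  have key : ∀ z (hz : z ∈ Submodule.span ℝ (B.basis '' {j | B.weight j ≤ n}))
      (hz' : z ∈ filtration D n), Nilpotentisation.cls D n ⟨z, hz'⟩ = B.toNil (B.proj n z) := by
    intro z hz
    induction hz using Submodule.span_induction with
    | mem z hz =>
      obtain ⟨j, hj, rfl⟩ := hz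
      intro hz'
      have hj' : B.weight j ≤ n := hj
      rcases hj'.eq_or_lt with h | h
      · have h1 : B.proj n (B.basis j) = B.basis j := by
          rw [proj, B.basis.constr_basis, if_pos h]
        rw [h1]
        exact ((B.toNilₗ_basis j).trans (Nilpotentisation.cls_congr h rfl)).symm
      · have h1 : B.proj n (B.basis j) = 0 := by
          rw [proj, B.basis.constr_basis, if_neg h.ne]
        rw [h1, map_zero]
        unfold Nilpotentisation.cls
        rw [(Submodule.Quotient.mk_eq_zero _).2, map_zero]
        exact filtration_mono D (by omega : B.weight j ≤ n - 1) (B.mem_filtration j)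
    | zero =>
      intro _
      rw [map_zero, map_zero]
      exact map_zero (Nilpotentisation.incl D n ∘ₗ Submodule.mkQ _)
    | add a b ha hb iha ihb =>
      rw [← B.span_eq] at ha hb
      intro _
      rw [map_add, map_add, ← iha ha, ← ihb hb, ← Nilpotentisation.cls_add]
      rfl
    | smul r a ha iha =>
      rw [← B.span_eq] at ha
      intro _
      rw [map_smul, map_smul, ← iha ha]
      exact map_smul (Nilpotentisation.incl D n ∘ₗ Submodule.mkQ _) r (⟨a, ha⟩ : filtration D n)
  exact key x (by rw [← B.span_eq]; exact x.2) x.2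

/-- At ε = 0 the factor 0^(l_i + l_j - l_k) kills the components of weight below l_i + l_j and
equals 1 at weight l_i + l_j; components of higher weight have zero coefficient. What remains is the
weight projection that computes the class of the bracket. -/
lemma toNil_scaledBracket_zero (x y : L) :
    B.toNil (B.scaledBracket 0 x y) = ⁅B.toNil x, B.toNil y⁆ := by
  have : (B.scaledBracket 0).compr₂ B.toNil.toLinearMap =
      (Nilpotentisation.bracketₗ D).compl₁₂ B.toNil.toLinearMap B.toNil.toLinearMap :=
    B.basis.ext fun i => B.basis.ext fun j => by
      have hb : ∀ i, B.toNil (B.basis i) = Nilpotentisation.cls D (B.weight i)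
          ⟨B.basis i, B.mem_filtration i⟩ := B.toNilₗ_basis
      rw [LinearMap.compr₂_apply, LinearMap.compl₁₂_apply]
      simp only [LinearEquiv.coe_coe]
      rw [hb, hb, Nilpotentisation.bracketₗ_cls, cls_eq_toNil_proj]
      congr 1
      rw [scaledBracket_basis, proj, B.basis.constr_apply_fintype ℝ]
      refine Finset.sum_congr rfl fun k _ => ?_
      rw [B.basis.equivFun_apply]
      rcases lt_trichotomy (B.weight i + B.weight j) (B.weight k) with h | h | h
      · simp [B.repr_eq_zero (lie_mem_filtration D _ _ (B.mem_filtration i) (B.mem_filtration j)) h]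
      · simp [h]
      · have : B.weight i + B.weight j - B.weight k ≠ 0 := by omega
        simp [this, h.ne]
  exact LinearMap.congr_fun₂ this x y

lemma scaledBracket_zero_skew (x y : L) : B.scaledBracket 0 y x = -B.scaledBracket 0 x y :=
  B.toNil.injective (by
    rw [map_neg, toNil_scaledBracket_zero, toNil_scaledBracket_zero, lie_skew])

end AdaptedBasis

/-! ## Contractions of a Lie bracket by dilatations -/

/-- A one-parameter family of linear dilatations, with the rescaled brackets
`δ_ε⁻¹ [δ_ε x, δ_ε y]` extended continuously to `ε = 0`. -/
structure BracketContraction (E : Type u) [NormedAddCommGroup E] [NormedSpace ℝ E] where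
  dil : ℝ → E →L[ℝ] E
  bracket : ℝ → E →L[ℝ] E →L[ℝ] E
  continuous_dil : Continuous dil
  continuous_bracket : Continuous bracket
  dil_zero : dil 0 = 0
  dil_one : dil 1 = .id ℝ E
  dil_mul : ∀ ε μ x, dil (ε * μ) x = dil ε (dil μ x)
  dil_bracket : ∀ ε s x y, dil s (bracket (ε * s) x y) = bracket ε (dil s x) (dil s y)
  bracket_zero_skew : ∀ x y, bracket 0 y x = -bracket 0 x y

/-! ### The limit operation of a contraction -/

namespace BracketContraction

variable {E : Type u} [NormedAddCommGroup E] [NormedSpace ℝ E] (K : BracketContraction E)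

lemma continuous_dil_apply : Continuous fun p : ℝ × E => K.dil p.1 p.2 :=
  (K.continuous_dil.comp continuous_fst).clm_apply continuous_snd

lemma dil_inv_dil {ε : ℝ} (h : ε ≠ 0) (x : E) : K.dil ε⁻¹ (K.dil ε x) = x := by
  rw [← K.dil_mul, inv_mul_cancel₀ h, K.dil_one]; rfl

lemma exists_norm_dil_le : ∃ M > 0, ∀ s ∈ Icc (0 : ℝ) 1, ∀ x, ‖K.dil s x‖ ≤ M * ‖x‖ := by
  obtain ⟨M, hM⟩ := isCompact_Icc.exists_bound_of_continuousOn (E := E →L[ℝ] E)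
    (f := K.dil) (s := Icc (0 : ℝ) 1) K.continuous_dil.continuousOn
  refine ⟨max M 1, by positivity, fun s hs x => ((K.dil s).le_opNorm x).trans ?_⟩
  gcongr
  exact (hM s hs).trans (le_max_left _ _)

/-- If a property holds near `0`, then it holds near `0` uniformly along the dilatations
`δ_s`, `s ∈ [0, 1]`. -/
lemma eventually_dil {p : E → Prop} (h : ∀ᶠ x in 𝓝 0, p x) :
    ∀ᶠ x in 𝓝 0, ∀ s ∈ Icc (0 : ℝ) 1, p (K.dil s x) := by
  obtain ⟨M, hM, hle⟩ := K.exists_norm_dil_le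
  obtain ⟨r, hr, h⟩ := Metric.eventually_nhds_iff_ball.1 h
  filter_upwards [Metric.ball_mem_nhds (0 : E) (div_pos hr hM)] with x hx s hs
  refine h _ ?_
  rw [mem_ball_zero_iff] at hx ⊢
  calc _ ≤ M * ‖x‖ := hle s hs x
    _ < M * (r / M) := by gcongr
    _ = r := by field_simp

lemma tendsto_dil_zero (x : E) : Tendsto (fun s : ℝ => K.dil s x) (𝓝 0) (𝓝 0) := by
  have := (K.continuous_dil_apply.comp (Continuous.prodMk_left x)).tendsto (0 : ℝ)
  simpa [Function.comp_def, K.dil_zero] using this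

variable [CompleteSpace E]

/-- The curve `t ↦ log (exp x exp (t y))` for the bracket `c`, near `c = K.bracket 0`. -/
def logCurve : (E →L[ℝ] E →L[ℝ] E) × E × E → ℝ → E := (exists_logCurve (K.bracket 0)).choose

/-- The rescaled local group operation `δ_ε⁻¹ ((δ_ε x) (δ_ε y))`, extended to `ε = 0`. -/
def mul (q : ℝ × E × E) : E := K.logCurve (K.bracket q.1, q.2) 1

/-- The limit `β` of the rescaled operations. -/
def limitMul (p : E × E) : E := K.mul (0, p)

lemma tendsto_bracket : Tendsto (fun q : ℝ × E × E => (K.bracket q.1, q.2)) (𝓝 (0, 0, 0))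
    (𝓝 (K.bracket 0, 0, 0)) :=
  ((K.continuous_bracket.comp continuous_fst).prodMk continuous_snd).tendsto _

lemma eventually_norm_logCurve_lt {r : ℝ} (hr : 0 < r) :
    ∀ᶠ q : ℝ × E × E in 𝓝 (0, 0, 0), ∀ t, ‖K.logCurve (K.bracket q.1, q.2) t‖ < r :=
  K.tendsto_bracket.eventually ((exists_logCurve (K.bracket 0)).choose_spec.2.1 r hr)

lemma eventually_isLogCurve : ∀ᶠ q : ℝ × E × E in 𝓝 (0, 0, 0),
    K.logCurve (K.bracket q.1, q.2) 0 = q.2.1 ∧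
      IsLogCurve (K.bracket q.1) q.2.2 (K.logCurve (K.bracket q.1, q.2)) :=
  K.tendsto_bracket.eventually (exists_logCurve (K.bracket 0)).choose_spec.2.2

lemma contDiffAt_logCurve :
    ContDiffAt ℝ ∞ (fun q => K.logCurve q 1) (K.bracket 0, (0 : E), (0 : E)) :=
  (exists_logCurve (K.bracket 0)).choose_spec.1

/-- The bracket c_ε is continuous in ε, and the flow in (c, x, y). Joint continuity across ε = 0 is
the source of the uniform convergence in H1. -/
lemma eventually_continuousAt_mul : ∀ᶠ q in 𝓝 ((0 : ℝ), (0 : E), (0 : E)),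
    ContinuousAt K.mul q := by
  have h := (K.contDiffAt_logCurve.of_le (m := 1) ENat.LEInfty.out).eventually (by simp)
  filter_upwards [K.tendsto_bracket.eventually h] with q hq
  exact hq.continuousAt.comp (f := fun q : ℝ × E × E => (K.bracket q.1, q.2))
    ((K.continuous_bracket.comp continuous_fst).prodMk continuous_snd).continuousAt

lemma contDiffAt_limitMul : ContDiffAt ℝ ∞ K.limitMul ((0 : E), (0 : E)) := by
  refine K.contDiffAt_logCurve.comp (f := fun p : E × E => (K.bracket 0, p)) ((0 : E), (0 : E)) ?_
  exact (contDiff_prodMk_right (K.bracket 0)).contDiffAt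

lemma mul_zero_zero : K.mul (0, 0, 0) = 0 := by
  by_contra h
  have h1 := (K.eventually_norm_logCurve_lt (norm_pos_iff.2 h)).self_of_nhds 1
  exact lt_irrefl _ h1

lemma tendsto_mul : Tendsto K.mul (𝓝 (0, 0, 0)) (𝓝 0) := by
  have := K.eventually_continuousAt_mul.self_of_nhds
  rwa [ContinuousAt, mul_zero_zero] at this

lemma tendsto_limitMul : Tendsto K.limitMul (𝓝 (0, 0)) (𝓝 0) :=
  K.tendsto_mul.comp ((Continuous.prodMk_right (0 : ℝ)).tendsto ((0 : E), (0 : E)))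

lemma eventually_nhds_zero_prodMk {P : ℝ × E × E → Prop} (h : ∀ᶠ q in 𝓝 (0, 0, 0), P q) :
    ∀ᶠ p : E × E in 𝓝 (0, 0), P (0, p) :=
  ((Continuous.prodMk_right (0 : ℝ)).tendsto ((0 : E), (0 : E))).eventually h

/-- The limit operation is homogeneous. -/
lemma limitMul_dil : ∀ᶠ p : E × E in 𝓝 (0, 0), ∀ s ∈ Icc (0 : ℝ) 1,
    K.limitMul (K.dil s p.1, K.dil s p.2) = K.dil s (K.limitMul p) := by
  obtain ⟨M, hM, hle⟩ := K.exists_norm_dil_le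
  obtain ⟨r, hr, huniq⟩ := exists_logCurve_unique (K.bracket 0)
  have h1 := eventually_nhds_zero_prodMk (K.eventually_norm_logCurve_lt (div_pos hr hM))
  have h2 := eventually_nhds_zero_prodMk ((K.eventually_norm_logCurve_lt hr).and
    K.eventually_isLogCurve)
  have h2' : ∀ᶠ p : E × E in 𝓝 (0, 0), ∀ s ∈ Icc (0 : ℝ) 1,
      (∀ t, ‖K.logCurve (K.bracket 0, K.dil s p.1, K.dil s p.2) t‖ < r) ∧
      K.logCurve (K.bracket 0, K.dil s p.1, K.dil s p.2) 0 = K.dil s p.1 ∧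
      IsLogCurve (K.bracket 0) (K.dil s p.2)
        (K.logCurve (K.bracket 0, K.dil s p.1, K.dil s p.2)) := by
    obtain ⟨pa, ha, pb, hb, h⟩ := eventually_prod_iff.1 (nhds_prod_eq (x := (0 : E)) (y := (0 : E)) ▸ h2)
    rw [nhds_prod_eq]
    filter_upwards [(K.eventually_dil ha).prod_mk (K.eventually_dil hb)] with p hp s hs
    exact h (hp.1 s hs) (hp.2 s hs)
  filter_upwards [h1, h2, h2'] with p hp1 hp2 hp3 s hs
  -- The dilated curve and the curve with dilated data are small log curves for the same bracket
  -- with the same initial value, hence agree at time 1.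
  refine huniq (K.dil s p.2) _ (K.dil s ∘ K.logCurve (K.bracket 0, p)) (fun t _ => (hp3 s hs).1 t)
    (fun t _ => ?_) (hp3 s hs).2.2 ?_ ?_ (by norm_num : (1 : ℝ) ∈ Ioo (-2 : ℝ) 2)
  · calc _ ≤ M * ‖K.logCurve (K.bracket 0, p) t‖ := hle s hs _
      _ < M * (r / M) := by gcongr; exact hp1 t
      _ = r := by field_simp
  · refine hp2.2.2.map fun x y => ?_
    have := K.dil_bracket 0 s x y
    rw [zero_mul] at this
    exact this.symm
  · rw [(hp3 s hs).2.1]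
    exact congrArg (K.dil s) hp2.2.1.symm

/-- The derivative at `0` of the left translations of the limit operation. -/
lemma lieKernel_fderiv_limitMul : ∀ᶠ x in 𝓝 (0 : E),
    lieKernel (K.bracket 0 x) ∘L fderiv ℝ (fun y => K.limitMul (x, y)) 0 = .id ℝ E := by
  obtain ⟨r, hr, huniq⟩ := exists_logCurve_unique (K.bracket 0)
  have h := eventually_nhds_zero_prodMk ((K.eventually_norm_logCurve_lt hr).and
    K.eventually_isLogCurve)
  have hd := (K.contDiffAt_limitMul.of_le (m := 1) ENat.LEInfty.out).eventually (by simp)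
  obtain ⟨pa, ha, pb, hb, h⟩ := eventually_prod_iff.1
    (nhds_prod_eq (x := (0 : E)) (y := (0 : E)) ▸ h.and hd)
  obtain ⟨ρ, hρ, hb⟩ := Metric.eventually_nhds_iff_ball.1 hb
  filter_upwards [ha] with x hx
  have hdx : DifferentiableAt ℝ (fun y => K.limitMul (x, y)) 0 :=
    ((h hx (hb 0 (Metric.mem_ball_self hρ))).2.differentiableAt one_ne_zero).comp (f := fun y => (x, y)) 0
      (by fun_prop)
  have hsmall : ∀ y ∈ Metric.ball (0 : E) ρ,
      lieKernel (K.bracket 0 x) (fderiv ℝ (fun y => K.limitMul (x, y)) 0 y) = y := by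
    intro y hy
    obtain ⟨⟨hn, h0, hc⟩, -⟩ := h hx (hb y hy)
    -- By uniqueness, scaling y by s amounts to scaling time by s; |s| < 1 keeps st in (-2, 2). Thus
    -- the derivative of β(x, ·) at 0 towards y is the initial velocity of the log curve.
    have hcurve : ∀ s ∈ Ioo (-1 : ℝ) 1,
        K.limitMul (x, s • y) = K.logCurve (K.bracket 0, x, y) s := by
      intro s hs
      have hs' : |s| < 1 := abs_lt.2 hs
      have hsy : s • y ∈ Metric.ball (0 : E) ρ := by
        rw [mem_ball_zero_iff, norm_smul, Real.norm_eq_abs] at *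
        calc |s| * ‖y‖ ≤ 1 * ‖y‖ := by gcongr
          _ < ρ := by rwa [one_mul]
      obtain ⟨⟨hn', h0', hc'⟩, -⟩ := h hx (hb _ hsy)
      have := huniq (s • y) _ (fun t => K.logCurve (K.bracket 0, x, y) (s * t))
        (fun t _ => hn' t) (fun t _ => hn (s * t)) hc' (fun t ht => ?_)
        (by rw [mul_zero]; exact h0'.trans h0.symm) (by norm_num : (1 : ℝ) ∈ Ioo (-2 : ℝ) 2)
      · simp only [mul_one] at this
        exact this
      · have hst : s * t ∈ Ioo (-2 : ℝ) 2 := by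
          have ht' : |t| < 2 := abs_lt.2 ht
          rw [mem_Ioo, ← abs_lt, abs_mul]
          nlinarith [abs_nonneg s, abs_nonneg t]
        obtain ⟨z', hz, hz'⟩ := hc (s * t) hst
        refine ⟨s • z', ?_, by rw [map_smul, hz']⟩
        have hlin : HasDerivAt (fun t : ℝ => s * t) s t := by
          simpa using (hasDerivAt_id t).const_mul s
        exact hz.scomp t hlin
    obtain ⟨z', hz, hz'⟩ := hc 0 (by norm_num)
    have h1 : HasDerivAt (fun s : ℝ => K.limitMul (x, s • y)) z' 0 := by
      refine hz.congr_of_eventuallyEq ?_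
      filter_upwards [Ioo_mem_nhds (by norm_num : (-1 : ℝ) < 0) one_pos] with s hs
      exact hcurve s hs
    have h2 : HasDerivAt (fun s : ℝ => K.limitMul (x, s • y))
        (fderiv ℝ (fun y => K.limitMul (x, y)) 0 y) 0 := by
      have hlin : HasDerivAt (fun s : ℝ => s • y) y 0 := by
        simpa using (hasDerivAt_id (0 : ℝ)).smul_const y
      have hd0 : HasFDerivAt (fun y => K.limitMul (x, y))
          (fderiv ℝ (fun y => K.limitMul (x, y)) 0) ((0 : ℝ) • y) := by
        rw [zero_smul]; exact hdx.hasFDerivAt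
      exact hd0.comp_hasDerivAt (0 : ℝ) hlin
    rw [h2.unique h1]
    refine Eq.trans ?_ hz'
    exact congrArg (fun a => lieKernel (K.bracket 0 a) z') h0.symm
  ext v
  -- Both sides are linear, so small vectors suffice.
  have hv : ∃ t : ℝ, t ≠ 0 ∧ t • v ∈ Metric.ball (0 : E) ρ := by
    have : Tendsto (fun t : ℝ => t • v) (𝓝[≠] 0) (𝓝 0) := by
      have hc : Continuous fun t : ℝ => t • v := by fun_prop
      have := hc.tendsto 0
      rw [zero_smul] at this
      exact this.mono_left nhdsWithin_le_nhds
    obtain ⟨t, ht, ht'⟩ := ((this.eventually (Metric.ball_mem_nhds (0 : E) hρ)).and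
      self_mem_nhdsWithin).exists
    exact ⟨t, ht', ht⟩
  obtain ⟨t, ht, htv⟩ := hv
  have := hsmall _ htv
  rw [map_smul, map_smul] at this
  exact smul_right_injective E ht this

/-- `e` is the exponential map of a group `Γ`, read near `0`, with bracket `K.bracket 1`. -/
structure Integrates {Γ : Type*} [Group Γ] (e : E → Γ) : Prop where
  injOn : ∃ U ∈ 𝓝 (0 : E), InjOn e U
  map_zero : e 0 = 1
  map_neg : ∀ x, e (-x) = (e x)⁻¹
  map_mul : ∀ᶠ q : ℝ × E × E in 𝓝 (0, 0, 0),
    e (K.dil q.1 (K.mul q)) = e (K.dil q.1 q.2.1) * e (K.dil q.1 q.2.2)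

/-! ### Group laws of the limit operation -/

namespace Integrates

variable {K} {Γ : Type*} [Group Γ] {e : E → Γ} (he : K.Integrates e)

include he

/-- Since δ_0 = 0, both arguments of `e` lie in the domain of injectivity for small ε; then δ_ε is
cancelled, which needs ε ≠ 0. -/
lemma eventually_eq_of_dil {X : Type*} [TopologicalSpace X] {x₀ : X} {f g : ℝ × X → E}
    (hf : ContinuousAt f (0, x₀)) (hg : ContinuousAt g (0, x₀))
    (h : ∀ᶠ p in 𝓝 ((0 : ℝ), x₀), e (K.dil p.1 (f p)) = e (K.dil p.1 (g p))) :
    ∀ᶠ p in 𝓝 ((0 : ℝ), x₀), p.1 ≠ 0 → f p = g p := by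
  obtain ⟨U, hU, hinj⟩ := he.injOn
  have key : ∀ {f : ℝ × X → E}, ContinuousAt f (0, x₀) →
      ∀ᶠ p in 𝓝 ((0 : ℝ), x₀), K.dil p.1 (f p) ∈ U := by
    intro f hf
    have h1 : ContinuousAt (fun p : ℝ × X => K.dil p.1 (f p)) (0, x₀) :=
      K.continuous_dil_apply.continuousAt.comp (f := fun p : ℝ × X => (p.1, f p))
        (continuousAt_fst.prodMk hf)
    refine h1.eventually ?_
    simpa [K.dil_zero] using hU
  filter_upwards [key hf, key hg, h] with p h1 h2 h3 hp
  rw [← K.dil_inv_dil hp (f p), hinj h1 h2 h3, K.dil_inv_dil hp]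

/-- Identities for small ε ≠ 0 persist at ε = 0 by continuity. In this way β inherits associativity,
unit and inverse from `Γ`, with no use of the Jacobi identity of the limit bracket. -/
lemma eventually_eq_of_continuousAt {X : Type*} [TopologicalSpace X] {x₀ : X} {f g : ℝ × X → E}
    (hf : ∀ᶠ p in 𝓝 ((0 : ℝ), x₀), ContinuousAt f p)
    (hg : ∀ᶠ p in 𝓝 ((0 : ℝ), x₀), ContinuousAt g p)
    (h : ∀ᶠ p in 𝓝 ((0 : ℝ), x₀), e (K.dil p.1 (f p)) = e (K.dil p.1 (g p))) :
    ∀ᶠ x in 𝓝 x₀, f (0, x) = g (0, x) := by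
  have h1 := (he.eventually_eq_of_dil hf.self_of_nhds hg.self_of_nhds h).eventually_nhds
  have h2 := ((Continuous.prodMk_right (0 : ℝ)).tendsto x₀).eventually (h1.and (hf.and hg))
  filter_upwards [h2] with x hx
  have ht : Tendsto (fun ε : ℝ => (ε, x)) (𝓝[≠] 0) (𝓝 (0, x)) :=
    ((Continuous.prodMk_left x).tendsto (0 : ℝ)).mono_left nhdsWithin_le_nhds
  refine tendsto_nhds_unique_of_eventuallyEq (hx.2.1.tendsto.comp ht) (hx.2.2.tendsto.comp ht) ?_
  filter_upwards [ht.eventually hx.1, self_mem_nhdsWithin] with ε h1 h2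
  exact h1 h2

lemma limitMul_assoc : ∀ᶠ p : E × E × E in 𝓝 (0, 0, 0),
    K.limitMul (K.limitMul (p.1, p.2.1), p.2.2) = K.limitMul (p.1, K.limitMul (p.2.1, p.2.2)) := by
  have hl : ContinuousAt (fun p : ℝ × E × E × E => (p.1, p.2.1, p.2.2.1)) (0, 0, 0, 0) := by
    fun_prop
  have hr : ContinuousAt (fun p : ℝ × E × E × E => (p.1, p.2.2.1, p.2.2.2)) (0, 0, 0, 0) := by
    fun_prop
  have hl' := hl.eventually K.eventually_continuousAt_mul
  have hr' := hr.eventually K.eventually_continuousAt_mul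
  have hL : Tendsto (fun p : ℝ × E × E × E => (p.1, K.mul (p.1, p.2.1, p.2.2.1), p.2.2.2))
      (𝓝 (0, 0, 0, 0)) (𝓝 (0, 0, 0)) :=
    (continuous_fst.tendsto' _ _ rfl).prodMk_nhds ((K.tendsto_mul.comp hl).prodMk_nhds
      ((continuous_snd.comp (continuous_snd.comp continuous_snd)).tendsto' _ _ rfl))
  have hR : Tendsto (fun p : ℝ × E × E × E => (p.1, p.2.1, K.mul (p.1, p.2.2.1, p.2.2.2)))
      (𝓝 (0, 0, 0, 0)) (𝓝 (0, 0, 0)) :=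
    (continuous_fst.tendsto' _ _ rfl).prodMk_nhds (((continuous_fst.comp
      continuous_snd).tendsto' _ _ rfl).prodMk_nhds (K.tendsto_mul.comp hr))
  refine he.eventually_eq_of_continuousAt
    (f := fun p : ℝ × E × E × E => K.mul (p.1, K.mul (p.1, p.2.1, p.2.2.1), p.2.2.2))
    (g := fun p : ℝ × E × E × E => K.mul (p.1, p.2.1, K.mul (p.1, p.2.2.1, p.2.2.2))) ?_ ?_ ?_
  · filter_upwards [hl', hL.eventually K.eventually_continuousAt_mul] with p h1 h2
    refine h2.comp (f := fun p : ℝ × E × E × E =>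
      (p.1, K.mul (p.1, p.2.1, p.2.2.1), p.2.2.2)) (continuousAt_fst.prodMk
        (ContinuousAt.prodMk ?_ (by fun_prop)))
    exact h1.comp (f := fun p : ℝ × E × E × E => (p.1, p.2.1, p.2.2.1)) (by fun_prop)
  · filter_upwards [hr', hR.eventually K.eventually_continuousAt_mul] with p h1 h2
    refine h2.comp (f := fun p : ℝ × E × E × E =>
      (p.1, p.2.1, K.mul (p.1, p.2.2.1, p.2.2.2))) (continuousAt_fst.prodMk
        (ContinuousAt.prodMk (by fun_prop) ?_))
    exact h1.comp (f := fun p : ℝ × E × E × E => (p.1, p.2.2.1, p.2.2.2)) (by fun_prop)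
  · filter_upwards [hl.eventually he.map_mul, hr.eventually he.map_mul,
      hL.eventually he.map_mul, hR.eventually he.map_mul] with p h1 h2 h3 h4
    rw [h3, h4]
    rw [h1, h2, mul_assoc]

lemma limitMul_zero_right : ∀ᶠ x : E in 𝓝 0, K.limitMul (x, 0) = x := by
  have hl : ContinuousAt (fun p : ℝ × E => (p.1, p.2, (0 : E))) (0, 0) := by fun_prop
  refine he.eventually_eq_of_continuousAt (f := fun p : ℝ × E => K.mul (p.1, p.2, 0))
    (g := fun p => p.2) ?_ (.of_forall fun _ => continuousAt_snd) ?_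
  · filter_upwards [hl.eventually K.eventually_continuousAt_mul] with p h1
    exact h1.comp (f := fun p : ℝ × E => (p.1, p.2, (0 : E))) (by fun_prop)
  · filter_upwards [hl.eventually he.map_mul] with p h1
    rw [h1, _root_.map_zero, he.map_zero, mul_one]

lemma limitMul_zero_left : ∀ᶠ x : E in 𝓝 0, K.limitMul (0, x) = x := by
  have hl : ContinuousAt (fun p : ℝ × E => (p.1, (0 : E), p.2)) (0, 0) := by fun_prop
  refine he.eventually_eq_of_continuousAt (f := fun p : ℝ × E => K.mul (p.1, 0, p.2))
    (g := fun p => p.2) ?_ (.of_forall fun _ => continuousAt_snd) ?_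
  · filter_upwards [hl.eventually K.eventually_continuousAt_mul] with p h1
    exact h1.comp (f := fun p : ℝ × E => (p.1, (0 : E), p.2)) (by fun_prop)
  · filter_upwards [hl.eventually he.map_mul] with p h1
    rw [h1, _root_.map_zero, he.map_zero, one_mul]

lemma limitMul_neg_right : ∀ᶠ x : E in 𝓝 0, K.limitMul (x, -x) = 0 := by
  have hl : ContinuousAt (fun p : ℝ × E => (p.1, p.2, -p.2)) (0, 0) := by fun_prop
  rw [ContinuousAt, neg_zero] at hl
  refine he.eventually_eq_of_continuousAt (f := fun p : ℝ × E => K.mul (p.1, p.2, -p.2))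
    (g := fun p => 0) ?_ (.of_forall fun _ => continuousAt_const) ?_
  · filter_upwards [hl.eventually K.eventually_continuousAt_mul] with p h1
    exact h1.comp (f := fun p : ℝ × E => (p.1, p.2, -p.2)) (by fun_prop)
  · filter_upwards [hl.eventually he.map_mul] with p h1
    rw [h1, _root_.map_neg, he.map_neg, mul_inv_cancel, _root_.map_zero, he.map_zero]

/-- For `ε ≠ 0` the rescaled operation is given by `K.mul`. -/
lemma mul_eq_of_exp {ℓ : Γ → E} (hℓ : ∀ᶠ x in 𝓝 (0 : E), ℓ (e x) = x) :
    ∀ᶠ q : ℝ × E × E in 𝓝 (0, 0, 0), q.1 ≠ 0 →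
      K.dil q.1⁻¹ (ℓ (e (K.dil q.1 q.2.1) * e (K.dil q.1 q.2.2))) = K.mul q := by
  have h1 : Tendsto (fun q : ℝ × E × E => K.dil q.1 (K.mul q)) (𝓝 (0, 0, 0)) (𝓝 0) := by
    have := (K.continuous_dil_apply.tendsto ((0 : ℝ), (0 : E))).comp
      (continuous_fst.tendsto' ((0 : ℝ), (0 : E), (0 : E)) 0 rfl |>.prodMk_nhds K.tendsto_mul)
    simpa [K.dil_zero, Function.comp_def] using this
  filter_upwards [h1.eventually hℓ, he.map_mul] with q h2 h3 hq
  rw [← h3, h2, K.dil_inv_dil hq]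

end Integrates

end BracketContraction

/-! ## The homogeneous group of a contraction -/

section VectorSpaceGroup

open VectorField

variable {E : Type*} [NormedAddCommGroup E] [NormedSpace ℝ E] [FiniteDimensional ℝ E]
  [CompleteSpace E] [Group E] [LieGroup 𝓘(ℝ, E) ∞ E]

/-- On a vector space carrying a group law, the left-invariant field of `v` at x is the derivative
of y ↦ xy at 1 applied to `v`; the bracket at 1 is then the skew part of the mixed second
derivative. -/
lemma groupBracket_eq_fderiv (v w : E) : groupBracket E E v w =
    fderiv ℝ (fun x => fderiv ℝ (fun y => x * y) 1 w) 1 v -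
      fderiv ℝ (fun x => fderiv ℝ (fun y => x * y) 1 v) 1 w := by
  have h1 : ∀ v : E, (mulInvariantVectorField (algebraEquiv E E v) : ∀ x : E, TangentSpace 𝓘(ℝ, E) x) =
      fun x : E => (fderiv ℝ (fun y => x * y) 1 v : E) := by
    intro v
    funext x
    change mfderiv 𝓘(ℝ, E) 𝓘(ℝ, E) (fun y => x * y) 1 v = _
    rw [mfderiv_eq_fderiv]
    rfl
  have h2 : ∀ v : E, fderiv ℝ (fun y : E => 1 * y) 1 v = v := by
    intro v
    simp
  have h3 : groupBracket E E v w = mlieBracket 𝓘(ℝ, E) (mulInvariantVectorField (algebraEquiv E E v))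
    (mulInvariantVectorField (algebraEquiv E E w)) (1 : E) := rfl
  rw [h3, ← mlieBracketWithin_univ, mlieBracketWithin_eq_lieBracketWithin]
  refine (congrArg₂ (fun V W : E → E => lieBracketWithin ℝ V W univ 1) (h1 v) (h1 w)).trans ?_
  rw [lieBracketWithin_univ]
  have h4 := lieBracket_eq (𝕜 := ℝ) (V := fun x : E => (fderiv ℝ (fun y => x * y) 1 v : E))
    (W := fun x : E => (fderiv ℝ (fun y => x * y) 1 w : E))
  refine (congrFun h4 1).trans ?_
  simp only [h2]

end VectorSpaceGroup

/-! ### Homogeneous extension of the limit operation to a Lie group -/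

namespace BracketContraction

variable {E : Type u} [NormedAddCommGroup E] [NormedSpace ℝ E] [CompleteSpace E]
  (K : BracketContraction E)

/-- The homogeneous extension of the limit operation to the whole space. -/
def homMul (p : E × E) : E :=
  limUnder (𝓝[>] (0 : ℝ)) fun s => K.dil s⁻¹ (K.limitMul (K.dil s p.1, K.dil s p.2))

lemma tendsto_dil_prod (p : E × E) :
    Tendsto (fun s : ℝ => (K.dil s p.1, K.dil s p.2)) (𝓝[>] 0) (𝓝 (0, 0)) :=
  ((K.tendsto_dil_zero p.1).prodMk_nhds (K.tendsto_dil_zero p.2)).mono_left nhdsWithin_le_nhds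

/-- Homogeneity of β, applied at a small scale r with ratio s/r ≤ 1, makes the expression constant
in small s; the limit in `homMul` is thus a stationary value. -/
lemma eventually_dil_limitMul (p : E × E) : ∀ᶠ s in 𝓝[>] (0 : ℝ),
    K.dil s⁻¹ (K.limitMul (K.dil s p.1, K.dil s p.2)) = K.homMul p := by
  obtain ⟨r, hr, hr0⟩ := (((K.tendsto_dil_prod p).eventually K.limitMul_dil).and
    self_mem_nhdsWithin).exists
  have hr0 : 0 < r := hr0
  have h : ∀ᶠ s in 𝓝[>] (0 : ℝ), K.dil s⁻¹ (K.limitMul (K.dil s p.1, K.dil s p.2)) =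
      K.dil r⁻¹ (K.limitMul (K.dil r p.1, K.dil r p.2)) := by
    filter_upwards [Ioc_mem_nhdsGT hr0] with s hs
    have hs0 : s ≠ 0 := hs.1.ne'
    have h1 := hr (s * r⁻¹) ⟨by have := hs.1; positivity, by
      rw [← div_eq_mul_inv]; exact (div_le_one hr0).2 hs.2⟩
    simp only [← K.dil_mul] at h1
    rw [mul_assoc, inv_mul_cancel₀ hr0.ne', mul_one] at h1
    rw [h1, ← K.dil_mul, inv_mul_cancel_left₀ hs0]
  have hl : K.homMul p = _ := (tendsto_const_nhds.congr' (h.mono fun s hs => hs.symm)).limUnder_eq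
  filter_upwards [h] with s hs
  rw [hs, hl]

lemma eventually_homMul_eq : ∀ᶠ p : E × E in 𝓝 (0, 0), K.homMul p = K.limitMul p := by
  filter_upwards [K.limitMul_dil] with p hp
  obtain ⟨s, hs, hs'⟩ := ((K.eventually_dil_limitMul p).and (Ioc_mem_nhdsGT one_pos)).exists
  rw [← hs, hp s ⟨hs'.1.le, hs'.2⟩, K.dil_inv_dil hs'.1.ne']

lemma homMul_dil {s : ℝ} (hs : 0 < s) (p : E × E) :
    K.homMul (K.dil s p.1, K.dil s p.2) = K.dil s (K.homMul p) := by
  have ht : Tendsto (fun σ : ℝ => σ * s) (𝓝[>] 0) (𝓝[>] 0) := by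
    refine tendsto_nhdsWithin_iff.2 ⟨?_, ?_⟩
    · have := (continuous_mul_const s).tendsto 0
      rw [zero_mul] at this
      exact this.mono_left nhdsWithin_le_nhds
    · filter_upwards [self_mem_nhdsWithin] with σ hσ
      exact mul_pos hσ hs
  obtain ⟨σ, ⟨h1, h2⟩, hσ⟩ := (((K.eventually_dil_limitMul (K.dil s p.1, K.dil s p.2)).and
    (ht.eventually (K.eventually_dil_limitMul p))).and self_mem_nhdsWithin).exists
  have hσ : 0 < σ := hσ
  rw [← h1, ← h2]
  simp only [← K.dil_mul]
  congr 2
  field_simp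

lemma homMul_eq_dil_inv {s : ℝ} (hs : 0 < s) (p : E × E) :
    K.homMul p = K.dil s⁻¹ (K.homMul (K.dil s p.1, K.dil s p.2)) := by
  rw [K.homMul_dil hs, K.dil_inv_dil hs.ne']

lemma contDiff_homMul : ContDiff ℝ ∞ K.homMul := by
  -- Differentiability of finite order at a point is an open condition; this lets one move `p` by a
  -- dilatation into the neighbourhood of 0 where the operation agrees with β.
  rw [contDiff_infty]
  intro n
  rw [contDiff_iff_contDiffAt]
  intro p
  have h0 : ContDiffAt ℝ n K.homMul (0, 0) :=
    (K.contDiffAt_limitMul.of_le (by exact_mod_cast le_top)).congr_of_eventuallyEq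
      K.eventually_homMul_eq
  obtain ⟨s, hs, hs0⟩ := (((K.tendsto_dil_prod p).eventually (h0.eventually (by simp))).and
    self_mem_nhdsWithin).exists
  have hs0 : 0 < s := hs0
  have h1 : K.homMul = fun p : E × E => K.dil s⁻¹ (K.homMul (K.dil s p.1, K.dil s p.2)) :=
    funext fun p => K.homMul_eq_dil_inv hs0 p
  rw [h1]
  refine (K.dil s⁻¹).contDiff.contDiffAt.comp p ?_
  exact hs.comp (f := fun p : E × E => (K.dil s p.1, K.dil s p.2)) p
    (((K.dil s).contDiff.comp contDiff_fst).prodMk ((K.dil s).contDiff.comp contDiff_snd)).contDiffAt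

namespace Integrates

variable {K} {Γ : Type*} [Group Γ] {e : E → Γ} (he : K.Integrates e)

include he

/-- Each global law below follows in the same way: dilate the arguments until the local law of β
applies, then scale back. -/
lemma homMul_zero_right (x : E) : K.homMul (x, 0) = x := by
  have h := he.limitMul_zero_right
  have h' := (Continuous.prodMk_left (0 : E)).tendsto (0 : E) |>.eventually K.eventually_homMul_eq
  obtain ⟨s, ⟨h1, h2⟩, hs⟩ := ((((K.tendsto_dil_zero x).mono_left nhdsWithin_le_nhds).eventually
    (h.and h')).and (self_mem_nhdsWithin : Ioi (0 : ℝ) ∈ 𝓝[>] 0)).exists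
  rw [K.homMul_eq_dil_inv hs]
  simp only [_root_.map_zero]
  rw [h2, h1, K.dil_inv_dil (ne_of_gt hs)]

lemma homMul_zero_left (x : E) : K.homMul (0, x) = x := by
  have h := he.limitMul_zero_left
  have h' := (Continuous.prodMk_right (0 : E)).tendsto (0 : E) |>.eventually K.eventually_homMul_eq
  obtain ⟨s, ⟨h1, h2⟩, hs⟩ := ((((K.tendsto_dil_zero x).mono_left nhdsWithin_le_nhds).eventually
    (h.and h')).and (self_mem_nhdsWithin : Ioi (0 : ℝ) ∈ 𝓝[>] 0)).exists
  rw [K.homMul_eq_dil_inv hs]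
  simp only [_root_.map_zero]
  rw [h2, h1, K.dil_inv_dil (ne_of_gt hs)]

lemma homMul_neg_right (x : E) : K.homMul (x, -x) = 0 := by
  have h := he.limitMul_neg_right
  have h' : ∀ᶠ x : E in 𝓝 0, K.homMul (x, -x) = K.limitMul (x, -x) := by
    have : Continuous fun x : E => (x, -x) := by fun_prop
    have := this.tendsto 0
    rw [neg_zero] at this
    exact this.eventually K.eventually_homMul_eq
  obtain ⟨s, ⟨h1, h2⟩, hs⟩ := ((((K.tendsto_dil_zero x).mono_left nhdsWithin_le_nhds).eventually
    (h.and h')).and (self_mem_nhdsWithin : Ioi (0 : ℝ) ∈ 𝓝[>] 0)).exists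
  rw [K.homMul_eq_dil_inv hs]
  simp only [_root_.map_neg]
  rw [h2, h1, _root_.map_zero]

lemma homMul_assoc (x y z : E) :
    K.homMul (K.homMul (x, y), z) = K.homMul (x, K.homMul (y, z)) := by
  have h0 : Tendsto K.homMul (𝓝 (0, 0)) (𝓝 0) :=
    K.tendsto_limitMul.congr' (K.eventually_homMul_eq.mono fun _ h => h.symm)
  have hl : Tendsto (fun p : E × E × E => (p.1, p.2.1)) (𝓝 (0, 0, 0)) (𝓝 (0, 0)) :=
    Continuous.tendsto' (by fun_prop) _ _ rfl
  have hr : Tendsto (fun p : E × E × E => (p.2.1, p.2.2)) (𝓝 (0, 0, 0)) (𝓝 (0, 0)) :=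
    Continuous.tendsto' (by fun_prop) _ _ rfl
  have hL : Tendsto (fun p : E × E × E => (K.homMul (p.1, p.2.1), p.2.2))
      (𝓝 (0, 0, 0)) (𝓝 (0, 0)) :=
    (h0.comp hl).prodMk_nhds (Continuous.tendsto' (by fun_prop) _ _ rfl)
  have hR : Tendsto (fun p : E × E × E => (p.1, K.homMul (p.2.1, p.2.2)))
      (𝓝 (0, 0, 0)) (𝓝 (0, 0)) :=
    Tendsto.prodMk_nhds (Continuous.tendsto' (by fun_prop) _ _ rfl) (h0.comp hr)
  have hd : Tendsto (fun s : ℝ => (K.dil s x, K.dil s y, K.dil s z)) (𝓝[>] 0) (𝓝 (0, 0, 0)) :=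
    (K.tendsto_dil_zero x |>.prodMk_nhds (K.tendsto_dil_zero y |>.prodMk_nhds
      (K.tendsto_dil_zero z))).mono_left nhdsWithin_le_nhds
  have key : ∀ᶠ p : E × E × E in 𝓝 (0, 0, 0),
      K.homMul (K.homMul (p.1, p.2.1), p.2.2) = K.homMul (p.1, K.homMul (p.2.1, p.2.2)) := by
    filter_upwards [he.limitMul_assoc, hl.eventually K.eventually_homMul_eq,
      hr.eventually K.eventually_homMul_eq, hL.eventually K.eventually_homMul_eq,
      hR.eventually K.eventually_homMul_eq] with p h h1 h2 h3 h4
    rw [h3, h4, h1, h2, h]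
  obtain ⟨s, h, hs⟩ := ((hd.eventually key).and self_mem_nhdsWithin).exists
  have hs : 0 < s := hs
  rw [K.homMul_eq_dil_inv hs, K.homMul_eq_dil_inv hs (x, K.homMul (y, z))]
  simp only [← K.homMul_dil hs]
  exact congrArg _ h

/-- The group with underlying space `E` and operation the homogeneous extension of the limit
operation. -/
abbrev group : Group E where
  mul x y := K.homMul (x, y)
  mul_assoc := he.homMul_assoc
  one := (0 : E)
  one_mul := he.homMul_zero_left
  mul_one := he.homMul_zero_right
  inv x := -x
  inv_mul_cancel x := by
    have := he.homMul_neg_right (-x)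
    rwa [neg_neg] at this

lemma lieGroup : @LieGroup ℝ _ E _ E _ _ 𝓘(ℝ, E) ∞ E he.group _ _ :=
  letI := he.group
  { contMDiff_mul := by
      rw [contMDiff_iff]
      refine ⟨K.contDiff_homMul.continuous, fun x y => ?_⟩
      simp only [mfld_simps, chartAt_self_eq]
      rw [contDiffOn_univ]
      exact K.contDiff_homMul
    contMDiff_inv := contDiff_neg.contMDiff }

/-- Let A(x) be the derivative of y ↦ xy at 0. Differentiating `lieKernel (c_0 x) (A x w) = w` at x
= 0 in the direction v gives DA(v) w - c_0(v, w)/2 = 0. -/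
lemma fderiv_homMul (v w : E) :
    fderiv ℝ (fun x => fderiv ℝ (fun y => K.homMul (x, y)) 0 w) 0 v =
      (1 / 2 : ℝ) • K.bracket 0 v w := by
  have hA : ContDiff ℝ 1 fun x => fderiv ℝ (fun y => K.homMul (x, y)) 0 := by
    refine ContDiff.fderiv (m := 2) (n := 1) (f := fun x y => K.homMul (x, y))
      (K.contDiff_homMul.of_le ENat.LEInfty.out) contDiff_const one_add_one_eq_two.le
  set A : E → E →L[ℝ] E := fun x => fderiv ℝ (fun y => K.homMul (x, y)) 0 with hAdef
  have hA0 : A 0 = .id ℝ E := by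
    have : (fun y => K.homMul (0, y)) = id := funext he.homMul_zero_left
    rw [hAdef]
    simp only [this, fderiv_id]
  have hk : ∀ᶠ x in 𝓝 (0 : E), lieKernel (K.bracket 0 x) (A x w) = w := by
    have h' : ∀ᶠ p in 𝓝 ((0 : E), (0 : E)), ∀ᶠ p' in 𝓝 p, K.homMul p' = K.limitMul p' :=
      K.eventually_homMul_eq.eventually_nhds
    filter_upwards [K.lieKernel_fderiv_limitMul,
      ((Continuous.prodMk_left (0 : E)).tendsto (0 : E)).eventually h'] with x h1 h2
    have h3 : (fun y => K.homMul (x, y)) =ᶠ[𝓝 0] fun y => K.limitMul (x, y) :=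
      ((Continuous.prodMk_right x).tendsto (0 : E)).eventually h2
    rw [hAdef]
    simp only [h3.fderiv_eq]
    exact congrArg (fun T : E →L[ℝ] E => T w) h1
  have hd1 : HasFDerivAt (fun x => lieKernel (K.bracket 0 x))
      (fderiv ℝ lieKernel 0 ∘L K.bracket 0) 0 := by
    have := (contDiff_lieKernel (n := 1) (E := E)).differentiable one_ne_zero
      |>.differentiableAt (x := K.bracket 0 0) |>.hasFDerivAt
    have h2 := this.comp (0 : E) (K.bracket 0).hasFDerivAt
    rw [_root_.map_zero] at h2
    exact h2
  have hd2 : HasFDerivAt A (fderiv ℝ A 0) 0 :=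
    (hA.differentiable one_ne_zero).differentiableAt.hasFDerivAt
  have hd3 : HasFDerivAt (fun x => A x w) (ContinuousLinearMap.apply ℝ E w ∘L fderiv ℝ A 0) 0 :=
    (ContinuousLinearMap.apply ℝ E w).hasFDerivAt.comp (0 : E) hd2
  have hd4 := hd1.clm_apply hd3
  have hd5 : HasFDerivAt (fun x => lieKernel (K.bracket 0 x) (A x w)) (0 : E →L[ℝ] E) 0 :=
    (hasFDerivAt_const w 0).congr_of_eventuallyEq hk
  have h6 := congrArg (fun T : E →L[ℝ] E => T v) (hd4.unique hd5)
  rw [hd3.fderiv]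
  simp [hA0, lieKernel_zero, fderiv_lieKernel_zero] at h6
  rw [one_div]
  exact add_neg_eq_zero.1 h6

/-- The group lives on a real vector space, which is contractible, hence simply connected. Its
bracket is the skew part of c_0/2, and this is c_0 because c_0 is skew. -/
theorem nonempty_simplyConnectedLieGroup [FiniteDimensional ℝ E] {𝔫 : Type*} [LieRing 𝔫]
    [LieAlgebra ℝ 𝔫] (θ : E ≃ₗ[ℝ] 𝔫) (hθ : ∀ x y, θ (K.bracket 0 x y) = ⁅θ x, θ y⁆) :
    Nonempty (SimplyConnectedLieGroup E 𝔫) := by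
  let _ := he.group
  have := he.lieGroup
  have hb : ∀ v w : E, groupBracket E E v w = K.bracket 0 v w := by
    intro v w
    rw [groupBracket_eq_fderiv]
    have h1 := he.fderiv_homMul v w
    have h2 := he.fderiv_homMul w v
    rw [K.bracket_zero_skew] at h2
    refine (congrArg₂ (fun a b : E => a - b) h1 h2).trans ?_
    module
  let ψ : GroupLieAlgebra 𝓘(ℝ, E) E ≃ₗ[ℝ] 𝔫 := (algebraEquiv E E).symm.toLinearEquiv.trans θ
  exact ⟨{ carrier := E
           lieAlgebraEquiv := { ψ with
              map_lie' := fun {X Y} => by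
                exact (congrArg θ (hb ((algebraEquiv E E).symm X) ((algebraEquiv E E).symm Y))).trans
                  (hθ _ _) } }⟩

end Integrates

end BracketContraction

/-! ## Virtual tangent spaces read in a chart -/

/-- A family of maps that extends continuously to `ε = 0` converges uniformly near a point. -/
lemma exists_tendstoUniformlyOn {X M : Type*} [TopologicalSpace X] [LocallyCompactSpace X]
    [UniformSpace M] {F : ℝ → X → M} {H : ℝ × X → M} {f : X → M} {x₀ : X}
    (hH : ∀ᶠ p in 𝓝 ((0 : ℝ), x₀), ContinuousAt H p)
    (hF : ∀ᶠ p in 𝓝 ((0 : ℝ), x₀), p.1 ≠ 0 → F p.1 p.2 = H p)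
    (hf : ∀ᶠ x in 𝓝 x₀, f x = H (0, x)) :
    ∃ U ∈ 𝓝 x₀, TendstoUniformlyOn F f (𝓝[>] 0) U := by
  have h1 := ((Continuous.prodMk_right (0 : ℝ)).tendsto x₀).eventually
    (hH.and hF.eventually_nhds)
  obtain ⟨U, hU, hUsub, hUc⟩ := local_compact_nhds (h1.and hf)
  refine ⟨U, hU, (tendstoLocallyUniformlyOn_iff_tendstoUniformlyOn_of_compact hUc).1 ?_⟩
  intro V hV x hx
  -- For y near x and small ε, both H(ε, y) and H(0, y) are V'-close to H(0, x), so they are V-close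
  -- to each other; compactness of `U` makes the locally uniform limit uniform.
  obtain ⟨V', hV', hsymm, hcomp⟩ := comp_symm_mem_uniformity_sets hV
  obtain ⟨⟨hx1, hx2⟩, -⟩ := hUsub hx
  have h3 : ∀ᶠ p in 𝓝 ((0 : ℝ), x), (H (0, x), H p) ∈ V' :=
    hx1.tendsto.eventually (mem_nhds_left _ hV')
  obtain ⟨pa, ha, pb, hb, h4⟩ := eventually_prod_iff.1
    (nhds_prod_eq (x := (0 : ℝ)) (y := x) ▸ h3.and hx2)
  refine ⟨U ∩ {y | pb y}, inter_mem self_mem_nhdsWithin (mem_nhdsWithin_of_mem_nhds hb), ?_⟩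
  filter_upwards [nhdsWithin_le_nhds ha, self_mem_nhdsWithin] with ε hε hε0 y hy
  rw [(hUsub hy.1).2, (h4 hε hy.2).2 (ne_of_gt hε0)]
  exact hcomp (SetRel.prodMk_mem_comp (hsymm.symm _ _ (h4 ha.self_of_nhds hy.2).1)
    (h4 hε hy.2).1)

lemma eventually_limUnder_eq {X M : Type*} [TopologicalSpace X] [TopologicalSpace M] [T2Space M]
    [Nonempty M] {F : ℝ → X → M} {H : ℝ × X → M} {x₀ : X}
    (hH : ∀ᶠ p in 𝓝 ((0 : ℝ), x₀), ContinuousAt H p)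
    (hF : ∀ᶠ p in 𝓝 ((0 : ℝ), x₀), p.1 ≠ 0 → F p.1 p.2 = H p) :
    ∀ᶠ x in 𝓝 x₀, limUnder (𝓝[>] (0 : ℝ)) (fun ε => F ε x) = H (0, x) := by
  filter_upwards [((Continuous.prodMk_right (0 : ℝ)).tendsto x₀).eventually
    (hH.and hF.eventually_nhds)] with x hx
  have ht : Tendsto (fun ε : ℝ => (ε, x)) (𝓝[>] 0) (𝓝 (0, x)) :=
    ((Continuous.prodMk_left x).tendsto (0 : ℝ)).mono_left nhdsWithin_le_nhds
  refine Tendsto.limUnder_eq ((hx.1.tendsto.comp ht).congr' ?_)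
  filter_upwards [ht.eventually hx.2, self_mem_nhdsWithin] with ε h1 h2
  exact (h1 (ne_of_gt h2)).symm

/-- The dilatation group `P` is, near the neutral element, the group integrating `K` read in the
chart `κ`. -/
structure DilatationGroup.IsChart {E : Type u} [NormedAddCommGroup E] [NormedSpace ℝ E]
    [CompleteSpace E] {M : Type*} [TopologicalSpace M] (P : DilatationGroup M)
    (K : BracketContraction E) (κ : E → M) (ℓ : M → E) : Prop where
  map_zero : κ 0 = P.one
  left_inv : ∀ᶠ x in 𝓝 (0 : E), ℓ (κ x) = x
  right_inv : ∀ᶠ m in 𝓝 P.one, κ (ℓ m) = m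
  continuousAt : ∀ᶠ x in 𝓝 (0 : E), ContinuousAt κ x
  continuousAt_symm : ∀ᶠ m in 𝓝 P.one, ContinuousAt ℓ m
  dil_eq : ∀ ε m, P.dil ε m = κ (K.dil ε (ℓ m))
  mul_eq : ∀ᶠ q : ℝ × E × E in 𝓝 (0, 0, 0), q.1 ≠ 0 →
    P.rescaledMul q.1 (κ q.2.1) (κ q.2.2) = κ (K.mul q)
  inv_eq : ∀ᶠ q : ℝ × E in 𝓝 (0, 0), q.1 ≠ 0 → P.rescaledInv q.1 (κ q.2) = κ (-q.2)

namespace DilatationGroup.IsChart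

variable {E : Type u} [NormedAddCommGroup E] [NormedSpace ℝ E] [CompleteSpace E]
  {K : BracketContraction E} {M : Type*} {κ : E → M} {ℓ : M → E}

section Topological

variable [TopologicalSpace M] {P : DilatationGroup M} (h : P.IsChart K κ ℓ)

include h

lemma symm_one : ℓ P.one = 0 := by rw [← h.map_zero, h.left_inv.self_of_nhds]

lemma tendsto_symm : Tendsto ℓ (𝓝 P.one) (𝓝 0) := by
  have := h.continuousAt_symm.self_of_nhds.tendsto
  rwa [h.symm_one] at this

lemma tendsto : Tendsto κ (𝓝 0) (𝓝 P.one) := by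
  have := h.continuousAt.self_of_nhds.tendsto
  rwa [h.map_zero] at this

lemma tendsto_mul_symm : Tendsto (fun q : ℝ × M × M => (q.1, ℓ q.2.1, ℓ q.2.2))
    (𝓝 (0, P.one, P.one)) (𝓝 (0, 0, 0)) :=
  (continuous_fst.tendsto' _ _ rfl).prodMk_nhds
    ((h.tendsto_symm.comp ((continuous_fst.comp continuous_snd).tendsto' _ _ rfl)).prodMk_nhds
      (h.tendsto_symm.comp ((continuous_snd.comp continuous_snd).tendsto' _ _ rfl)))

lemma eventually_fst_right_inv : ∀ᶠ q : ℝ × M in 𝓝 (0, P.one), κ (ℓ q.2) = q.2 :=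
  (continuous_snd.tendsto' ((0 : ℝ), P.one) _ rfl).eventually h.right_inv

lemma eventually_prod_right_inv : ∀ᶠ p : M × M in 𝓝 (P.one, P.one),
    κ (ℓ p.1) = p.1 ∧ κ (ℓ p.2) = p.2 :=
  ((continuous_fst.tendsto' (P.one, P.one) _ rfl).eventually h.right_inv).and
    ((continuous_snd.tendsto' (P.one, P.one) _ rfl).eventually h.right_inv)

lemma eventually_continuousAt_dil (ε : ℝ) : ∀ᶠ p : ℝ × M in 𝓝 (ε, P.one),
    ContinuousAt (fun p : ℝ × M => κ (K.dil p.1 (ℓ p.2))) p := by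
  have hs : Tendsto (fun p : ℝ × M => ℓ p.2) (𝓝 (ε, P.one)) (𝓝 0) :=
    h.tendsto_symm.comp (continuous_snd.tendsto' _ _ rfl)
  have hd : Tendsto (fun p : ℝ × M => K.dil p.1 (ℓ p.2)) (𝓝 (ε, P.one)) (𝓝 0) := by
    have := (K.continuous_dil_apply.tendsto (ε, (0 : E))).comp
      ((continuous_fst.tendsto' (ε, P.one) ε rfl).prodMk_nhds hs)
    simpa [Function.comp_def] using this
  filter_upwards [(continuous_snd.tendsto' (ε, P.one) _ rfl).eventually h.continuousAt_symm,
    hd.eventually h.continuousAt] with p h1 h2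
  refine h2.comp (f := fun p : ℝ × M => K.dil p.1 (ℓ p.2)) ?_
  exact K.continuous_dil_apply.continuousAt.comp (f := fun p : ℝ × M => (p.1, ℓ p.2))
    (continuousAt_fst.prodMk (h1.comp (f := fun p : ℝ × M => p.2) continuousAt_snd))

lemma eventually_continuousAt_mul : ∀ᶠ q : ℝ × M × M in 𝓝 (0, P.one, P.one),
    ContinuousAt (fun q : ℝ × M × M => κ (K.mul (q.1, ℓ q.2.1, ℓ q.2.2))) q := by
  have h1 := (continuous_fst.comp continuous_snd).tendsto' ((0 : ℝ), P.one, P.one) P.one rfl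
    |>.eventually h.continuousAt_symm
  have h2 := (continuous_snd.comp continuous_snd).tendsto' ((0 : ℝ), P.one, P.one) P.one rfl
    |>.eventually h.continuousAt_symm
  filter_upwards [h1, h2, h.tendsto_mul_symm.eventually K.eventually_continuousAt_mul,
    (K.tendsto_mul.comp h.tendsto_mul_symm).eventually h.continuousAt] with q h1 h2 h3 h4
  refine h4.comp (f := fun q : ℝ × M × M => K.mul (q.1, ℓ q.2.1, ℓ q.2.2)) ?_
  refine h3.comp (f := fun q : ℝ × M × M => (q.1, ℓ q.2.1, ℓ q.2.2)) ?_
  exact continuousAt_fst.prodMk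
    ((h1.comp (f := fun q : ℝ × M × M => q.2.1) (by fun_prop)).prodMk
      (h2.comp (f := fun q : ℝ × M × M => q.2.2) (by fun_prop)))

lemma eventually_continuousAt_neg : ∀ᶠ q : ℝ × M in 𝓝 (0, P.one),
    ContinuousAt (fun q : ℝ × M => κ (-ℓ q.2)) q := by
  have hs : Tendsto (fun p : ℝ × M => -ℓ p.2) (𝓝 (0, P.one)) (𝓝 0) := by
    have := (h.tendsto_symm.comp (continuous_snd.tendsto' ((0 : ℝ), P.one) _ rfl)).neg
    rwa [neg_zero] at this
  filter_upwards [(continuous_snd.tendsto' ((0 : ℝ), P.one) _ rfl).eventually h.continuousAt_symm,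
    hs.eventually h.continuousAt] with p h1 h2
  refine h2.comp (f := fun p : ℝ × M => -ℓ p.2) ?_
  exact (h1.comp (f := fun p : ℝ × M => p.2) continuousAt_snd).neg

lemma eventually_rescaledMul_eq : ∀ᶠ q : ℝ × M × M in 𝓝 (0, P.one, P.one), q.1 ≠ 0 →
    P.rescaledMul q.1 q.2.1 q.2.2 = κ (K.mul (q.1, ℓ q.2.1, ℓ q.2.2)) := by
  filter_upwards [h.tendsto_mul_symm.eventually h.mul_eq,
    (continuous_snd.tendsto' ((0 : ℝ), P.one, P.one) _ rfl).eventually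
      h.eventually_prod_right_inv] with q h1 h2 hq
  rw [← h1 hq, h2.1, h2.2]

lemma eventually_rescaledInv_eq : ∀ᶠ q : ℝ × M in 𝓝 (0, P.one), q.1 ≠ 0 →
    P.rescaledInv q.1 q.2 = κ (-ℓ q.2) := by
  have ht : Tendsto (fun q : ℝ × M => (q.1, ℓ q.2)) (𝓝 (0, P.one)) (𝓝 (0, 0)) :=
    (continuous_fst.tendsto' _ _ rfl).prodMk_nhds
      (h.tendsto_symm.comp (continuous_snd.tendsto' _ _ rfl))
  filter_upwards [ht.eventually h.inv_eq, h.eventually_fst_right_inv] with q h1 h2 hq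
  rw [← h1 hq, h2]

variable [T2Space M]

lemma virtualMul_eq : ∀ᶠ p : M × M in 𝓝 (P.one, P.one),
    P.virtualMul p.1 p.2 = κ (K.limitMul (ℓ p.1, ℓ p.2)) :=
  haveI : Nonempty M := ⟨P.one⟩
  eventually_limUnder_eq (F := fun ε (p : M × M) => P.rescaledMul ε p.1 p.2)
    h.eventually_continuousAt_mul h.eventually_rescaledMul_eq

lemma virtualInv_eq : ∀ᶠ m in 𝓝 P.one, P.virtualInv m = κ (-ℓ m) :=
  haveI : Nonempty M := ⟨P.one⟩
  eventually_limUnder_eq (F := P.rescaledInv)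
    h.eventually_continuousAt_neg h.eventually_rescaledInv_eq

lemma virtualMul_chart : ∀ᶠ p : E × E in 𝓝 (0, 0),
    P.virtualMul (κ p.1) (κ p.2) = κ (K.limitMul p) := by
  have h1 : Tendsto (fun p : E × E => κ p.1) (𝓝 (0, 0)) (𝓝 P.one) :=
    h.tendsto.comp (continuous_fst.tendsto' _ _ rfl)
  have h2 : Tendsto (fun p : E × E => κ p.2) (𝓝 (0, 0)) (𝓝 P.one) :=
    h.tendsto.comp (continuous_snd.tendsto' _ _ rfl)
  filter_upwards [(h1.prodMk_nhds h2).eventually h.virtualMul_eq,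
    (continuous_fst.tendsto' ((0 : E), (0 : E)) _ rfl).eventually h.left_inv,
    (continuous_snd.tendsto' ((0 : E), (0 : E)) _ rfl).eventually h.left_inv] with p h3 h4 h5
  rw [h3, h4, h5]

lemma virtualInv_chart : ∀ᶠ x in 𝓝 (0 : E), P.virtualInv (κ x) = κ (-x) := by
  filter_upwards [h.tendsto.eventually h.virtualInv_eq, h.left_inv] with x h1 h2
  rw [h1, h2]

/-- In the chart the virtual operation is β and the virtual inverse is x ↦ -x, so the laws of β
transfer. -/
lemma virtualTangentIsLocalGroup {Γ : Type*} [Group Γ] {e : E → Γ} (he : K.Integrates e) :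
    P.VirtualTangentIsLocalGroup := by
  refine ⟨?_, ?_, ?_⟩
  · have h1 := ((Continuous.prodMk_left (0 : E)).tendsto (0 : E)).eventually h.virtualMul_chart
    filter_upwards [h.right_inv, h.tendsto_symm.eventually (h1.and he.limitMul_zero_right)]
      with x hx h2
    change P.virtualMul x P.one = x
    have h3 := h2.1
    rwa [h2.2, h.map_zero, hx] at h3
  · have hf : Tendsto (fun p : M × M × M => (ℓ p.1, ℓ p.2.1, ℓ p.2.2))
        (𝓝 (P.one, P.one, P.one)) (𝓝 (0, 0, 0)) :=
      (h.tendsto_symm.comp (continuous_fst.tendsto' _ _ rfl)).prodMk_nhds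
        ((h.tendsto_symm.comp ((continuous_fst.comp continuous_snd).tendsto' _ _ rfl)).prodMk_nhds
          (h.tendsto_symm.comp ((continuous_snd.comp continuous_snd).tendsto' _ _ rfl)))
    have hl : Tendsto (fun p : E × E × E => (p.1, p.2.1)) (𝓝 (0, 0, 0)) (𝓝 (0, 0)) :=
      Continuous.tendsto' (by fun_prop) _ _ rfl
    have hr : Tendsto (fun p : E × E × E => (p.2.1, p.2.2)) (𝓝 (0, 0, 0)) (𝓝 (0, 0)) :=
      Continuous.tendsto' (by fun_prop) _ _ rfl
    have hL : Tendsto (fun p : E × E × E => (K.limitMul (p.1, p.2.1), p.2.2))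
        (𝓝 (0, 0, 0)) (𝓝 (0, 0)) :=
      (K.tendsto_limitMul.comp hl).prodMk_nhds (Continuous.tendsto' (by fun_prop) _ _ rfl)
    have hR : Tendsto (fun p : E × E × E => (p.1, K.limitMul (p.2.1, p.2.2)))
        (𝓝 (0, 0, 0)) (𝓝 (0, 0)) :=
      Tendsto.prodMk_nhds (Continuous.tendsto' (by fun_prop) _ _ rfl) (K.tendsto_limitMul.comp hr)
    have key : ∀ᶠ p : E × E × E in 𝓝 (0, 0, 0),
        P.virtualMul (κ p.1) (P.virtualMul (κ p.2.1) (κ p.2.2)) =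
          P.virtualMul (P.virtualMul (κ p.1) (κ p.2.1)) (κ p.2.2) := by
      filter_upwards [hl.eventually h.virtualMul_chart, hr.eventually h.virtualMul_chart,
        hL.eventually h.virtualMul_chart, hR.eventually h.virtualMul_chart,
        he.limitMul_assoc] with p h1 h2 h3 h4 h5
      rw [h1, h2, h3, h4, h5]
    filter_upwards [hf.eventually key,
      (continuous_fst.tendsto' (P.one, P.one, P.one) _ rfl).eventually h.right_inv,
      (continuous_snd.tendsto' (P.one, P.one, P.one) _ rfl).eventually
        h.eventually_prod_right_inv] with p h1 h2 h3
    rw [h2, h3.1, h3.2] at h1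
    exact h1
  · have hf : Tendsto (fun p : M × M => (ℓ p.1, ℓ p.2)) (𝓝 (P.one, P.one)) (𝓝 (0, 0)) :=
      (h.tendsto_symm.comp (continuous_fst.tendsto' _ _ rfl)).prodMk_nhds
        (h.tendsto_symm.comp (continuous_snd.tendsto' _ _ rfl))
    have key : ∀ᶠ p : E × E in 𝓝 (0, 0),
        P.virtualMul (κ p.1) (P.virtualMul (κ (-p.1)) (κ p.2)) = κ p.2 := by
      have hn : Tendsto (fun p : E × E => (-p.1, p.2)) (𝓝 (0, 0)) (𝓝 (0, 0)) :=
        Continuous.tendsto' (by fun_prop) _ _ (by simp)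
      have hR : Tendsto (fun p : E × E => (p.1, K.limitMul (-p.1, p.2))) (𝓝 (0, 0)) (𝓝 (0, 0)) :=
        Tendsto.prodMk_nhds (Continuous.tendsto' (by fun_prop) _ _ rfl) (K.tendsto_limitMul.comp hn)
      have ha : Tendsto (fun p : E × E => (p.1, -p.1, p.2)) (𝓝 (0, 0)) (𝓝 (0, 0, 0)) :=
        Continuous.tendsto' (by fun_prop) _ _ (by simp)
      filter_upwards [hn.eventually h.virtualMul_chart, hR.eventually h.virtualMul_chart,
        ha.eventually he.limitMul_assoc,
        (continuous_fst.tendsto' ((0 : E), (0 : E)) _ rfl).eventually he.limitMul_neg_right,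
        (continuous_snd.tendsto' ((0 : E), (0 : E)) _ rfl).eventually he.limitMul_zero_left]
        with p h1 h2 h3 h4 h5
      rw [h1, h2, ← h3, h4, h5]
    have hn : Tendsto (fun p : E × E => (-p.1, p.2)) (𝓝 (0, 0)) (𝓝 (0, 0)) :=
      Continuous.tendsto' (by fun_prop) _ _ (by simp)
    -- Replacing x by -x in the first cancellation law gives the second.
    have key' := hn.eventually key
    simp only [neg_neg] at key'
    filter_upwards [hf.eventually (key.and key'), h.eventually_prod_right_inv,
      (hf.eventually ((continuous_fst.tendsto' ((0 : E), (0 : E)) _ rfl).eventually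
        h.virtualInv_chart))] with p h1 h2 h3
    rw [h2.1] at h3
    simp only [h2.1, h2.2] at h1
    change P.virtualMul p.1 (P.virtualMul (P.virtualInv p.1) p.2) = p.2 ∧
      P.virtualMul (P.virtualInv p.1) (P.virtualMul p.1 p.2) = p.2
    rw [h3]
    exact h1

end Topological

/-- In the chart the families in H0, H1 and H2 extend continuously to ε = 0, so local compactness
makes the limits uniform for any uniformity inducing the topology. -/
lemma hasVirtualTangent [UniformSpace M] [T2Space M] [LocallyCompactSpace M]
    {P : DilatationGroup M} (h : P.IsChart K κ ℓ) : P.HasVirtualTangent where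
  action_one := by
    filter_upwards [h.right_inv] with m hm
    rw [h.dil_eq, K.dil_one]
    exact hm
  action_mul ε _ μ _ := by
    have ht : Tendsto (fun m => K.dil μ (ℓ m)) (𝓝 P.one) (𝓝 0) := by
      have := ((K.dil μ).continuous.tendsto 0).comp h.tendsto_symm
      rwa [_root_.map_zero] at this
    filter_upwards [ht.eventually h.left_inv] with m hm
    rw [h.dil_eq, h.dil_eq, h.dil_eq, hm, K.dil_mul]
  action_uniform ε _ := by
    obtain ⟨U, hU, hUsub, hUc⟩ := local_compact_nhds (h.eventually_continuousAt_dil ε)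
    obtain ⟨W, hW, V, hV, hWV⟩ := mem_nhds_prod_iff.1 hU
    refine ⟨W, hW, V, hV, UniformContinuousOn.mono ?_ hWV⟩
    simp only [h.dil_eq]
    exact hUc.uniformContinuousOn_of_continuous fun p hp =>
      ContinuousAt.continuousWithinAt (f := fun p : ℝ × M => κ (K.dil p.1 (ℓ p.2))) (hUsub hp)
  dil_one ε _ := by rw [h.dil_eq, h.symm_one, _root_.map_zero, h.map_zero]
  dil_tendsto := exists_tendstoUniformlyOn (H := fun p : ℝ × M => κ (K.dil p.1 (ℓ p.2)))
    (h.eventually_continuousAt_dil 0) (.of_forall fun p _ => h.dil_eq p.1 p.2)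
    (.of_forall fun m => by simp [K.dil_zero, h.map_zero])
  mul_tendsto := by
    obtain ⟨U, hU, hunif⟩ := exists_tendstoUniformlyOn
      (F := fun ε (p : M × M) => P.rescaledMul ε p.1 p.2)
      h.eventually_continuousAt_mul h.eventually_rescaledMul_eq h.virtualMul_eq
    obtain ⟨V, hV, W, hW, hVU⟩ := mem_nhds_prod_iff.1 hU
    exact ⟨V ∩ W, inter_mem hV hW,
      hunif.mono ((prod_mono inter_subset_left inter_subset_right).trans hVU)⟩
  inv_tendsto := exists_tendstoUniformlyOn h.eventually_continuousAt_neg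
    h.eventually_rescaledInv_eq h.virtualInv_eq

end DilatationGroup.IsChart

/-! ## The exponential and logarithm of a Lie group near the identity -/

section ExpLog

variable {E : Type u} [NormedAddCommGroup E] [NormedSpace ℝ E] [FiniteDimensional ℝ E]
  [CompleteSpace E] {G : Type*} [TopologicalSpace G] [T2Space G] [ChartedSpace E G] [Group G]
  [LieGroup 𝓘(ℝ, E) ∞ G]

variable (E G) in
lemma exists_lieLog_eq : ∃ φ : OpenPartialHomeomorph (GroupLieAlgebra 𝓘(ℝ, E) G) G,
    0 ∈ φ.source ∧ EqOn φ lieExp φ.source ∧ ∀ g, lieLog g = φ.symm g := by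
  have h := exists_openPartialHomeomorph_lieExp (E := E) (G := G)
  refine ⟨h.choose, h.choose_spec.1, h.choose_spec.2, fun g => ?_⟩
  rw [lieLog, dif_pos h]

variable (E G) in
lemma eventually_lieLog_lieExp : ∀ᶠ X : GroupLieAlgebra 𝓘(ℝ, E) G in 𝓝 0,
    lieLog (lieExp X) = X := by
  obtain ⟨φ, h0, hφ, hl⟩ := exists_lieLog_eq E G
  filter_upwards [φ.open_source.mem_nhds h0] with X hX
  rw [← hφ hX, hl, φ.left_inv hX]

variable (E G) in
lemma eventually_lieExp_lieLog : ∀ᶠ g : G in 𝓝 1,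
    lieExp (lieLog (E := E) g) = g := by
  obtain ⟨φ, h0, hφ, hl⟩ := exists_lieLog_eq E G
  have h1 : (1 : G) ∈ φ.target := by
    rw [← lieExp_zero (E := E), ← hφ h0]; exact φ.map_source h0
  filter_upwards [φ.open_target.mem_nhds h1] with g hg
  rw [hl, ← hφ (φ.map_target hg), φ.right_inv hg]

variable (E G) in
lemma eventually_continuousAt_lieExp : ∀ᶠ X : GroupLieAlgebra 𝓘(ℝ, E) G in 𝓝 0,
    ContinuousAt (lieExp (E := E) (G := G)) X := by
  obtain ⟨φ, h0, hφ, hl⟩ := exists_lieLog_eq E G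
  filter_upwards [φ.open_source.mem_nhds h0] with X hX
  exact (φ.continuousAt hX).congr (hφ.eventuallyEq_of_mem (φ.open_source.mem_nhds hX))

variable (E G) in
lemma eventually_continuousAt_lieLog : ∀ᶠ g : G in 𝓝 1,
    ContinuousAt (lieLog (E := E) (G := G)) g := by
  obtain ⟨φ, h0, hφ, hl⟩ := exists_lieLog_eq E G
  have h1 : (1 : G) ∈ φ.target := by
    rw [← lieExp_zero (E := E), ← hφ h0]; exact φ.map_source h0
  filter_upwards [φ.open_target.mem_nhds h1] with g hg
  exact (φ.continuousAt_symm hg).congr (.of_forall fun g => (hl g).symm)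

lemma lieLog_one : lieLog (1 : G) = (0 : GroupLieAlgebra 𝓘(ℝ, E) G) := by
  have := (eventually_lieLog_lieExp E G).self_of_nhds
  rwa [lieExp_zero] at this

lemma tendsto_lieExp : Tendsto (lieExp (E := E) (G := G)) (𝓝 0) (𝓝 1) := by
  have := (eventually_continuousAt_lieExp E G).self_of_nhds.tendsto
  rwa [lieExp_zero] at this

variable (E G) in
lemma isLocalGroupIso_lieExp :
    IsLocalGroupIso 0 logMul 1 (· * ·) (lieExp : GroupLieAlgebra 𝓘(ℝ, E) G → G) := by
  refine ⟨lieExp_zero, exists_openPartialHomeomorph_lieExp, ?_⟩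
  have : IsTopologicalGroup G := topologicalGroup_of_lieGroup 𝓘(ℝ, E) ∞
  have ht : Tendsto (fun p : GroupLieAlgebra 𝓘(ℝ, E) G × GroupLieAlgebra 𝓘(ℝ, E) G =>
      lieExp p.1 * lieExp p.2) (𝓝 (0, 0)) (𝓝 1) := by
    have := (tendsto_lieExp (E := E) (G := G)).comp
        (continuous_fst.tendsto' ((0 : GroupLieAlgebra 𝓘(ℝ, E) G), (0 : GroupLieAlgebra 𝓘(ℝ, E) G)) _ rfl)
      |>.mul ((tendsto_lieExp (E := E) (G := G)).comp (continuous_snd.tendsto' _ _ rfl))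
    rwa [mul_one] at this
  filter_upwards [ht.eventually (eventually_lieExp_lieLog E G)] with p hp
  exact hp

end ExpLog

/-! ### Continuity in the dilatation parameter, and the contraction on the model space -/

namespace AdaptedBasis

variable {L : Type*} [LieRing L] [LieAlgebra ℝ L] {D : Submodule ℝ L} (B : AdaptedBasis D)
  [TopologicalSpace L] [ContinuousAdd L] [ContinuousSMul ℝ L]

lemma continuous_dil_left (x : L) : Continuous fun ε => B.dil ε x := by
  simp only [dil_apply]
  fun_prop

lemma continuous_scaledBracket_left (x y : L) : Continuous fun ε => B.scaledBracket ε x y := by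
  simp only [scaledBracket, B.basis.constr_apply_fintype ℝ, LinearMap.sum_apply,
    LinearMap.smul_apply]
  fun_prop

end AdaptedBasis

section Contraction

variable {E : Type u} [NormedAddCommGroup E] [NormedSpace ℝ E] [FiniteDimensional ℝ E]
  [CompleteSpace E] {G : Type*} [TopologicalSpace G] [ChartedSpace E G] [Group G]
  [LieGroup 𝓘(ℝ, E) ∞ G] {D : Submodule ℝ (GroupLieAlgebra 𝓘(ℝ, E) G)}

/-- The dilatations of an adapted basis and the contraction of the Lie bracket, on the model
space. -/
def AdaptedBasis.contraction (B : AdaptedBasis D) : BracketContraction E where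
  dil ε := LinearMap.toContinuousLinearMap ((algebraEquiv E G).symm.toLinearMap ∘ₗ B.dil ε ∘ₗ
    (algebraEquiv E G).toLinearMap)
  bracket ε := LinearMap.toContinuousLinearMap (LinearMap.toContinuousLinearMap.toLinearMap ∘ₗ
    LinearMap.mk₂ ℝ (fun X Y => (algebraEquiv E G).symm
      (B.scaledBracket ε (algebraEquiv E G X) (algebraEquiv E G Y)))
      (by simp) (by simp) (by simp) (by simp))
  continuous_dil := continuous_clm_apply.2 fun x =>
    (algebraEquiv E G).symm.continuous.comp (B.continuous_dil_left (algebraEquiv E G x))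
  continuous_bracket := continuous_clm_apply.2 fun x => continuous_clm_apply.2 fun y =>
    (algebraEquiv E G).symm.continuous.comp
      (B.continuous_scaledBracket_left (algebraEquiv E G x) (algebraEquiv E G y))
  dil_zero := by
    ext x
    exact (congrArg (algebraEquiv E G).symm (B.dil_zero _)).trans (map_zero _)
  dil_one := by
    ext x
    exact congrArg (algebraEquiv E G).symm (B.dil_one _)
  dil_mul ε μ x := congrArg (algebraEquiv E G).symm (B.dil_mul ε μ _)
  dil_bracket ε s x y := congrArg (algebraEquiv E G).symm (B.dil_scaledBracket ε s _ _)
  bracket_zero_skew x y := (congrArg (algebraEquiv E G).symm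
    (B.scaledBracket_zero_skew _ _)).trans (map_neg _ _)

end Contraction

/-! ## The virtual tangent space of a Lie group -/

section VirtualTangent

variable {E : Type u} [NormedAddCommGroup E] [NormedSpace ℝ E] [FiniteDimensional ℝ E]
  [CompleteSpace E] {G : Type*} [TopologicalSpace G] [T2Space G] [ChartedSpace E G] [Group G]
  [LieGroup 𝓘(ℝ, E) ∞ G] {D : Submodule ℝ (GroupLieAlgebra 𝓘(ℝ, E) G)} (B : AdaptedBasis D)

/-- If `L ε` intertwines the brackets, then it intertwines the log curves, which are mapped to
products by the exponential of `G`. -/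
lemma eventually_lieExp_mul (K : BracketContraction E) {L : ℝ → E →L[ℝ] E}
    (hL : Continuous L) {S : Set ℝ}
    (hbr : ∀ ε ∈ S, ∀ x y, groupBracket E G (L ε x) (L ε y) = L ε (K.bracket ε x y)) :
    ∀ᶠ q : ℝ × E × E in 𝓝 (0, 0, 0), q.1 ∈ S →
      lieExp (algebraEquiv E G (L q.1 (K.mul q))) = lieExp (algebraEquiv E G (L q.1 q.2.1)) * lieExp (algebraEquiv E G (L q.1 q.2.2)) := by
  obtain ⟨r, hr, h⟩ := exists_lieExp_logCurve (E := E) (G := G)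
  -- A bound on L ε for small ε keeps the image curves within the radius where exp multiplies along
  -- log curves.
  have hLb : ∀ᶠ q : ℝ × E × E in 𝓝 (0, 0, 0), ‖L q.1‖ < ‖L 0‖ + 1 :=
    (hL.norm.comp continuous_fst).tendsto' ((0 : ℝ), (0 : E), (0 : E)) _ rfl
      |>.eventually_lt_const (lt_add_one _)
  have hM : 0 < ‖L 0‖ + 1 := by positivity
  filter_upwards [hLb, K.eventually_norm_logCurve_lt (div_pos hr hM), K.eventually_isLogCurve]
    with q h1 h2 h3 hq
  have h4 := h (L q.1 q.2.2) (L q.1 ∘ K.logCurve (K.bracket q.1, q.2)) (fun t _ => ?_)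
    (h3.2.map (hbr q.1 hq))
  · simp only [Function.comp_apply, h3.1] at h4
    exact h4
  · calc _ ≤ ‖L q.1‖ * ‖K.logCurve (K.bracket q.1, q.2) t‖ := (L q.1).le_opNorm _
      _ ≤ (‖L 0‖ + 1) * ‖K.logCurve (K.bracket q.1, q.2) t‖ := by gcongr
      _ < (‖L 0‖ + 1) * (r / (‖L 0‖ + 1)) := by gcongr; exact h2 t
      _ = r := by field_simp

/-- The exponential of `G`, on the model space. -/
def modelExp (x : E) : G := lieExp (algebraEquiv E G x)

/-- The logarithm of `G`, with values in the model space. -/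
def modelLog (g : G) : E := (algebraEquiv E G).symm (lieLog g)

lemma tendsto_algebraEquiv : Tendsto (algebraEquiv E G) (𝓝 0) (𝓝 0) :=
  (algebraEquiv E G).continuous.tendsto' _ _ (map_zero _)

lemma tendsto_algebraEquiv_symm : Tendsto (algebraEquiv E G).symm (𝓝 0) (𝓝 0) :=
  (algebraEquiv E G).symm.continuous.tendsto' _ _ (map_zero _)

lemma eventually_modelLog_modelExp : ∀ᶠ x : E in 𝓝 0, modelLog (modelExp x : G) = x := by
  filter_upwards [tendsto_algebraEquiv.eventually (eventually_lieLog_lieExp E G)] with x hx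
  rw [modelLog, modelExp, hx, ContinuousLinearEquiv.symm_apply_apply]

lemma integrates_modelExp : B.contraction.Integrates (modelExp : E → G) where
  injOn := by
    obtain ⟨φ, h0, hφ⟩ := exists_openPartialHomeomorph_lieExp (E := E) (G := G)
    refine ⟨algebraEquiv E G ⁻¹' φ.source,
      tendsto_algebraEquiv (φ.open_source.mem_nhds h0), fun x hx y hy hxy => ?_⟩
    refine (algebraEquiv E G).injective (φ.injOn hx hy ?_)
    exact (hφ hx).trans (hxy.trans (hφ hy).symm)
  map_zero := by rw [modelExp, map_zero, lieExp_zero]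
  map_neg x := by rw [modelExp, map_neg, lieExp_neg]; rfl
  -- Here L ε = δ_ε, which intertwines c_ε with c_1, the bracket of G, for every ε including 0.
  map_mul := (eventually_lieExp_mul B.contraction B.contraction.continuous_dil (S := univ)
    fun ε _ x y => by
      have h := B.contraction.dil_bracket 1 ε x y
      rw [one_mul] at h
      rw [h]
      exact congrArg (algebraEquiv E G).symm (B.scaledBracket_one _ _).symm).mono
    fun _ h => h trivial

/-- In exponential coordinates inversion is x ↦ -x, which commutes with the linear dilatations; the
limit in H2 is therefore already attained for small ε ≠ 0. -/
lemma eventually_rescaled_inv : ∀ᶠ q : ℝ × E in 𝓝 (0, 0), q.1 ≠ 0 →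
    B.contraction.dil q.1⁻¹ (modelLog (modelExp (B.contraction.dil q.1 q.2) : G)⁻¹) = -q.2 := by
  have ht : Tendsto (fun q : ℝ × E => -B.contraction.dil q.1 q.2) (𝓝 (0, 0)) (𝓝 0) := by
    have := (B.contraction.continuous_dil_apply.tendsto ((0 : ℝ), (0 : E))).neg
    simpa using this
  filter_upwards [ht.eventually (eventually_modelLog_modelExp (G := G))] with q h1 hq
  rw [← (integrates_modelExp B).map_neg, h1, map_neg, B.contraction.dil_inv_dil hq]

lemma isChart_logGroup :
    (logGroup B).IsChart B.contraction (algebraEquiv E G) (algebraEquiv E G).symm where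
  map_zero := map_zero _
  left_inv := .of_forall fun x => (algebraEquiv E G).symm_apply_apply x
  right_inv := .of_forall fun x => (algebraEquiv E G).apply_symm_apply x
  continuousAt := .of_forall fun x => (algebraEquiv E G).continuous.continuousAt
  continuousAt_symm := .of_forall fun x => (algebraEquiv E G).symm.continuous.continuousAt
  dil_eq _ _ := rfl
  mul_eq := by
    filter_upwards [(integrates_modelExp B).mul_eq_of_exp eventually_modelLog_modelExp]
      with q h hq
    exact congrArg (algebraEquiv E G) (h hq)
  inv_eq := by
    filter_upwards [eventually_rescaled_inv B] with q h hq
    exact congrArg (algebraEquiv E G) (h hq)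

lemma isChart_dilatedGroup :
    (dilatedGroup B).IsChart B.contraction (modelExp : E → G) modelLog where
  map_zero := (integrates_modelExp B).map_zero
  left_inv := eventually_modelLog_modelExp
  right_inv := eventually_lieExp_lieLog E G
  continuousAt := by
    filter_upwards [tendsto_algebraEquiv.eventually (eventually_continuousAt_lieExp E G)] with x hx
    exact hx.comp (algebraEquiv E G).continuous.continuousAt
  continuousAt_symm := by
    filter_upwards [eventually_continuousAt_lieLog E G] with g hg
    exact (algebraEquiv E G).symm.continuous.continuousAt.comp hg
  dil_eq _ _ := rfl
  mul_eq := by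
    have h1 := (integrates_modelExp B).mul_eq_of_exp eventually_modelLog_modelExp
    filter_upwards [h1, (continuous_fst.comp continuous_snd).tendsto'
        ((0 : ℝ), (0 : E), (0 : E)) 0 rfl |>.eventually (eventually_modelLog_modelExp (G := G)),
      (continuous_snd.comp continuous_snd).tendsto' ((0 : ℝ), (0 : E), (0 : E)) 0 rfl |>.eventually
        (eventually_modelLog_modelExp (G := G))] with q h hx hy hq
    change modelExp (B.contraction.dil q.1⁻¹ (modelLog
      ((modelExp (B.contraction.dil q.1 (modelLog (modelExp q.2.1 : G))) : G) *
        modelExp (B.contraction.dil q.1 (modelLog (modelExp q.2.2 : G)))))) = _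
    rw [Function.comp_apply] at hx hy
    rw [hx, hy, h hq]
  inv_eq := by
    filter_upwards [eventually_rescaled_inv B, continuous_snd.tendsto' ((0 : ℝ), (0 : E)) 0 rfl
      |>.eventually (eventually_modelLog_modelExp (G := G))] with q h hx hq
    change modelExp (B.contraction.dil q.1⁻¹ (modelLog
      (modelExp (B.contraction.dil q.1 (modelLog (modelExp q.2 : G))) : G)⁻¹)) = _
    rw [hx, h hq]

lemma hasVirtualTangent_logGroup :
    @DilatationGroup.HasVirtualTangent _ (logGroup B) (algebraUniformSpace E G) := by
  have : LocallyCompactSpace (GroupLieAlgebra 𝓘(ℝ, E) G) :=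
    (algebraEquiv E G).toHomeomorph.symm.isClosedEmbedding.locallyCompactSpace
  have : T2Space (GroupLieAlgebra 𝓘(ℝ, E) G) :=
    (algebraEquiv E G).toHomeomorph.t2Space
  let _ := algebraUniformSpace E G
  exact (isChart_logGroup B).hasVirtualTangent

lemma hasVirtualTangent_dilatedGroup :
    @DilatationGroup.HasVirtualTangent _ (dilatedGroup B) (groupUniformSpace E G) := by
  have : LocallyCompactSpace G := Manifold.locallyCompact_of_finiteDimensional 𝓘(ℝ, E)
  let _ := groupUniformSpace E G
  exact (isChart_dilatedGroup B).hasVirtualTangent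

/-! ### Comparison of the limit operation with N(G, D) -/

/-- The identification of the Lie algebras of `G` and `N` given by an adapted basis, on the model
space. -/
def modelNil (N : SimplyConnectedLieGroup E (Nilpotentisation D)) : E ≃L[ℝ] E :=
  LinearEquiv.toContinuousLinearEquiv ((algebraEquiv E G).toLinearEquiv ≪≫ₗ B.toNil ≪≫ₗ
    N.lieAlgebraEquiv.symm.toLinearEquiv ≪≫ₗ (algebraEquiv E N.carrier).symm.toLinearEquiv)

variable (N : SimplyConnectedLieGroup E (Nilpotentisation D))

lemma groupBracket_modelNil (x y : E) :
    groupBracket E N.carrier (modelNil B N x) (modelNil B N y) =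
      modelNil B N (B.contraction.bracket 0 x y) := by
  refine congrArg (algebraEquiv E N.carrier).symm ?_
  refine (LieEquiv.map_lie N.lieAlgebraEquiv.symm _ _).symm.trans ?_
  exact congrArg N.lieAlgebraEquiv.symm (B.toNil_scaledBracket_zero _ _).symm

lemma eventually_modelExp_modelNil : ∀ᶠ p : E × E in 𝓝 (0, 0),
    (modelExp (modelNil B N (B.contraction.limitMul p)) : N.carrier) =
      modelExp (modelNil B N p.1) * modelExp (modelNil B N p.2) := by
  -- Now L is constant, equal to b read on the model space; it intertwines the bracket of N with c_0
  -- only, hence `S = {0}`.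
  have h := eventually_lieExp_mul (G := N.carrier) B.contraction
    (L := fun _ => (modelNil B N : E →L[ℝ] E)) continuous_const (S := {0}) (by
      rintro _ rfl x y
      exact groupBracket_modelNil B N x y)
  filter_upwards [BracketContraction.eventually_nhds_zero_prodMk h] with p hp
  exact hp rfl

lemma eventually_nilMul_eq : ∀ᶠ p : E × E in 𝓝 (0, 0),
    nilMul B N (algebraEquiv E G p.1) (algebraEquiv E G p.2) =
      algebraEquiv E G (B.contraction.limitMul p) := by
  have ht : Tendsto (fun p : E × E => modelNil B N (B.contraction.limitMul p)) (𝓝 (0, 0)) (𝓝 0) := by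
    have := ((modelNil B N).continuous.tendsto 0).comp B.contraction.tendsto_limitMul
    rwa [map_zero] at this
  filter_upwards [eventually_modelExp_modelNil B N,
    ht.eventually (eventually_modelLog_modelExp (G := N.carrier))] with p h1 h2
  rw [h1] at h2
  have h3 : algebraEquiv E G ((modelNil B N).symm (modelLog ((modelExp (modelNil B N p.1) : N.carrier) *
      modelExp (modelNil B N p.2)))) = algebraEquiv E G (B.contraction.limitMul p) := by
    rw [h2, ContinuousLinearEquiv.symm_apply_apply]
  exact h3

lemma exists_openPartialHomeomorph_nilExp :
    ∃ φ : OpenPartialHomeomorph (GroupLieAlgebra 𝓘(ℝ, E) G) N.carrier,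
      0 ∈ φ.source ∧ EqOn φ (nilExp B N) φ.source := by
  obtain ⟨φ, h0, hφ⟩ := exists_openPartialHomeomorph_lieExp (E := E) (G := N.carrier)
  let h : GroupLieAlgebra 𝓘(ℝ, E) G ≃ₜ GroupLieAlgebra 𝓘(ℝ, E) N.carrier :=
    ((algebraEquiv E G).symm.trans ((modelNil B N).trans (algebraEquiv E N.carrier))).toHomeomorph
  refine ⟨h.transOpenPartialHomeomorph φ, ?_, fun X hX => hφ hX⟩
  change h 0 ∈ φ.source
  have : h 0 = 0 := map_zero
    ((algebraEquiv E G).symm.trans ((modelNil B N).trans (algebraEquiv E N.carrier)))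
  rwa [this]

lemma nilExp_zero : nilExp B N 0 = 1 := by
  rw [nilExp, map_zero, map_zero, lieExp_zero]

lemma tendsto_algebraEquiv_symm_prod :
    Tendsto (fun p : GroupLieAlgebra 𝓘(ℝ, E) G × GroupLieAlgebra 𝓘(ℝ, E) G =>
      ((algebraEquiv E G).symm p.1, (algebraEquiv E G).symm p.2)) (𝓝 (0, 0)) (𝓝 (0, 0)) :=
  (tendsto_algebraEquiv_symm.comp (continuous_fst.tendsto' _ _ rfl)).prodMk_nhds
    (tendsto_algebraEquiv_symm.comp (continuous_snd.tendsto' _ _ rfl))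

lemma isLocalGroupIso_nilExp :
    IsLocalGroupIso 0 (nilMul B N) 1 (· * ·) (nilExp B N) := by
  refine ⟨nilExp_zero B N, exists_openPartialHomeomorph_nilExp B N, ?_⟩
  filter_upwards [tendsto_algebraEquiv_symm_prod.eventually (eventually_nilMul_eq B N),
    tendsto_algebraEquiv_symm_prod.eventually (eventually_modelExp_modelNil B N)] with p h1 h2
  exact (congrArg (nilExp B N) h1).trans h2

/-- Both sides are β read in 𝔤: the left one as the limit of rescaled operations, the right one
because exp_N ∘ b multiplies along β. -/
lemma eventually_virtualTranslation_eq :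
    ∀ᶠ p : GroupLieAlgebra 𝓘(ℝ, E) G × GroupLieAlgebra 𝓘(ℝ, E) G in 𝓝 (0, 0),
      (logGroup B).virtualTranslation p.1 p.2 = nilMul B N p.1 p.2 := by
  have : T2Space (GroupLieAlgebra 𝓘(ℝ, E) G) := (algebraEquiv E G).toHomeomorph.t2Space
  filter_upwards [tendsto_algebraEquiv_symm_prod.eventually (eventually_nilMul_eq B N),
    (isChart_logGroup B).virtualMul_eq] with p h1 h2
  exact h2.trans h1.symm

/-- In the chart exp the virtual operation of G is β, and exp_N ∘ b carries β to the product of N;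
the map is a local homeomorphism as a composite of two. -/
lemma isLocalGroupIso_nilExp_lieLog :
    IsLocalGroupIso 1 (dilatedGroup B).virtualMul 1 (· * ·)
      (fun g => nilExp B N (lieLog g)) := by
  refine ⟨(congrArg (nilExp B N) lieLog_one).trans (nilExp_zero B N), ?_, ?_⟩
  · obtain ⟨φ, h0, hφ, hl⟩ := exists_lieLog_eq E G
    obtain ⟨ψ, h0', hψ⟩ := exists_openPartialHomeomorph_nilExp B N
    refine ⟨φ.symm.trans ψ, ?_, fun g hg => ?_⟩
    · rw [OpenPartialHomeomorph.trans_source]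
      refine ⟨?_, ?_⟩
      · change (1 : G) ∈ φ.target
        rw [← lieExp_zero (E := E), ← hφ h0]
        exact φ.map_source h0
      · rw [mem_preimage, ← hl, lieLog_one]
        exact h0'
    · rw [OpenPartialHomeomorph.trans_source] at hg
      change ψ (φ.symm g) = nilExp B N (lieLog g)
      rw [hl, ← hψ hg.2]
  · have hl : Tendsto (fun p : G × G => ((modelLog p.1 : E), (modelLog p.2 : E)))
        (𝓝 (1, 1)) (𝓝 (0, 0)) :=
      ((isChart_dilatedGroup B).tendsto_symm.comp (continuous_fst.tendsto' _ _ rfl)).prodMk_nhds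
        ((isChart_dilatedGroup B).tendsto_symm.comp (continuous_snd.tendsto' _ _ rfl))
    filter_upwards [(isChart_dilatedGroup B).virtualMul_eq,
      hl.eventually (eventually_modelExp_modelNil B N),
      (B.contraction.tendsto_limitMul.comp hl).eventually
        (eventually_modelLog_modelExp (G := G))] with p h1 h2 h3
    rw [h1]
    refine Eq.trans (congrArg (fun x : E => nilExp B N (algebraEquiv E G x)) h3) h2

end VirtualTangent

end SubRiemLie

end

/-! ### The theorem -/

theorem mainTheorem5 {E : Type*} [NormedAddCommGroup E] [NormedSpace ℝ E] [FiniteDimensional ℝ E]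
    [CompleteSpace E] {G : Type*} [TopologicalSpace G] [T2Space G] [ChartedSpace E G] [Group G]
    [LieGroup 𝓘(ℝ, E) ∞ G] (D : Submodule ℝ (GroupLieAlgebra 𝓘(ℝ, E) G))
    (hD : SubRiemLie.IsBracketGenerating D) :
    -- the basis that defines the dilatations, and the group `N(G, D)`, exist
    Nonempty (SubRiemLie.AdaptedBasis D) ∧
    Nonempty (SubRiemLie.SimplyConnectedLieGroup E (SubRiemLie.Nilpotentisation D)) ∧
    ∀ (B : SubRiemLie.AdaptedBasis D)
      (N : SubRiemLie.SimplyConnectedLieGroup E (SubRiemLie.Nilpotentisation D)),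
      -- `G` and `N` are, as local groups, read in the Lie algebra through their exponentials
      SubRiemLie.IsLocalGroupIso 0 SubRiemLie.logMul 1 (· * ·)
        (SubRiemLie.lieExp : GroupLieAlgebra 𝓘(ℝ, E) G → G) ∧
      SubRiemLie.IsLocalGroupIso 0 (SubRiemLie.nilMul B N) 1 (· * ·) (SubRiemLie.nilExp B N) ∧
      -- the virtual tangent spaces of `log G` at `0` and of `G` at `1` are well defined
      @SubRiemLie.DilatationGroup.HasVirtualTangent _ (SubRiemLie.logGroup B)
        (SubRiemLie.algebraUniformSpace E G) ∧
      (SubRiemLie.logGroup B).VirtualTangentIsLocalGroup ∧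
      @SubRiemLie.DilatationGroup.HasVirtualTangent _ (SubRiemLie.dilatedGroup B)
        (SubRiemLie.groupUniformSpace E G) ∧
      (SubRiemLie.dilatedGroup B).VirtualTangentIsLocalGroup ∧
      -- `N(G, D) = VT₀ log G` as local groups: `L^N_X` is the left translation by `X` in `N(G, D)`
      (∀ᶠ p : GroupLieAlgebra 𝓘(ℝ, E) G × GroupLieAlgebra 𝓘(ℝ, E) G in nhds (0, 0),
        (SubRiemLie.logGroup B).virtualTranslation p.1 p.2 = SubRiemLie.nilMul B N p.1 p.2) ∧
      -- `VT₁ G` is isomorphic to `N(G, D)` as a local group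
      SubRiemLie.IsLocalGroupIso 1 (SubRiemLie.dilatedGroup B).virtualMul 1 (· * ·)
        (fun g => SubRiemLie.nilExp B N (SubRiemLie.lieLog g)) := by 
  have : FiniteDimensional ℝ (GroupLieAlgebra 𝓘(ℝ, E) G) :=
    (SubRiemLie.algebraEquiv E G).toLinearEquiv.finiteDimensional
  obtain ⟨B₀⟩ := SubRiemLie.exists_adaptedBasis D hD
  refine ⟨⟨B₀⟩, ?_, fun B N => ⟨SubRiemLie.isLocalGroupIso_lieExp E G,
    SubRiemLie.isLocalGroupIso_nilExp B N, SubRiemLie.hasVirtualTangent_logGroup B, ?_,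
    SubRiemLie.hasVirtualTangent_dilatedGroup B, ?_,
    SubRiemLie.eventually_virtualTranslation_eq B N,
    SubRiemLie.isLocalGroupIso_nilExp_lieLog B N⟩⟩
  -- The basis `B₀` serves only to construct one group N; the assertions that follow hold for every
  -- adapted basis and every such N.
  · exact (SubRiemLie.integrates_modelExp B₀).nonempty_simplyConnectedLieGroup
      ((SubRiemLie.algebraEquiv E G).toLinearEquiv ≪≫ₗ B₀.toNil)
      fun x y => B₀.toNil_scaledBracket_zero _ _
  · have : T2Space (GroupLieAlgebra 𝓘(ℝ, E) G) :=
      (SubRiemLie.algebraEquiv E G).toHomeomorph.t2Space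
    exact (SubRiemLie.isChart_logGroup B).virtualTangentIsLocalGroup
      (SubRiemLie.integrates_modelExp B)
  · exact (SubRiemLie.isChart_dilatedGroup B).virtualTangentIsLocalGroup
      (SubRiemLie.integrates_modelExp B)
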